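/- **Definitions.** A conservative system on a manifold $M$ is a pair consisting of a smooth Riemannian metric $g$ and a smooth function $U$ on $M$; its Hamiltonian is $H=K+U$ on $T^*M$, with $K=\frac12\sum g^{ij}p_ip_j$. We write it as "metric plus potential", $H=\sum g_{ij}\,dq^i dq^j+U$. A first integral is a smooth function $F:T^*M\to\mathbb R$ with $\{F,H\}=0$. The system has an integral of degree $m$ in momenta if there is a first integral $F$ that is polynomial of degree at most $m$ in the momenta and is independent of $H$ ($dF$ and $dH$ are linearly independent on a dense subset of $T^*M$). Two Hamiltonians $K_1+U_1$ and $K_2+U_2$ on $M$ are equivalent if there are a diffeomorphism $\phi$ of $M$, with induced fibrewise linear (cotangent) lift $\Phi:T^*M\to T^*M$, and nonzero constants $\kappa,\tilde\kappa$ with $\Phi^*K_1=\kappa K_2$ and $\phi^*U_1=\tilde\kappa U_2$. On $S^2=\{u_1^2+u_2^2+u_3^2=1\}$ the Goryachev Hamiltonians are $$\frac{du_1^2+du_2^2+2du_3^2}{2u_1^2+2u_2^2+u_3^2}-2B_1u_1u_2-B_2(u_1^2-u_2^2)-u_1,\qquad B_1,B_2\in\mathbb R,$$ and the Kovalevskaya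 Hamiltonian is the case $B_1=B_2=0$. For $a>-2$ put $A=A(u)=1+au^2+u^4$ and consider, for $\varphi\in[0,2\pi)$, $u\in\mathbb R$, $$H_a=A^{-1/2}\left(d\varphi^2+A^{-1/2}du^2\right)-\frac u2\left((a+2u^2)-2A^{1/2}\right)\cos\varphi .$$ Let $y=\int_0^u A(t)^{-1/4}\,dt$ and let $(\varphi,u)$ stand for the point $$\left(\frac{\cos\varphi}{\cosh y},\ \frac{\sin\varphi}{\cosh y},\ \tanh y\right)\in S^2,$$ whose stereographic projection has polar coordinates $(\varphi,r)$ with $r=e^y$. **Theorem.** 1. For every $a>-2$, $(\varphi,u)\in[0,2\pi)\times\mathbb R$ parametrizes bijectively $S^2$ without its two poles $(0,0,\pm1)$, and there is exactly one smooth conservative system on $S^2$ whose metric and potential in the coordinates $(\varphi,u)$ are those of $H_a$. It has an integral of fourth degree in momenta. 2. If $a\neq2$, there is no linear or quadratic integral; more precisely, every first integral that is polynomial of degree at most $2$ in momenta is functionally dependent on $H$ at every point of $T^*S^2$. 3. If $a=2$, the potential vanishes identically and the metric has constant positive curvature. 4. For different values $a_1\neq a_2$ of the parameter (both $>-2$)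 the resulting Hamiltonians on $S^2$ are not equivalent. 5. For no $a>-2$ is the resulting Hamiltonian equivalent to the Kovalevskaya Hamiltonian or to a Goryachev Hamiltonian. -/

import Mathlib

open scoped Manifold ContDiff

noncomputable section

/-! ## Conservative systems on a manifold -/

section Systems

variable {n : ℕ} {M : Type*} [TopologicalSpace M] [ChartedSpace (EuclideanSpace ℝ (Fin n)) M]

/-- A smooth Riemannian metric on `M`. -/
abbrev SmoothMetric (n : ℕ) (M : Type*) [TopologicalSpace M]
    [ChartedSpace (EuclideanSpace ℝ (Fin n)) M] [IsManifold (𝓡 n) ∞ M] :=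
  Bundle.ContMDiffRiemannianMetric (𝓡 n) ∞ (EuclideanSpace ℝ (Fin n))
    (fun x : M => TangentSpace (𝓡 n) x)

/-- A conservative system: a smooth Riemannian metric and a smooth potential. -/
structure ConservativeSystem (n : ℕ) (M : Type*) [TopologicalSpace M]
    [ChartedSpace (EuclideanSpace ℝ (Fin n)) M] [IsManifold (𝓡 n) ∞ M] where
  /-- the Riemannian metric -/
  metric : SmoothMetric n M
  /-- the potential -/
  potential : M → ℝ
  potential_smooth : ContMDiff (𝓡 n) 𝓘(ℝ, ℝ) ∞ potential

/-- A real function on the cotangent bundle `T*M`: a value for each point `x` and each covector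
at `x`. -/
abbrev PhaseFunction (n : ℕ) (M : Type*) [TopologicalSpace M]
    [ChartedSpace (EuclideanSpace ℝ (Fin n)) M] :=
  (x : M) → (TangentSpace (𝓡 n) x →L[ℝ] ℝ) → ℝ

namespace PhaseFunction

/-- `F` in the canonical coordinates `(q, p)` of `T*M` induced by a chart `e` of `M`:
`(q, p)` is the covector `∑ pᵢ dqᵢ` at the point with coordinates `q`. -/
def inChart (F : PhaseFunction n M) (e : OpenPartialHomeomorph M (EuclideanSpace ℝ (Fin n)))
    (z : EuclideanSpace ℝ (Fin n) × EuclideanSpace ℝ (Fin n)) : ℝ :=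
  F (e.symm z.1) ((innerSL ℝ z.2).comp (mfderiv (𝓡 n) (𝓡 n) e (e.symm z.1)))

/-- `F` is smooth on `T*M`. -/
def Smooth (F : PhaseFunction n M) : Prop :=
  ∀ e ∈ atlas (EuclideanSpace ℝ (Fin n)) M, ContDiffOn ℝ ∞ (F.inChart e) (e.target ×ˢ Set.univ)

/-- The Poisson bracket `∑ᵢ (∂F/∂qᵢ ∂G/∂pᵢ - ∂F/∂pᵢ ∂G/∂qᵢ)` in the canonical coordinates of the
chart `e`. -/
def poissonInChart (F G : PhaseFunction n M)
    (e : OpenPartialHomeomorph M (EuclideanSpace ℝ (Fin n)))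
    (z : EuclideanSpace ℝ (Fin n) × EuclideanSpace ℝ (Fin n)) : ℝ :=
  ∑ i : Fin n,
    (fderiv ℝ (F.inChart e) z (EuclideanSpace.single i 1, 0) *
        fderiv ℝ (G.inChart e) z (0, EuclideanSpace.single i 1) -
      fderiv ℝ (F.inChart e) z (0, EuclideanSpace.single i 1) *
        fderiv ℝ (G.inChart e) z (EuclideanSpace.single i 1, 0))

/-- `F` and `G` are in involution. -/
def PoissonCommute (F G : PhaseFunction n M) : Prop :=
  ∀ e ∈ atlas (EuclideanSpace ℝ (Fin n)) M, ∀ z ∈ e.target ×ˢ (Set.univ : Set _),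
    F.poissonInChart G e z = 0

/-- `F` is polynomial of degree at most `m` in momenta: on each cotangent space it is a polynomial
of total degree at most `m` in the components `pᵢ` of the covector. -/
def PolynomialInMomenta (m : ℕ) (F : PhaseFunction n M) : Prop :=
  ∀ e ∈ atlas (EuclideanSpace ℝ (Fin n)) M, ∀ q ∈ e.target,
    ∃ P : MvPolynomial (Fin n) ℝ, P.totalDegree ≤ m ∧
      ∀ p : EuclideanSpace ℝ (Fin n), F.inChart e (q, p) = MvPolynomial.eval (fun i => p i) P

/-- The differentials `dF` and `dG` are linearly independent at the point of `T*M` with canonical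
coordinates `z`. -/
def IndependentAt (F G : PhaseFunction n M)
    (e : OpenPartialHomeomorph M (EuclideanSpace ℝ (Fin n)))
    (z : EuclideanSpace ℝ (Fin n) × EuclideanSpace ℝ (Fin n)) : Prop :=
  LinearIndependent ℝ ![fderiv ℝ (F.inChart e) z, fderiv ℝ (G.inChart e) z]

/-- `F` and `G` are functionally independent: `dF` and `dG` are linearly independent on a dense
subset of `T*M`. -/
def Independent (F G : PhaseFunction n M) : Prop :=
  ∀ e ∈ atlas (EuclideanSpace ℝ (Fin n)) M,
    e.target ×ˢ (Set.univ : Set (EuclideanSpace ℝ (Fin n))) ⊆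
      closure {z | z.1 ∈ e.target ∧ F.IndependentAt G e z}

/-- `dF` and `dG` are linearly dependent at every point of `T*M`. -/
def EverywhereDependent (F G : PhaseFunction n M) : Prop :=
  ∀ e ∈ atlas (EuclideanSpace ℝ (Fin n)) M, ∀ z ∈ e.target ×ˢ (Set.univ : Set _),
    ¬ F.IndependentAt G e z

end PhaseFunction

variable [IsManifold (𝓡 n) ∞ M]

namespace SmoothMetric

/-- The components `g_ij` of a metric in a chart. -/
def gram (g : SmoothMetric n M) (e : OpenPartialHomeomorph M (EuclideanSpace ℝ (Fin n)))
    (q : EuclideanSpace ℝ (Fin n)) : Matrix (Fin n) (Fin n) ℝ :=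
  Matrix.of fun i j =>
    g.inner (e.symm q)
      (mfderiv (𝓡 n) (𝓡 n) e.symm q (EuclideanSpace.single i (1 : ℝ) : EuclideanSpace ℝ (Fin n)))
      (mfderiv (𝓡 n) (𝓡 n) e.symm q (EuclideanSpace.single j (1 : ℝ) : EuclideanSpace ℝ (Fin n)))

/-- The partial derivative `∂f/∂qᵢ`. -/
def pd (i : Fin n) (f : EuclideanSpace ℝ (Fin n) → ℝ) (q : EuclideanSpace ℝ (Fin n)) : ℝ :=
  fderiv ℝ f q (EuclideanSpace.single i 1)

/-- The Christoffel symbols `Γ^k_ij` in a chart. -/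
def christoffel (g : SmoothMetric n M) (e : OpenPartialHomeomorph M (EuclideanSpace ℝ (Fin n)))
    (k i j : Fin n) (q : EuclideanSpace ℝ (Fin n)) : ℝ :=
  (1 / 2) * ∑ l : Fin n, (g.gram e q)⁻¹ k l *
    (pd i (fun y => g.gram e y j l) q + pd j (fun y => g.gram e y i l) q
      - pd l (fun y => g.gram e y i j) q)

/-- The components `R^l_kij` of the curvature tensor in a chart:
`R(∂ᵢ, ∂ⱼ) ∂ₖ = ∑ₗ R^l_kij ∂ₗ`. -/
def riemann (g : SmoothMetric n M) (e : OpenPartialHomeomorph M (EuclideanSpace ℝ (Fin n)))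
    (l k i j : Fin n) (q : EuclideanSpace ℝ (Fin n)) : ℝ :=
  pd i (g.christoffel e l j k) q - pd j (g.christoffel e l i k) q
    + ∑ s : Fin n, (g.christoffel e l i s q * g.christoffel e s j k q
      - g.christoffel e l j s q * g.christoffel e s i k q)

/-- The metric has constant sectional curvature `c`:
`R(X, Y) Z = c (g(Y, Z) X - g(X, Z) Y)`. -/
def HasConstantCurvature (g : SmoothMetric n M) (c : ℝ) : Prop :=
  ∀ e ∈ atlas (EuclideanSpace ℝ (Fin n)) M, ∀ q ∈ e.target, ∀ l k i j : Fin n,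
    g.riemann e l k i j q =
      c * (g.gram e q j k * (if l = i then 1 else 0) - g.gram e q i k * (if l = j then 1 else 0))

theorem flat_bijective (g : SmoothMetric n M) (x : M) :
    Function.Bijective (g.inner x).toLinearMap := by
  have hinj : Function.Injective (g.inner x).toLinearMap := by
    rw [injective_iff_map_eq_zero]
    intro v hv
    by_contra h
    have h1 := g.pos x v h
    have h2 : g.inner x v = 0 := hv
    rw [h2] at h1
    simp at h1
  refine ⟨hinj, ?_⟩
  let f : EuclideanSpace ℝ (Fin n) →ₗ[ℝ] (EuclideanSpace ℝ (Fin n) →L[ℝ] ℝ) :=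
    (g.inner x).toLinearMap
  have hd : Module.finrank ℝ (EuclideanSpace ℝ (Fin n)) =
      Module.finrank ℝ (EuclideanSpace ℝ (Fin n) →L[ℝ] ℝ) :=
    ((InnerProductSpace.toDual ℝ (EuclideanSpace ℝ (Fin n))).toLinearEquiv).finrank_eq
  exact (LinearMap.injective_iff_surjective_of_finrank_eq_finrank (f := f) hd).1 hinj

/-- The musical isomorphism `v ↦ g(v, ·)` from the tangent to the cotangent space. -/
def flat (g : SmoothMetric n M) (x : M) :
    TangentSpace (𝓡 n) x ≃ₗ[ℝ] (TangentSpace (𝓡 n) x →L[ℝ] ℝ) :=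
  LinearEquiv.ofBijective (g.inner x).toLinearMap (g.flat_bijective x)

/-- The kinetic energy `½ ∑ g^ij pᵢ pⱼ` on `T*M`. -/
def kinetic (g : SmoothMetric n M) : PhaseFunction n M :=
  fun x p => (1 / 2) * p ((g.flat x).symm p)

end SmoothMetric

namespace ConservativeSystem

/-- The Hamiltonian `H = K + U` on `T*M`. -/
def hamiltonian (S : ConservativeSystem n M) : PhaseFunction n M :=
  fun x p => S.metric.kinetic x p + S.potential x

/-- `F` is a smooth first integral of the Hamiltonian system of `S`. -/
def IsFirstIntegral (S : ConservativeSystem n M) (F : PhaseFunction n M) : Prop :=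
  F.Smooth ∧ F.PoissonCommute S.hamiltonian

/-- The system possesses an integral of degree `m` in momenta, independent of the Hamiltonian. -/
def HasIntegralOfDegree (S : ConservativeSystem n M) (m : ℕ) : Prop :=
  ∃ F : PhaseFunction n M, S.IsFirstIntegral F ∧ F.PolynomialInMomenta m ∧
    F.Independent S.hamiltonian

/-- Equivalence of the Hamiltonians `K₁ + U₁` and `K₂ + U₂`: for a diffeomorphism `φ` of `M`, with
the induced fibrewise linear diffeomorphism `Φ` of `T*M` over `φ` (which sends the covector
`p ∘ dφ` at `x` to the covector `p` at `φ x`), and nonzero constants `κ`, `κ'`, one has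
`Φ^* K₁ = κ K₂` and `φ^* U₁ = κ' U₂`. -/
def Equivalent (S₁ S₂ : ConservativeSystem n M) : Prop :=
  ∃ (φ : M ≃ₘ^∞⟮𝓡 n, 𝓡 n⟯ M) (κ κ' : ℝ), κ ≠ 0 ∧ κ' ≠ 0 ∧
    (∀ (x : M) (p : TangentSpace (𝓡 n) (φ x) →L[ℝ] ℝ),
      S₁.metric.kinetic (φ x) p = κ * S₂.metric.kinetic x (p.comp (mfderiv (𝓡 n) (𝓡 n) φ x))) ∧
    ∀ x : M, S₁.potential (φ x) = κ' * S₂.potential x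

end ConservativeSystem

end Systems

/-! ## The sphere and the systems of Kovalevskaya and Goryachev -/

/-- The unit sphere `S²` in `ℝ³`. -/
abbrev S2 : Type := Metric.sphere (0 : EuclideanSpace ℝ (Fin 3)) 1

namespace S2

/-- The differential `duᵢ` of the coordinate function `uᵢ` of `ℝ³` restricted to the sphere, at
the point `x`. -/
def du (i : Fin 3) (x : S2) : TangentSpace (𝓡 2) x →L[ℝ] ℝ :=
  (EuclideanSpace.proj i : EuclideanSpace ℝ (Fin 3) →L[ℝ] ℝ).comp
    (mvfderiv (𝓡 2) ((↑) : S2 → EuclideanSpace ℝ (Fin 3)) x)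

/-- The form `(du₁² + du₂² + 2 du₃²) / (2 u₁² + 2 u₂² + u₃²)` at the point `x`. -/
def kovalevskayaForm (x : S2) : TangentSpace (𝓡 2) x →L[ℝ] TangentSpace (𝓡 2) x →L[ℝ] ℝ :=
  (2 * x.1 0 ^ 2 + 2 * x.1 1 ^ 2 + x.1 2 ^ 2)⁻¹ •
    ((du 0 x).smulRight (du 0 x) + (du 1 x).smulRight (du 1 x) +
      (2 : ℝ) • (du 2 x).smulRight (du 2 x))


theorem kovDenom_pos (x : S2) : 0 < 2 * x.1 0 ^ 2 + 2 * x.1 1 ^ 2 + x.1 2 ^ 2 := by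
  have h : ‖x.1‖ = 1 := by simp
  have h2 : x.1 0 ^ 2 + x.1 1 ^ 2 + x.1 2 ^ 2 = 1 := by
    have := EuclideanSpace.real_norm_sq_eq x.1
    rw [h, Fin.sum_univ_three] at this
    linarith
  nlinarith [sq_nonneg (x.1 0), sq_nonneg (x.1 1)]

theorem kovalevskayaForm_apply (x : S2) (v w : TangentSpace (𝓡 2) x) :
    kovalevskayaForm x v w =
      (2 * x.1 0 ^ 2 + 2 * x.1 1 ^ 2 + x.1 2 ^ 2)⁻¹ *
        (du 0 x v * du 0 x w + du 1 x v * du 1 x w + 2 * (du 2 x v * du 2 x w)) := by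
  simp [kovalevskayaForm]
  ring

theorem du_separates (x : S2) (v : TangentSpace (𝓡 2) x) (h : ∀ i, du i x v = 0) : v = 0 := by
  have : Fact (Module.finrank ℝ (EuclideanSpace ℝ (Fin 3)) = 2 + 1) := ⟨by simp⟩
  apply injective_mvfderiv_subtypeVal_sphere (n := 2) x
  rw [map_zero]
  ext i
  exact h i

theorem kovalevskayaForm_pos (x : S2) (v : TangentSpace (𝓡 2) x) (hv : v ≠ 0) :
    0 < kovalevskayaForm x v v := by
  rw [kovalevskayaForm_apply]
  refine mul_pos (inv_pos.2 (kovDenom_pos x)) ?_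
  by_contra hcon
  apply hv
  apply du_separates
  have h0 := mul_self_nonneg (du 0 x v)
  have h1 := mul_self_nonneg (du 1 x v)
  have h2 := mul_self_nonneg (du 2 x v)
  have e0 : du 0 x v = 0 := mul_self_eq_zero.1 (by linarith)
  have e1 : du 1 x v = 0 := mul_self_eq_zero.1 (by linarith)
  have e2 : du 2 x v = 0 := mul_self_eq_zero.1 (by linarith)
  exact Fin.forall_fin_succ.2 ⟨e0, Fin.forall_fin_succ.2 ⟨e1, Fin.forall_fin_succ.2
    ⟨e2, fun i => i.elim0⟩⟩⟩

theorem isVonNBounded_of_pos (B : EuclideanSpace ℝ (Fin 2) →L[ℝ] EuclideanSpace ℝ (Fin 2) →L[ℝ] ℝ)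
    (hB : ∀ v, v ≠ 0 → 0 < B v v) : Bornology.IsVonNBounded ℝ {v | B v v < 1} := by
  rw [NormedSpace.isVonNBounded_iff]
  have hc : Continuous fun v => B v v := by fun_prop
  obtain ⟨v₀, hv₀, hmin⟩ := (isCompact_sphere (0 : EuclideanSpace ℝ (Fin 2)) 1).exists_isMinOn
    ⟨EuclideanSpace.single 0 1, by simp⟩ hc.continuousOn
  have hv₀' : ‖v₀‖ = 1 := by simpa using hv₀
  have hpos : 0 < B v₀ v₀ := hB v₀ (by rintro rfl; simp at hv₀')
  refine (Metric.isBounded_iff_subset_closedBall 0).2 ⟨1 / B v₀ v₀ + 1, ?_⟩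
  intro v hv
  rw [mem_closedBall_zero_iff]
  by_cases h : v = 0
  · subst h; simp; positivity
  have hn : 0 < ‖v‖ := norm_pos_iff.2 h
  have h1 : B v₀ v₀ ≤ B (‖v‖⁻¹ • v) (‖v‖⁻¹ • v) := hmin (by simp [norm_smul, hn.ne'])
  simp only [map_smul, _root_.smul_apply, smul_eq_mul] at h1
  have hv1 : B v v < 1 := hv
  have h2 : B v₀ v₀ * ‖v‖ ^ 2 < 1 := by
    have : B v₀ v₀ * ‖v‖ ^ 2 ≤ ‖v‖⁻¹ * (‖v‖⁻¹ * B v v) * ‖v‖ ^ 2 := by gcongr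
    have h3 : ‖v‖⁻¹ * (‖v‖⁻¹ * B v v) * ‖v‖ ^ 2 = B v v := by field_simp
    linarith
  have h4 : ‖v‖ ^ 2 < 1 / B v₀ v₀ := by rw [lt_div_iff₀ hpos]; linarith
  nlinarith [sq_nonneg (‖v‖ - 1)]

theorem contDiff_fst_smul {W X : Type*} [NormedAddCommGroup W] [NormedSpace ℝ W]
    [NormedAddCommGroup X] [NormedSpace ℝ X] {f : ℝ × W → X} (hf : ContDiff ℝ ∞ f) :
    ContDiff ℝ ∞ (fun z : ℝ × W => z.1 • f z) :=
  contDiff_fst.smul hf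

theorem contDiff_quadForm {F G : Type*} [NormedAddCommGroup F] [NormedSpace ℝ F]
    [NormedAddCommGroup G] [NormedSpace ℝ G] (l : Fin 3 → G →L[ℝ] ℝ) :
    ContDiff ℝ ∞ (fun z : ℝ × (F →L[ℝ] G) =>
      z.1 • (((l 0).comp z.2).smulRight ((l 0).comp z.2) +
        ((l 1).comp z.2).smulRight ((l 1).comp z.2) +
        (2 : ℝ) • ((l 2).comp z.2).smulRight ((l 2).comp z.2))) := by
  have hD : ∀ i : Fin 3, ContDiff ℝ ∞ (fun z : ℝ × (F →L[ℝ] G) => (l i).comp z.2) :=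
    fun i => contDiff_const.clm_comp contDiff_snd
  have h : ∀ i : Fin 3, ContDiff ℝ ∞
      (fun z : ℝ × (F →L[ℝ] G) => ((l i).comp z.2).smulRight ((l i).comp z.2)) :=
    fun i => (hD i).smulRight (hD i)
  have h2 := (h 2).const_smul (2 : ℝ)
  exact contDiff_fst_smul (((h 0).add (h 1)).add h2)

theorem quadForm_apply {F : Type*} [NormedAddCommGroup F] [NormedSpace ℝ F]
    (c : ℝ) (a b d : F →L[ℝ] ℝ) (v w : F) :
    (c • (a.smulRight a + b.smulRight b + (2 : ℝ) • d.smulRight d)) v w =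
      c * (a v * a w + b v * b w + 2 * (d v * d w)) := by
  simp
  ring

theorem contMDiff_kovalevskayaForm :
    ContMDiff (𝓡 2)
      ((𝓡 2).prod 𝓘(ℝ, EuclideanSpace ℝ (Fin 2) →L[ℝ] EuclideanSpace ℝ (Fin 2) →L[ℝ] ℝ)) ∞
      (fun x : S2 => Bundle.TotalSpace.mk'
        (EuclideanSpace ℝ (Fin 2) →L[ℝ] EuclideanSpace ℝ (Fin 2) →L[ℝ] ℝ)
        (E := fun x : S2 => TangentSpace (𝓡 2) x →L[ℝ] TangentSpace (𝓡 2) x →L[ℝ] ℝ)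
        x (kovalevskayaForm x)) := by
  have : Fact (Module.finrank ℝ (EuclideanSpace ℝ (Fin 3)) = 2 + 1) := ⟨by simp⟩
  intro x₀
  have hcoe : ContMDiff (𝓡 2) 𝓘(ℝ, EuclideanSpace ℝ (Fin 3)) ∞
      ((↑) : S2 → EuclideanSpace ℝ (Fin 3)) := contMDiff_coe_sphere (n := 2)
  have hT := (hcoe x₀).mfderiv_const (m := ∞) (by simp)
  let T : S2 → EuclideanSpace ℝ (Fin 2) →L[ℝ] EuclideanSpace ℝ (Fin 3) :=
    inTangentCoordinates (𝓡 2) 𝓘(ℝ, EuclideanSpace ℝ (Fin 3)) id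
      ((↑) : S2 → EuclideanSpace ℝ (Fin 3))
      (mfderiv (𝓡 2) 𝓘(ℝ, EuclideanSpace ℝ (Fin 3)) ((↑) : S2 → EuclideanSpace ℝ (Fin 3))) x₀
  have hQ := contDiff_quadForm (F := EuclideanSpace ℝ (Fin 2))
    (fun i => (EuclideanSpace.proj i : EuclideanSpace ℝ (Fin 3) →L[ℝ] ℝ))
  have hc : ContMDiffAt (𝓡 2) 𝓘(ℝ, ℝ) ∞
      (fun x : S2 => (2 * x.1 0 ^ 2 + 2 * x.1 1 ^ 2 + x.1 2 ^ 2)⁻¹) x₀ := by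
    have hp : ContDiff ℝ ∞
        (fun y : EuclideanSpace ℝ (Fin 3) => 2 * y 0 ^ 2 + 2 * y 1 ^ 2 + y 2 ^ 2) := by fun_prop
    exact (hp.contDiffAt.inv (kovDenom_pos x₀).ne').contMDiffAt.comp x₀ (hcoe x₀)
  rw [contMDiffAt_hom_bundle]
  refine ⟨contMDiffAt_id, ?_⟩
  refine (hQ.contMDiff.contMDiffAt.comp x₀ (hc.prodMk_space hT)).congr_of_eventuallyEq ?_
  filter_upwards [(trivializationAt (EuclideanSpace ℝ (Fin 2))
    (fun x : S2 => TangentSpace (𝓡 2) x) x₀).open_baseSet.mem_nhds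
      (FiberBundle.mem_baseSet_trivializationAt' x₀)] with x hx
  have hTx : ∀ v, T x v = mvfderiv (𝓡 2) ((↑) : S2 → EuclideanSpace ℝ (Fin 3)) x
      ((trivializationAt (EuclideanSpace ℝ (Fin 2))
        (fun x : S2 => TangentSpace (𝓡 2) x) x₀).symm x v) := by
    intro v
    simp only [T, inTangentCoordinates, id]
    rw [ContinuousLinearMap.inCoordinates_eq hx (by simp; trivial)]
    simp [mvfderiv]
    rfl
  ext v w
  rw [inCoordinates_apply_eq₂ hx hx (Set.mem_univ _)]
  refine Eq.trans ?_ (quadForm_apply _ _ _ _ v w).symm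
  simp only [ContinuousLinearMap.comp_apply]
  change _ = _ * (EuclideanSpace.proj 0 (T x v) * EuclideanSpace.proj 0 (T x w) +
    EuclideanSpace.proj 1 (T x v) * EuclideanSpace.proj 1 (T x w) +
    2 * (EuclideanSpace.proj 2 (T x v) * EuclideanSpace.proj 2 (T x w)))
  rw [hTx, hTx]
  rw [kovalevskayaForm_apply]
  simp only [Bundle.Trivial.fiberBundle_trivializationAt', Bundle.Trivial.linearMapAt_trivialization]
  rfl

/-- The Riemannian metric `(du₁² + du₂² + 2 du₃²) / (2 u₁² + 2 u₂² + u₃²)` on `S²`. -/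
def kovalevskayaMetric : SmoothMetric 2 S2 where
  inner := kovalevskayaForm
  symm x v w := by rw [kovalevskayaForm_apply, kovalevskayaForm_apply]; ring
  pos := kovalevskayaForm_pos
  isVonNBounded x := isVonNBounded_of_pos (kovalevskayaForm x) (kovalevskayaForm_pos x)
  contMDiff := contMDiff_kovalevskayaForm

/-- The Goryachev system with parameters `B₁`, `B₂`, with potential
`-2 B₁ u₁ u₂ - B₂ (u₁² - u₂²) - u₁`. -/
def goryachev (B₁ B₂ : ℝ) : ConservativeSystem 2 S2 where
  metric := kovalevskayaMetric
  potential x := -2 * B₁ * x.1 0 * x.1 1 - B₂ * (x.1 0 ^ 2 - x.1 1 ^ 2) - x.1 0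
  potential_smooth := by
    have : Fact (Module.finrank ℝ (EuclideanSpace ℝ (Fin 3)) = 2 + 1) := ⟨by simp⟩
    have hp : ContDiff ℝ ∞ (fun y : EuclideanSpace ℝ (Fin 3) =>
      -2 * B₁ * y 0 * y 1 - B₂ * (y 0 ^ 2 - y 1 ^ 2) - y 0) := by fun_prop
    exact hp.contMDiff.comp (contMDiff_coe_sphere (n := 2))

/-- The Kovalevskaya system, with potential `-u₁`. -/
def kovalevskaya : ConservativeSystem 2 S2 where
  metric := kovalevskayaMetric
  potential x := -x.1 0
  potential_smooth := by
    have : Fact (Module.finrank ℝ (EuclideanSpace ℝ (Fin 3)) = 2 + 1) := ⟨by simp⟩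
    have hp : ContDiff ℝ ∞ (fun y : EuclideanSpace ℝ (Fin 3) => -y 0) := by fun_prop
    exact hp.contMDiff.comp (contMDiff_coe_sphere (n := 2))

end S2

/-! ## The family of Hamiltonians in the coordinates `(φ, u)` -/

/-- `A(u, a, b) = b + a u² + u⁴`. -/
def quarticA (u a b : ℝ) : ℝ := b + a * u ^ 2 + u ^ 4

/-- The variable `y` with `dy = A(u, a, 1)^(-1/4) du`, normalized by `y = 0` at `u = 0`. It turns
`A^(-1/2) (dφ² + A^(-1/2) du²)` into `A^(-1/2) (dφ² + dy²)`. -/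
def conformalY (a u : ℝ) : ℝ := ∫ t in (0 : ℝ)..u, (quarticA t a 1) ^ (-(1 / 4) : ℝ)

theorem polarPoint_mem (φ y : ℝ) :
    !₂[Real.cos φ / Real.cosh y, Real.sin φ / Real.cosh y, Real.tanh y] ∈
      Metric.sphere (0 : EuclideanSpace ℝ (Fin 3)) 1 := by
  have hc := Real.cosh_pos y
  rw [mem_sphere_zero_iff_norm, EuclideanSpace.norm_eq, Real.sqrt_eq_one, Fin.sum_univ_three]
  simp only [Real.norm_eq_abs, sq_abs, Real.tanh_eq_sinh_div_cosh]
  simp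
  field_simp
  nlinarith [Real.sin_sq_add_cos_sq φ, Real.cosh_sq y]

/-- The point of `S²` with coordinates `(φ, u)`: its stereographic projection to the equatorial
plane has polar coordinates `(φ, r)` with `r = exp y`. -/
def polarParam (a : ℝ) (z : ℝ × ℝ) : S2 :=
  ⟨!₂[Real.cos z.1 / Real.cosh (conformalY a z.2), Real.sin z.1 / Real.cosh (conformalY a z.2),
    Real.tanh (conformalY a z.2)], polarPoint_mem _ _⟩

/-- The conservative system `S` on `S²` extends the Hamiltonian
`A^(-1/2) (dφ² + A^(-1/2) du²) - (u/2) ((a + 2 u²) - 2 A^(1/2)) cos φ`, `A = A(u, a, 1)`: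
in the coordinates `(φ, u)` on the sphere without the poles, `S` has this metric and this
potential. -/
structure ExtendsH1 (a : ℝ) (S : ConservativeSystem 2 S2) : Prop where
  metric_eq : ∀ z v w : ℝ × ℝ,
    S.metric.inner (polarParam a z)
        (mfderiv 𝓘(ℝ, ℝ × ℝ) (𝓡 2) (polarParam a) z v)
        (mfderiv 𝓘(ℝ, ℝ × ℝ) (𝓡 2) (polarParam a) z w) =
      (√(quarticA z.2 a 1))⁻¹ * (v.1 * w.1 + (√(quarticA z.2 a 1))⁻¹ * (v.2 * w.2))
  potential_eq : ∀ z : ℝ × ℝ,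
    S.potential (polarParam a z) =
      -(z.2 / 2) * ((a + 2 * z.2 ^ 2) - 2 * √(quarticA z.2 a 1)) * Real.cos z.1

end

/-! With `dy = A^(-1/4) du` the metric is `A^(-1/2) (dφ² + dy²)`, while the round metric is `(dφ² +
dy²) / cosh² y`. It is therefore conformal to the round metric with factor `cosh² y / √A`, and the
only question is smoothness at the poles. There the variable `V = u / √(1 + u²)` helps: `y - arsinh
u` is a smooth function of `V` near `[-1, 1]`, so the height `tanh y` is too, with positive
derivative, and every coefficient becomes a smooth function of the height
(`exists_smooth_coefficients`). For the potential the key identity is `(a + 2u² - 2√A)(a + 2u² +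
2√A) = a² - 4`. Uniqueness is continuity, since only two points are missing.

The integral of degree four is explicit: `p_φ⁴ + 4 p_φ (u cos φ p_φ - √A sin φ p_u) + (a + 2u² -
2√A) sin² φ`. Its bracket with `H` is computed in polar coordinates
(`canonicalBracket_polarQuartic`). Invariance of the Poisson bracket under point transformations
(`canonicalBracket_pullback`) and density carry the result to all stereographic charts.

For an integral of degree at most two, the coefficients of each monomial in the momenta give
equations that can be integrated in `u`. If `a ≠ 2`, the quadratic part must be a combination of the
kinetic energy and `p_φ²`, and the linear part a multiple of `p_φ` (`leading_coefficients`,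
`linear_coefficients`). The potential is not rotation invariant, so only `2γH + r` survives. For `a
= 2` one has `√A = 1 + u²` and `y = arsinh u`: the metric is round and the potential zero.

Inequivalence is read off from critical points of the potential. An equivalence preserves critical
points, multiplies critical values by a constant, and multiplies the eigenvalues of the Hessian
relative to the metric by a constant. For `a ≠ 2` the critical points with nonzero value satisfy `√A
= 2u²`; with `x = u²` this is `3x² = ax + 1`, which has one positive root. The eigenvalues there are
`-2x U` and `-(6x - a) U`; comparing them for two parameters gives `a₁ = κ a₂`, `x₁ = κ x₂` and then
`κ = 1` (`not_equivalent_of_ne`).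

Against the Goryachev systems, the point `φ = π/2`, `u = 0` is a critical point of value zero with
opposite nonzero eigenvalues. A Goryachev potential has such a point only if `B₂ = 0` and `4 B₁² >
1` (`parameters_of_saddle`). But then two of its critical points on the equator have nonzero values
of different squares, whereas in the family all nonzero critical values have the same square
(`potential_sq_eq`). -/

noncomputable section

/-! ## Calculus of the functions of one variable in the family -/

/-- `A = (u² - 1)² + (a + 2) u²`: this is where `a > -2` enters. -/
theorem quarticA_pos {a : ℝ} (ha : -2 < a) (u : ℝ) : 0 < quarticA u a 1 := by
  unfold quarticA
  rcases eq_or_ne u 0 with rfl | h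
  · norm_num
  · have : 0 < u ^ 2 := by positivity
    nlinarith [sq_nonneg (u ^ 2 - 1)]

theorem quarticA_neg (a u : ℝ) : quarticA (-u) a 1 = quarticA u a 1 := by
  simp [quarticA, Even.neg_pow (by decide : Even 2), Even.neg_pow (by decide : Even 4)]

theorem contDiff_quarticA (a : ℝ) : ContDiff ℝ ∞ (fun u => quarticA u a 1) := by
  unfold quarticA; fun_prop

theorem contDiff_quarticA_rpow {a : ℝ} (ha : -2 < a) (r : ℝ) :
    ContDiff ℝ ∞ (fun u => (quarticA u a 1) ^ r) :=
  (contDiff_quarticA a).rpow_const_of_ne fun u => (quarticA_pos ha u).ne'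

theorem hasDerivAt_conformalY {a : ℝ} (ha : -2 < a) (u : ℝ) :
    HasDerivAt (conformalY a) ((quarticA u a 1) ^ (-(1 / 4) : ℝ)) u := by
  have hc := (contDiff_quarticA_rpow ha (-(1 / 4))).continuous
  exact intervalIntegral.integral_hasDerivAt_right (hc.intervalIntegrable _ _)
    hc.stronglyMeasurable.stronglyMeasurableAtFilter hc.continuousAt

theorem contDiff_conformalY {a : ℝ} (ha : -2 < a) : ContDiff ℝ ∞ (conformalY a) := by
  rw [contDiff_infty_iff_deriv]
  refine ⟨fun u => (hasDerivAt_conformalY ha u).differentiableAt, ?_⟩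
  have : deriv (conformalY a) = fun u => (quarticA u a 1) ^ (-(1 / 4) : ℝ) :=
    funext fun u => (hasDerivAt_conformalY ha u).deriv
  rw [this]
  exact contDiff_quarticA_rpow ha _

/-- The root `A^(1/4)`. -/
def quarticRoot (a u : ℝ) : ℝ := (quarticA u a 1) ^ (1 / 4 : ℝ)

theorem quarticRoot_pos {a : ℝ} (ha : -2 < a) (u : ℝ) : 0 < quarticRoot a u :=
  Real.rpow_pos_of_pos (quarticA_pos ha u) _

theorem quarticRoot_sq {a : ℝ} (ha : -2 < a) (u : ℝ) :
    quarticRoot a u ^ 2 = √(quarticA u a 1) := by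
  rw [quarticRoot, ← Real.rpow_natCast, ← Real.rpow_mul (quarticA_pos ha u).le,
    Real.sqrt_eq_rpow]
  norm_num

theorem quarticRoot_pow_four {a : ℝ} (ha : -2 < a) (u : ℝ) :
    quarticRoot a u ^ 4 = quarticA u a 1 := by
  rw [show (4 : ℕ) = 2 * 2 from rfl, pow_mul, quarticRoot_sq ha, Real.sq_sqrt (quarticA_pos ha u).le]

theorem hasDerivAt_conformalY' {a : ℝ} (ha : -2 < a) (u : ℝ) :
    HasDerivAt (conformalY a) (quarticRoot a u)⁻¹ u := by
  have := hasDerivAt_conformalY ha u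
  rwa [Real.rpow_neg (quarticA_pos ha u).le] at this

theorem strictMono_conformalY {a : ℝ} (ha : -2 < a) : StrictMono (conformalY a) :=
  strictMono_of_deriv_pos fun u => by
    rw [(hasDerivAt_conformalY' ha u).deriv]; exact inv_pos.2 (quarticRoot_pos ha u)

/-- The poles correspond to `V = ±1`, and smoothness there needs functions defined on both sides of
these end points. Positivity on `[-1, 1]` is therefore extended to a slightly larger open interval.
-/
theorem exists_Ioo_subset_of_isOpen {s : Set ℝ} (hs : IsOpen s) (h : Set.Icc (-1) 1 ⊆ s) :
    ∃ δ > 0, Set.Ioo (-1 - δ) (1 + δ) ⊆ s := by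
  obtain ⟨δ, hδ, hsub⟩ := (isCompact_Icc (a := (-1 : ℝ)) (b := 1)).exists_thickening_subset_open hs h
  refine ⟨δ, hδ, fun x hx => hsub ?_⟩
  rw [Metric.mem_thickening_iff]
  -- The nearest point of `[-1, 1]` to `x`.
  refine ⟨max (-1) (min 1 x), ⟨le_max_left _ _, max_le (by norm_num) (min_le_left _ _)⟩, ?_⟩
  rw [Real.dist_eq, abs_lt]
  rcases le_total x 1 with h1 | h1 <;> rcases le_total (-1) x with h2 | h2 <;>
    simp only [h1, h2, min_eq_left, min_eq_right, max_eq_left, max_eq_right] <;>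
    constructor <;> norm_num <;> linarith [hx.1, hx.2]

/-! ### A smooth coordinate on the whole sphere

In terms of `V = u / √(1 + u²)` the height `tanh y` extends smoothly, with nonvanishing derivative,
to a neighbourhood of `[-1, 1]`. -/

/-- The polynomial `A / (1 + u²)²` in terms of `V = u / √(1 + u²)`. -/
def heightQ (a V : ℝ) : ℝ := 1 - (2 - a) * V ^ 2 * (1 - V ^ 2)

/-- The fourth root of `heightQ`. -/
def heightRoot (a V : ℝ) : ℝ := (heightQ a V) ^ (1 / 4 : ℝ)

/-- The derivative with respect to `V` of the difference between `y` and `arsinh u`. -/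
def heightDensity (a V : ℝ) : ℝ :=
  (2 - a) * V ^ 2 / (heightRoot a V * (1 + heightRoot a V) * (1 + heightRoot a V ^ 2))

/-- The difference between `y` and `arsinh u` in terms of `V`. -/
def heightShift (a V : ℝ) : ℝ := ∫ t in (0 : ℝ)..V, heightDensity a t

/-- The quotient `cosh y / √(1 + u²)` in terms of `V`. -/
def heightScale (a V : ℝ) : ℝ :=
  Real.cosh (heightShift a V) + V * Real.sinh (heightShift a V)

/-- The height `tanh y` in terms of `V`. -/
def heightMap (a V : ℝ) : ℝ :=
  (V * Real.cosh (heightShift a V) + Real.sinh (heightShift a V)) / heightScale a V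

/-- Since `0 ≤ V² (1 - V²) ≤ 1/4`, the value is at least `(2 + a)/4` for `a ≤ 2` and at least `1`
for `a ≥ 2`. -/
theorem heightQ_pos {a : ℝ} (ha : -2 < a) {V : ℝ} (hV : V ∈ Set.Icc (-1 : ℝ) 1) :
    0 < heightQ a V := by
  have h1 : V ^ 2 ≤ 1 := by nlinarith [hV.1, hV.2]
  unfold heightQ
  rcases le_total a 2 with h | h
  · nlinarith [sq_nonneg (V ^ 2 - 1 / 2), mul_nonneg (sq_nonneg V) (sub_nonneg.2 h1)]
  · nlinarith [mul_nonneg (mul_nonneg (sub_nonneg.2 h) (sq_nonneg V)) (sub_nonneg.2 h1)]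

theorem contDiff_heightQ (a : ℝ) : ContDiff ℝ ∞ (heightQ a) := by
  unfold heightQ; fun_prop

theorem heightRoot_pos {a V : ℝ} (h : 0 < heightQ a V) : 0 < heightRoot a V :=
  Real.rpow_pos_of_pos h _

theorem heightRoot_pow_four {a V : ℝ} (h : 0 < heightQ a V) : heightRoot a V ^ 4 = heightQ a V := by
  rw [heightRoot, ← Real.rpow_natCast, ← Real.rpow_mul h.le]
  norm_num

theorem contDiffAt_heightRoot {a V : ℝ} (h : 0 < heightQ a V) : ContDiffAt ℝ ∞ (heightRoot a) V :=
  (contDiff_heightQ a).contDiffAt.rpow_const_of_ne h.ne'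

theorem contDiffAt_heightDensity {a V : ℝ} (h : 0 < heightQ a V) :
    ContDiffAt ℝ ∞ (heightDensity a) V := by
  have hq := contDiffAt_heightRoot h
  have hp := heightRoot_pos h
  unfold heightDensity
  refine ContDiffAt.div (by fun_prop) ?_ (by positivity)
  exact (hq.mul (contDiffAt_const.add hq)).mul (contDiffAt_const.add (hq.pow 2))

/-- With `q⁴ = Q`, the factor `1 - V²` divides `1 - q⁴ = (1 - q)(1 + q)(1 + q²)`, hence `1/q - 1`.
In the variable `V` the derivatives of `y` and `arsinh u` are `1/(q (1 - V²))` and `1/(1 - V²)`;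
their poles at `V = ±1` cancel in the difference, which is `heightDensity`. -/
theorem one_add_heightDensity {a V : ℝ} (h : 0 < heightQ a V) :
    1 + heightDensity a V * (1 - V ^ 2) = (heightRoot a V)⁻¹ := by
  have hp := heightRoot_pos h
  have h4 := heightRoot_pow_four h
  unfold heightQ at h4
  unfold heightDensity
  field_simp
  linear_combination h4

theorem heightScale_pos {a V : ℝ} (hV : V ∈ Set.Icc (-1 : ℝ) 1) : 0 < heightScale a V := by
  unfold heightScale
  set K := heightShift a V
  have h1 : |Real.sinh K| < Real.cosh K := by
    apply abs_lt_of_sq_lt_sq _ (Real.cosh_pos K).le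
    nlinarith [Real.cosh_sq K]
  have h2 : |V * Real.sinh K| ≤ |Real.sinh K| := by
    rw [abs_mul]
    exact mul_le_of_le_one_left (abs_nonneg _) (abs_le.2 ⟨hV.1, hV.2⟩)
  linarith [neg_abs_le (V * Real.sinh K)]

/-- The interval is shrunk twice: first so that `heightQ` is positive and `heightShift` can be
differentiated, then so that `heightScale`, by then known to be continuous, is positive. -/
theorem exists_heightDomain {a : ℝ} (ha : -2 < a) : ∃ δ > 0,
    (∀ V ∈ Set.Ioo (-1 - δ) (1 + δ), 0 < heightQ a V) ∧
    (∀ V ∈ Set.Ioo (-1 - δ) (1 + δ), HasDerivAt (heightShift a) (heightDensity a V) V) ∧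
    (∀ V ∈ Set.Ioo (-1 - δ) (1 + δ), ContDiffAt ℝ ∞ (heightShift a) V) ∧
    (∀ V ∈ Set.Ioo (-1 - δ) (1 + δ), 0 < heightScale a V) := by
  obtain ⟨δ, hδ, hsub⟩ := exists_Ioo_subset_of_isOpen
    (isOpen_lt continuous_const (contDiff_heightQ a).continuous)
    (fun V hV => heightQ_pos ha hV)
  have hk : ContDiffOn ℝ ∞ (heightDensity a) (Set.Ioo (-1 - δ) (1 + δ)) :=
    fun V hV => (contDiffAt_heightDensity (hsub hV)).contDiffWithinAt
  have hd : ∀ V ∈ Set.Ioo (-1 - δ) (1 + δ),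
      HasDerivAt (heightShift a) (heightDensity a V) V := by
    intro V hV
    have h0 : (0 : ℝ) ∈ Set.Ioo (-1 - δ) (1 + δ) := ⟨by linarith, by linarith⟩
    refine intervalIntegral.integral_hasDerivAt_right
      ((hk.continuousOn.mono ?_).intervalIntegrable)
      (hk.continuousOn.stronglyMeasurableAtFilter isOpen_Ioo V hV)
      (contDiffAt_heightDensity (hsub hV)).continuousAt
    exact (Set.ordConnected_Ioo.uIcc_subset h0 hV)
  have hK : ContDiffOn ℝ ∞ (heightShift a) (Set.Ioo (-1 - δ) (1 + δ)) := by
    rw [contDiffOn_infty_iff_deriv_of_isOpen isOpen_Ioo]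
    exact ⟨fun V hV => (hd V hV).differentiableAt.differentiableWithinAt,
      hk.congr fun V hV => (hd V hV).deriv⟩
  have hS : ContinuousOn (heightScale a) (Set.Ioo (-1 - δ) (1 + δ)) := by
    unfold heightScale
    have := hK.continuousOn
    exact (Real.continuous_cosh.comp_continuousOn this).add
      (continuousOn_id.mul (Real.continuous_sinh.comp_continuousOn this))
  obtain ⟨ε, hε, hsub'⟩ := exists_Ioo_subset_of_isOpen
    (hS.isOpen_inter_preimage isOpen_Ioo (isOpen_Ioi (a := (0 : ℝ))))
    (fun V hV => ⟨⟨by linarith [hV.1], by linarith [hV.2]⟩, heightScale_pos hV⟩)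
  exact ⟨ε, hε, fun V hV => hsub (hsub' hV).1, fun V hV => hd V (hsub' hV).1,
    fun V hV => hK.contDiffAt (isOpen_Ioo.mem_nhds (hsub' hV).1), fun V hV => (hsub' hV).2⟩

/-- For the quotient `N / D` with `N = V cosh K + sinh K` and `D = cosh K + V sinh K`, the numerator
`N' D - N D'` collapses to `1 + K' (1 - V²)`, which `one_add_heightDensity` identifies. -/
theorem hasDerivAt_heightMap {a V : ℝ} (hQ : 0 < heightQ a V)
    (hK : HasDerivAt (heightShift a) (heightDensity a V) V) (hS : 0 < heightScale a V) :
    HasDerivAt (heightMap a) ((heightRoot a V * heightScale a V ^ 2)⁻¹) V := by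
  have h1 := one_add_heightDensity hQ
  have hq := heightRoot_pos hQ
  have hnum := ((hasDerivAt_id V).mul hK.cosh).add hK.sinh
  have hden := hK.cosh.add ((hasDerivAt_id V).mul hK.sinh)
  have := hnum.div hden hS.ne'
  convert! this using 1
  rw [mul_inv, ← h1, eq_div_iff (by exact pow_ne_zero 2 hS.ne')]
  have hcs := Real.cosh_sq (heightShift a V)
  simp only [id, Pi.add_apply, Pi.mul_apply]
  have hS' := hS.ne'
  change _ * (heightScale a V) ^ 2 = _
  rw [mul_assoc, inv_mul_cancel₀ (by positivity)]
  linear_combination (-1 - heightDensity a V * (1 - V ^ 2)) * hcs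

/-- Both sides vanish at `0`. Their derivatives agree by `one_add_heightDensity`, because `dV/du =
(1 + u²)^(-3/2)` and `1 - V² = 1/(1 + u²)`. -/
theorem conformalY_eq {a : ℝ} (ha : -2 < a) (u : ℝ) :
    conformalY a u = Real.arsinh u + heightShift a (u / √(1 + u ^ 2)) := by
  obtain ⟨δ, hδ, hQ, hK, -, -⟩ := exists_heightDomain ha
  have hmem : ∀ u : ℝ, u / √(1 + u ^ 2) ∈ Set.Ioo (-1 - δ) (1 + δ) := by
    intro u
    rw [← Real.tanh_arsinh]
    exact ⟨by linarith [Real.neg_one_lt_tanh (Real.arsinh u)],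
      by linarith [Real.tanh_lt_one (Real.arsinh u)]⟩
  have key : ∀ u, HasDerivAt (fun u => conformalY a u -
      (Real.arsinh u + heightShift a (u / √(1 + u ^ 2)))) 0 u := by
    intro u
    have hs : 0 < 1 + u ^ 2 := by positivity
    set s := √(1 + u ^ 2) with hsdef
    have hs0 : 0 < s := Real.sqrt_pos.2 hs
    have hs2 : s ^ 2 = 1 + u ^ 2 := Real.sq_sqrt hs.le
    have hd : HasDerivAt (fun u : ℝ => u / √(1 + u ^ 2)) (1 / s ^ 3) u := by
      have h1 : HasDerivAt (fun u : ℝ => √(1 + u ^ 2)) (u / s) u := by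
        have := ((hasDerivAt_pow 2 u).const_add 1).sqrt hs.ne'
        convert! this using 1
        field_simp
        ring
      convert! (hasDerivAt_id u).div h1 hs0.ne' using 1
      simp only [id]
      rw [← hsdef]
      field_simp
      linear_combination -hs2
    have h2 := (hasDerivAt_conformalY' ha u).sub ((Real.hasDerivAt_arsinh u).add
      ((hK _ (hmem u)).comp u hd))
    convert! h2 using 1
    have h3 := one_add_heightDensity (hQ _ (hmem u))
    -- This is the fourth root of `A = (1 + u²)² Q(V)`.
    have hroot : heightRoot a (u / s) = quarticRoot a u / s := by
      have e1 := heightRoot_pow_four (hQ _ (hmem u))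
      have e2 := quarticRoot_pow_four ha u
      have p1 := heightRoot_pos (hQ _ (hmem u))
      have p2 := quarticRoot_pos ha u
      rw [← hsdef] at e1 p1
      refine (pow_left_inj₀ p1.le (div_pos p2 hs0).le (by norm_num : 4 ≠ 0)).1 ?_
      rw [div_pow, e1, e2, heightQ, quarticA]
      have hs4 : s ^ 4 = (1 + u ^ 2) ^ 2 := by rw [← hs2]; ring
      field_simp
      rw [hs4, hs2]
      ring
    rw [← hsdef, hroot] at h3
    have p2 := quarticRoot_pos ha u
    have hv : 1 - (u / s) ^ 2 = 1 / s ^ 2 := by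
      field_simp
      linear_combination hs2
    rw [hv] at h3
    rw [← hsdef]
    have h4 : (quarticRoot a u)⁻¹ = (quarticRoot a u / s)⁻¹ / s := by field_simp
    rw [h4, ← h3]
    field_simp
    ring
  have hconst := is_const_of_deriv_eq_zero (fun u => (key u).differentiableAt)
    (fun u => (key u).deriv) u 0
  simp [conformalY, heightShift] at hconst
  simp only [conformalY, heightShift]
  linarith

end

noncomputable section

/-! ### Inverting the height map; smoothness of the coefficients at the poles. -/

theorem contDiffAt_heightScale {a V : ℝ} (hK : ContDiffAt ℝ ∞ (heightShift a) V) :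
    ContDiffAt ℝ ∞ (heightScale a) V :=
  hK.cosh.add (contDiffAt_id.mul hK.sinh)

theorem contDiffAt_heightMap {a V : ℝ} (hK : ContDiffAt ℝ ∞ (heightShift a) V)
    (hS : 0 < heightScale a V) : ContDiffAt ℝ ∞ (heightMap a) V :=
  ((contDiffAt_id.mul hK.cosh).add hK.sinh).div (contDiffAt_heightScale hK) hS.ne'

theorem heightMap_one {a : ℝ} : heightMap a 1 = 1 := by
  have := heightScale_pos (a := a) (V := 1) ⟨by norm_num, le_rfl⟩
  rw [heightMap, div_eq_one_iff_eq this.ne', heightScale, one_mul, one_mul, add_comm]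

theorem heightMap_neg_one {a : ℝ} : heightMap a (-1) = -1 := by
  have := heightScale_pos (a := a) (V := -1) ⟨le_rfl, by norm_num⟩
  rw [heightMap, div_eq_iff this.ne', heightScale]
  ring

/-- `heightMap` has a smooth inverse on a neighbourhood of `[-1, 1]`. -/
theorem exists_heightInverse {a : ℝ} (ha : -2 < a) : ∃ g : ℝ → ℝ,
    (∀ w ∈ Set.Icc (-1 : ℝ) 1, ContDiffAt ℝ ∞ g w) ∧
    (∀ w ∈ Set.Icc (-1 : ℝ) 1, g w ∈ Set.Icc (-1 : ℝ) 1) ∧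
    ∀ V ∈ Set.Icc (-1 : ℝ) 1, g (heightMap a V) = V := by
  obtain ⟨δ, hδ, hQ, hK, hKs, hS⟩ := exists_heightDomain ha
  set I := Set.Ioo (-1 - δ) (1 + δ) with hI
  have hsub : Set.Icc (-1 : ℝ) 1 ⊆ I := fun x hx => ⟨by linarith [hx.1], by linarith [hx.2]⟩
  have hd : ∀ V ∈ I, HasDerivAt (heightMap a) ((heightRoot a V * heightScale a V ^ 2)⁻¹) V :=
    fun V hV => hasDerivAt_heightMap (hQ V hV) (hK V hV) (hS V hV)
  have hpos : ∀ V ∈ I, 0 < (heightRoot a V * heightScale a V ^ 2)⁻¹ := fun V hV => by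
    have := heightRoot_pos (hQ V hV)
    have := hS V hV
    positivity
  have hmono : StrictMonoOn (heightMap a) I := by
    refine strictMonoOn_of_deriv_pos (convex_Ioo _ _)
      (fun V hV => (hd V hV).continuousAt.continuousWithinAt) fun V hV => ?_
    have hV' : V ∈ I := interior_subset hV
    rw [(hd V hV').deriv]
    exact hpos V hV'
  have hleft : ∀ V ∈ I, Function.invFunOn (heightMap a) I (heightMap a V) = V :=
    fun V hV => hmono.injOn.leftInvOn_invFunOn hV
  have hsurj : ∀ w ∈ Set.Icc (-1 : ℝ) 1, ∃ V ∈ Set.Icc (-1 : ℝ) 1, heightMap a V = w := by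
    intro w hw
    have := intermediate_value_Icc (by norm_num : (-1 : ℝ) ≤ 1)
      (fun V hV => (hd V (hsub hV)).continuousAt.continuousWithinAt)
    rw [heightMap_one, heightMap_neg_one] at this
    exact this hw
  refine ⟨Function.invFunOn (heightMap a) I, ?_, ?_, fun V hV => hleft V (hsub hV)⟩
  · intro w hw
    obtain ⟨V, hV, rfl⟩ := hsurj w hw
    have hc := contDiffAt_heightMap (hKs V (hsub hV)) (hS V (hsub hV))
    have hd' := (hd V (hsub hV)).hasFDerivAt_equiv (hpos V (hsub hV)).ne'
    have hn : (∞ : WithTop ℕ∞) ≠ 0 := by simp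
    -- The inverse function theorem gives a smooth local inverse. Its values near the point lie in
    -- `I`, where `heightMap` is injective, so it agrees there with the chosen global inverse, also
    -- at `w = ±1`.
    refine (hc.to_localInverse hd' hn).congr_of_eventuallyEq ?_
    have hinv := (hc.hasStrictFDerivAt' hd' hn).eventually_right_inverse
    have hcont := (hc.to_localInverse hd' hn).continuousAt
    have hmem : ∀ᶠ w in nhds (heightMap a V), hc.localInverse hd' hn w ∈ I := by
      apply hcont
      rw [hc.localInverse_apply_image hd' hn]
      exact isOpen_Ioo.mem_nhds (hsub hV)
    filter_upwards [hinv, hmem] with w' h1 h2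
    have := hleft _ h2
    rwa [show heightMap a (hc.localInverse hd' hn w') = w' from h1] at this
  · intro w hw
    obtain ⟨V, hV, rfl⟩ := hsurj w hw
    rwa [hleft V (hsub hV)]

/-- The amplitude `h` of the potential `h(u) cos φ`. -/
def potentialAmp (a u : ℝ) : ℝ := -(u / 2) * ((a + 2 * u ^ 2) - 2 * √(quarticA u a 1))

/-- The expression is `(a + 2u² + 2√A) / (1 + u²)`, the denominator that appears when the potential
is rationalised. Since `q⁴ - (1 - 2V²)² = (2 + a) V² (1 - V²) ≥ 0`, one has `q² ≥ |1 - 2V²|`. The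
lower bound `(a + 2)(1 - V²)` follows, and at `V² = 1` the bound is `4`. -/
theorem quartic_pos_aux {a : ℝ} (ha : -2 < a) {V q : ℝ} (hV : V ∈ Set.Icc (-1 : ℝ) 1)
    (hq : q ^ 4 = heightQ a V) : 0 < a + (2 - a) * V ^ 2 + 2 * q ^ 2 := by
  have h1 : 0 ≤ 1 - V ^ 2 := by nlinarith [hV.1, hV.2]
  unfold heightQ at hq
  have h2 : |1 - 2 * V ^ 2| ≤ q ^ 2 := by
    apply abs_le_of_sq_le_sq _ (sq_nonneg q)
    nlinarith [mul_nonneg (mul_nonneg (sq_nonneg V) h1) (by linarith : 0 ≤ 2 + a)]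
  have h3 := le_abs_self (1 - 2 * V ^ 2)
  have h4 := neg_le_abs (1 - 2 * V ^ 2)
  rcases h1.eq_or_lt with h | h
  · nlinarith
  · nlinarith [mul_pos h (by linarith : 0 < a + 2)]

/-- The coefficients of the metric, the potential and the quartic integral are smooth functions of
the height `tanh y` up to the poles. -/
theorem exists_smooth_coefficients {a : ℝ} (ha : -2 < a) : ∃ f g α β γ : ℝ → ℝ,
    (∀ w ∈ Set.Icc (-1 : ℝ) 1, ContDiffAt ℝ ∞ f w ∧ ContDiffAt ℝ ∞ g w ∧ ContDiffAt ℝ ∞ α w ∧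
      ContDiffAt ℝ ∞ β w ∧ ContDiffAt ℝ ∞ γ w ∧ 0 < f w) ∧
    ∀ u : ℝ,
      f (Real.tanh (conformalY a u)) = Real.cosh (conformalY a u) ^ 2 / √(quarticA u a 1) ∧
      g (Real.tanh (conformalY a u)) = potentialAmp a u * Real.cosh (conformalY a u) ∧
      α (Real.tanh (conformalY a u)) = - quarticRoot a u / Real.cosh (conformalY a u) ∧
      β (Real.tanh (conformalY a u)) = Real.cosh (conformalY a u) *
        (u - Real.tanh (conformalY a u) * quarticRoot a u) ∧
      γ (Real.tanh (conformalY a u)) = (a + 2 * u ^ 2 - 2 * √(quarticA u a 1)) *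
        Real.cosh (conformalY a u) ^ 2 := by
  obtain ⟨V, hVs, hVm, hVi⟩ := exists_heightInverse ha
  obtain ⟨δ, hδ, hQ, hK, hKs, hS⟩ := exists_heightDomain ha
  have hsub : Set.Icc (-1 : ℝ) 1 ⊆ Set.Ioo (-1 - δ) (1 + δ) :=
    fun x hx => ⟨by linarith [hx.1], by linarith [hx.2]⟩
  let q := heightRoot a
  let c := heightScale a
  let D : ℝ → ℝ := fun v => a + (2 - a) * v ^ 2 + 2 * q v ^ 2
  have hq0 : ∀ v ∈ Set.Icc (-1 : ℝ) 1, 0 < q v := fun v hv => heightRoot_pos (heightQ_pos ha hv)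
  have hq4 : ∀ v ∈ Set.Icc (-1 : ℝ) 1, q v ^ 4 = heightQ a v :=
    fun v hv => heightRoot_pow_four (heightQ_pos ha hv)
  have hc0 : ∀ v ∈ Set.Icc (-1 : ℝ) 1, 0 < c v := fun v hv => heightScale_pos hv
  have hD0 : ∀ v ∈ Set.Icc (-1 : ℝ) 1, 0 < D v := fun v hv => quartic_pos_aux ha hv (hq4 v hv)
  have sq : ∀ v ∈ Set.Icc (-1 : ℝ) 1, ContDiffAt ℝ ∞ q v :=
    fun v hv => contDiffAt_heightRoot (heightQ_pos ha hv)
  have sK : ∀ v ∈ Set.Icc (-1 : ℝ) 1, ContDiffAt ℝ ∞ (heightShift a) v :=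
    fun v hv => hKs v (hsub hv)
  have sc : ∀ v ∈ Set.Icc (-1 : ℝ) 1, ContDiffAt ℝ ∞ c v :=
    fun v hv => contDiffAt_heightScale (sK v hv)
  have sD : ∀ v ∈ Set.Icc (-1 : ℝ) 1, ContDiffAt ℝ ∞ D v := fun v hv => by
    have := sq v hv
    fun_prop
  have sM : ∀ v ∈ Set.Icc (-1 : ℝ) 1, ContDiffAt ℝ ∞ (heightMap a) v :=
    fun v hv => contDiffAt_heightMap (sK v hv) (hc0 v hv)
  -- With `s = √(1 + u²)`, substitute `u = sV`, `cosh y = s c` and `A^(1/4) = s q`; all powers of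
  -- `s` cancel. In the second and fifth coefficients, `a + 2u² - 2√A` is replaced by `(a² - 4) /
  -- (s² D)`.
  refine ⟨fun w => c (V w) ^ 2 / q (V w) ^ 2,
    fun w => -(a ^ 2 - 4) / 2 * V w * c (V w) / D (V w),
    fun w => - q (V w) / c (V w),
    fun w => heightMap a (V w) * (2 - a) * V w ^ 2 * c (V w) /
        ((1 + q (V w)) * (1 + q (V w) ^ 2)) - Real.sinh (heightShift a (V w)),
    fun w => (a ^ 2 - 4) * c (V w) ^ 2 / D (V w), ?_, ?_⟩
  · intro w hw
    have hv := hVm w hw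
    have hVw := hVs w hw
    have h1 : ContDiffAt ℝ ∞ (fun w => q (V w)) w := (sq _ hv).comp w hVw
    have h2 : ContDiffAt ℝ ∞ (fun w => c (V w)) w := (sc _ hv).comp w hVw
    have h3 : ContDiffAt ℝ ∞ (fun w => D (V w)) w := (sD _ hv).comp w hVw
    have h4 : ContDiffAt ℝ ∞ (fun w => heightMap a (V w)) w := (sM _ hv).comp w hVw
    have h5 : ContDiffAt ℝ ∞ (fun w => Real.sinh (heightShift a (V w))) w :=
      ((sK _ hv).comp w hVw).sinh
    have p1 := hq0 _ hv
    have p2 := hc0 _ hv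
    have p3 := hD0 _ hv
    refine ⟨(h2.pow 2).div (h1.pow 2) (by positivity), ?_, h1.neg.div h2 p2.ne', ?_, ?_,
      by positivity⟩
    · exact ((contDiffAt_const.mul hVw).mul h2).div h3 p3.ne'
    · refine ContDiffAt.sub (ContDiffAt.div ?_ ?_ ?_) h5
      · exact (((h4.mul contDiffAt_const).mul (hVw.pow 2)).mul h2)
      · exact (contDiffAt_const.add h1).mul (contDiffAt_const.add (h1.pow 2))
      · positivity
    · exact (contDiffAt_const.mul (h2.pow 2)).div h3 p3.ne'
  · intro u
    have hs : 0 < 1 + u ^ 2 := by positivity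
    set s := √(1 + u ^ 2) with hsdef
    have hs0 : 0 < s := Real.sqrt_pos.2 hs
    have hs2 : s ^ 2 = 1 + u ^ 2 := Real.sq_sqrt hs.le
    set v := u / s with hv
    have hvI : v ∈ Set.Icc (-1 : ℝ) 1 := by
      rw [hv, hsdef, ← Real.tanh_arsinh]
      exact ⟨(Real.neg_one_lt_tanh _).le, (Real.tanh_lt_one _).le⟩
    set y := conformalY a u with hy
    have hyv : y = Real.arsinh u + heightShift a v := conformalY_eq ha u
    have hcosh : Real.cosh y = s * c v := by
      rw [hyv, Real.cosh_add, Real.cosh_arsinh, Real.sinh_arsinh]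
      simp only [c, heightScale]
      rw [← hsdef, hv]
      field_simp
    have hsinh : Real.sinh y = s * (heightMap a v * c v) := by
      rw [hyv, Real.sinh_add, Real.cosh_arsinh, Real.sinh_arsinh]
      simp only [c, heightMap]
      rw [div_mul_cancel₀ _ (hc0 v hvI).ne', ← hsdef, hv]
      field_simp
    have p2 := hc0 v hvI
    have hw : Real.tanh y = heightMap a v := by
      rw [Real.tanh_eq_sinh_div_cosh, hsinh, hcosh]
      field_simp
    have p1 := hq0 v hvI
    have p3 := hD0 v hvI
    have r0 := quarticRoot_pos ha u
    have hr : quarticRoot a u = s * q v := by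
      refine (pow_left_inj₀ r0.le (by positivity) (by norm_num : 4 ≠ 0)).1 ?_
      rw [quarticRoot_pow_four ha, mul_pow, hq4 v hvI, heightQ, quarticA, hv]
      field_simp
      rw [show s ^ 4 = (s ^ 2) ^ 2 by ring, hs2]
      ring
    have hB : √(quarticA u a 1) = s ^ 2 * q v ^ 2 := by
      rw [← quarticRoot_sq ha, hr]; ring
    have hu : u = s * v := by rw [hv]; field_simp
    have hsv : s ^ 2 * (1 - v ^ 2) = 1 := by
      rw [hv]; field_simp; linear_combination hs2
    have hDs : s ^ 2 * D v = a + 2 * u ^ 2 + 2 * √(quarticA u a 1) := by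
      rw [hB, hu]
      simp only [D]
      linear_combination a * hsv
    -- Multiplication by the conjugate: `(a + 2u²)² - 4A = a² - 4`.
    have hprod : (a + 2 * u ^ 2 - 2 * √(quarticA u a 1)) * (s ^ 2 * D v) = a ^ 2 - 4 := by
      rw [hDs]
      have := Real.sq_sqrt (quarticA_pos ha u).le
      generalize √(quarticA u a 1) = B at this
      unfold quarticA at this
      linear_combination -4 * this
    simp only [hw, hVi v hvI, hcosh]
    refine ⟨?_, ?_, ?_, ?_, ?_⟩
    · rw [hB]; field_simp
    · rw [potentialAmp]
      have : (a + 2 * u ^ 2) - 2 * √(quarticA u a 1) = (a ^ 2 - 4) / (s ^ 2 * D v) := by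
        rw [eq_div_iff (by positivity)]; exact hprod
      rw [this]
      rw [show -(u / 2) = -(s * v / 2) by rw [hu]]
      field_simp
    · rw [hr]; field_simp
    · rw [hr]
      nth_rewrite 1 [hu]
      have h1 := one_add_heightDensity (heightQ_pos ha hvI)
      have hE : q v = 1 - (2 - a) * v ^ 2 * (1 - v ^ 2) / ((1 + q v) * (1 + q v ^ 2)) := by
        have := hq4 v hvI
        rw [heightQ] at this
        field_simp
        linear_combination this
      have hG : heightMap a v * c v = v * Real.cosh (heightShift a v) +
          Real.sinh (heightShift a v) := div_mul_cancel₀ _ p2.ne'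
      have hc : c v = Real.cosh (heightShift a v) + v * Real.sinh (heightShift a v) := rfl
      set X := (2 - a) * v ^ 2 / ((1 + q v) * (1 + q v ^ 2)) with hX
      have hE' : q v = 1 - X * (1 - v ^ 2) := by rw [hX]; nth_rewrite 1 [hE]; ring
      have hL : heightMap a v * (2 - a) * v ^ 2 * c v / ((1 + q v) * (1 + q v ^ 2)) =
          heightMap a v * c v * X := by rw [hX]; ring
      rw [hL]
      have : s * c v * (s * v - heightMap a v * (s * q v)) =
        s ^ 2 * (c v * v - (heightMap a v * c v) * q v) := by ring
      rw [this, hE']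
      -- Both `q` and `heightMap` are compared with their limits at the poles. The difference is
      -- divisible by `1 - V² = 1/s²`, which absorbs the growing factor `s²`.
      have h5 : c v * v - heightMap a v * c v * (1 - X * (1 - v ^ 2)) =
        (1 - v ^ 2) * (- Real.sinh (heightShift a v) + heightMap a v * c v * X) := by
        rw [hG, hc]; ring
      rw [h5, ← mul_assoc, hsv]
      ring
    · rw [div_eq_iff p3.ne']
      linear_combination -c v ^ 2 * hprod

/-- `y` stays at bounded distance from `arsinh u`, because `heightShift` is continuous on the
compact interval `[-1, 1]`. -/
theorem tendsto_conformalY_atTop {a : ℝ} (ha : -2 < a) :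
    Filter.Tendsto (conformalY a) Filter.atTop Filter.atTop ∧
      Filter.Tendsto (conformalY a) Filter.atBot Filter.atBot := by
  obtain ⟨δ, hδ, hQ, hK, -, -⟩ := exists_heightDomain ha
  have hcont : ContinuousOn (heightShift a) (Set.Icc (-1) 1) := fun V hV =>
    (hK V ⟨by linarith [hV.1], by linarith [hV.2]⟩).continuousAt.continuousWithinAt
  obtain ⟨C, hC⟩ := (isCompact_Icc (a := (-1 : ℝ)) (b := 1)).exists_bound_of_continuousOn hcont
  have hb : ∀ u, |conformalY a u - Real.arsinh u| ≤ C := fun u => by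
    rw [conformalY_eq ha, add_sub_cancel_left, ← Real.tanh_arsinh]
    exact hC _ ⟨(Real.neg_one_lt_tanh _).le, (Real.tanh_lt_one _).le⟩
  constructor
  · refine Filter.tendsto_atTop_mono (f := fun u => Real.arsinh u + -C)
      (fun u => by linarith [(abs_le.1 (hb u)).1]) ?_
    exact Filter.tendsto_atTop_add_const_right _ _ Real.sinhOrderIso.symm.tendsto_atTop
  · refine Filter.tendsto_atBot_mono (f := fun u => Real.arsinh u + C)
      (g := conformalY a) (fun u => by linarith [(abs_le.1 (hb u)).2]) ?_
    exact Filter.tendsto_atBot_add_const_right _ _ Real.sinhOrderIso.symm.tendsto_atBot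

theorem bijective_conformalY {a : ℝ} (ha : -2 < a) : Function.Bijective (conformalY a) :=
  ⟨(strictMono_conformalY ha).injective, (contDiff_conformalY ha).continuous.surjective
    (tendsto_conformalY_atTop ha).1 (tendsto_conformalY_atTop ha).2⟩

end

noncomputable section

/-! ## The unit sphere: embedding, stereographic charts and conformal metrics -/

namespace S2

theorem finrank_fact : Fact (Module.finrank ℝ (EuclideanSpace ℝ (Fin 3)) = 2 + 1) := ⟨by simp⟩

/-- The differential of the inclusion of the sphere into `ℝ³`. -/
def dcoe (x : S2) : TangentSpace (𝓡 2) x →L[ℝ] EuclideanSpace ℝ (Fin 3) :=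
  mvfderiv (𝓡 2) ((↑) : S2 → EuclideanSpace ℝ (Fin 3)) x

theorem dcoe_apply (x : S2) (v : TangentSpace (𝓡 2) x) (i : Fin 3) : dcoe x v i = du i x v := rfl

theorem dcoe_injective (x : S2) : Function.Injective (dcoe x) := by
  have := finrank_fact
  exact injective_mvfderiv_subtypeVal_sphere (n := 2) x

theorem contMDiff_coe : ContMDiff (𝓡 2) 𝓘(ℝ, EuclideanSpace ℝ (Fin 3)) ∞
    ((↑) : S2 → EuclideanSpace ℝ (Fin 3)) := by
  have := finrank_fact
  exact contMDiff_coe_sphere (n := 2)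

theorem range_dcoe (x : S2) (y : EuclideanSpace ℝ (Fin 3)) :
    (∃ v, dcoe x v = y) ↔ inner ℝ x.1 y = 0 := by
  have := finrank_fact
  have h := range_mvfderiv_subtypeVal (n := 2) x
  rw [← Submodule.mem_orthogonal_singleton_iff_inner_right, ← h]
  rfl

theorem inner_dcoe (x : S2) (v : TangentSpace (𝓡 2) x) : inner ℝ x.1 (dcoe x v) = 0 :=
  (range_dcoe x _).1 ⟨v, rfl⟩

theorem dcoe_mfderiv {N : Type*} [NormedAddCommGroup N] [NormedSpace ℝ N] {P : N → S2} {z : N}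
    (hP : MDifferentiableAt 𝓘(ℝ, N) (𝓡 2) P z) (v : N) :
    dcoe (P z) (mfderiv 𝓘(ℝ, N) (𝓡 2) P z v) = fderiv ℝ (fun z => (P z).1) z v := by
  have h := mfderiv_comp z ((contMDiff_coe (P z)).mdifferentiableAt (by simp)) hP
  rw [← mfderiv_eq_fderiv]
  change _ = mfderiv 𝓘(ℝ, N) 𝓘(ℝ, EuclideanSpace ℝ (Fin 3)) ((Subtype.val : S2 → EuclideanSpace ℝ (Fin 3)) ∘ P) z v
  rw [h]
  rfl

theorem coord_sq (x : S2) : x.1 0 ^ 2 + x.1 1 ^ 2 + x.1 2 ^ 2 = 1 := by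
  have h : ‖x.1‖ = 1 := by simp
  have := EuclideanSpace.real_norm_sq_eq x.1
  rw [h, Fin.sum_univ_three] at this
  linarith

theorem coord_mem_Icc (x : S2) : x.1 2 ∈ Set.Icc (-1 : ℝ) 1 := by
  have := coord_sq x
  constructor <;> nlinarith [sq_nonneg (x.1 0), sq_nonneg (x.1 1)]

/-! ### Charts -/

section Charts

variable {e : OpenPartialHomeomorph S2 (EuclideanSpace ℝ (Fin 2))}

theorem target_eq_univ (he : e ∈ atlas (EuclideanSpace ℝ (Fin 2)) S2) : e.target = Set.univ := by
  have := finrank_fact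
  obtain ⟨v, rfl⟩ := he
  exact stereographic'_target v

/-- The inverse of a chart as a map to `ℝ³`. -/
def chartInv (e : OpenPartialHomeomorph S2 (EuclideanSpace ℝ (Fin 2)))
    (q : EuclideanSpace ℝ (Fin 2)) : EuclideanSpace ℝ (Fin 3) := (e.symm q).1

/-- Every chart is a stereographic projection from some `v`, followed by an isometry of the plane
orthogonal to `v`. This normal form makes the later computations independent of the orthonormal
basis used in the chart. -/
theorem exists_chartInv_eq (he : e ∈ atlas (EuclideanSpace ℝ (Fin 2)) S2) :
    ∃ (U : EuclideanSpace ℝ (Fin 2) →ₗᵢ[ℝ] EuclideanSpace ℝ (Fin 3))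
      (v : EuclideanSpace ℝ (Fin 3)), ‖v‖ = 1 ∧ (∀ q, inner ℝ (U q) v = 0) ∧
      ∀ q, chartInv e q = (‖q‖ ^ 2 + 4)⁻¹ • ((4 : ℝ) • U q + (‖q‖ ^ 2 - 4) • v) := by
  have := finrank_fact
  obtain ⟨v, rfl⟩ := he
  let U : (ℝ ∙ (v : EuclideanSpace ℝ (Fin 3)))ᗮ ≃ₗᵢ[ℝ] EuclideanSpace ℝ (Fin 2) :=
    (OrthonormalBasis.fromOrthogonalSpanSingleton 2 (ne_zero_of_mem_unit_sphere v)).repr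
  refine ⟨(Submodule.subtypeₗᵢ _).comp U.symm.toLinearIsometry, v, by simp, fun q => ?_,
    fun q => ?_⟩
  · exact Submodule.mem_orthogonal_singleton_iff_inner_left.1 (U.symm q).2
  · have h := stereographic'_symm_apply v q
    have hn : ‖((U.symm q : (ℝ ∙ (v : EuclideanSpace ℝ (Fin 3)))ᗮ) :
        EuclideanSpace ℝ (Fin 3))‖ = ‖q‖ := by
      exact U.symm.norm_map q
    change ((stereographic' 2 v).symm q : EuclideanSpace ℝ (Fin 3)) = _
    rw [h]
    simp only [U] at hn
    simp only [hn, smul_add]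
    rfl

theorem contDiff_chartInv (he : e ∈ atlas (EuclideanSpace ℝ (Fin 2)) S2) :
    ContDiff ℝ ∞ (chartInv e) := by
  obtain ⟨U, v, -, -, h⟩ := exists_chartInv_eq he
  rw [show chartInv e = _ from funext h]
  have hn : ContDiff ℝ ∞ fun q : EuclideanSpace ℝ (Fin 2) => ‖q‖ ^ 2 := contDiff_norm_sq ℝ
  have h1 : ContDiff ℝ ∞ fun q : EuclideanSpace ℝ (Fin 2) => (‖q‖ ^ 2 + 4)⁻¹ :=
    (hn.add contDiff_const).inv fun q => by positivity
  have h2 : ContDiff ℝ ∞ fun q : EuclideanSpace ℝ (Fin 2) => U q :=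
    U.toContinuousLinearMap.contDiff
  have h3 : ContDiff ℝ ∞ fun q : EuclideanSpace ℝ (Fin 2) => (‖q‖ ^ 2 - 4) • v :=
    (hn.sub contDiff_const).smul contDiff_const
  exact h1.smul ((h2.const_smul (4 : ℝ)).add h3)

/-- Stereographic projection is conformal: terms along `v` and `U q` combine with `⟪U q, v⟫ = 0` and
`‖v‖ = 1`. -/
theorem inner_fderiv_chartInv (he : e ∈ atlas (EuclideanSpace ℝ (Fin 2)) S2)
    (q ξ η : EuclideanSpace ℝ (Fin 2)) :
    inner ℝ (fderiv ℝ (chartInv e) q ξ) (fderiv ℝ (chartInv e) q η) =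
      16 / (‖q‖ ^ 2 + 4) ^ 2 * inner ℝ ξ η := by
  obtain ⟨U, v, hv, hU, h⟩ := exists_chartInv_eq he
  have hpos : ‖q‖ ^ 2 + 4 ≠ 0 := by positivity
  have hd : ∀ ξ, fderiv ℝ (chartInv e) q ξ =
      (‖q‖ ^ 2 + 4)⁻¹ • ((4 : ℝ) • U ξ + (2 * inner ℝ q ξ) • v) +
      (-(2 * inner ℝ q ξ) / (‖q‖ ^ 2 + 4) ^ 2) • ((4 : ℝ) • U q + (‖q‖ ^ 2 - 4) • v) := by
    intro ξ
    rw [show chartInv e = _ from funext h]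
    have hn : HasFDerivAt (fun q : EuclideanSpace ℝ (Fin 2) => ‖q‖ ^ 2) (2 • innerSL ℝ q) q :=
      (hasStrictFDerivAt_norm_sq q).hasFDerivAt
    have h1 := (hasFDerivAt_inv hpos).comp q (hn.add_const (4 : ℝ))
    have h2 := (U.toContinuousLinearMap.hasFDerivAt (x := q)).const_smul (4 : ℝ) |>.add
      ((hn.sub_const (4 : ℝ)).smul_const v)
    have := h1.smul h2
    erw [this.fderiv]
    simp [two_mul]
    ring_nf
  rw [hd, hd]
  have hvv : inner ℝ v v = (1 : ℝ) := by rw [real_inner_self_eq_norm_sq, hv]; norm_num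
  have hvU : ∀ q, inner ℝ v (U q) = (0 : ℝ) := fun q => by rw [real_inner_comm]; exact hU q
  have hqq : inner ℝ q q = ‖q‖ ^ 2 := real_inner_self_eq_norm_sq q
  simp only [inner_add_left, inner_add_right, inner_smul_left, inner_smul_right, hvv, hvU, hU,
    LinearIsometry.inner_map_map, hqq, real_inner_comm q ξ]
  simp
  field_simp
  ring

theorem mdifferentiable_chart (he : e ∈ atlas (EuclideanSpace ℝ (Fin 2)) S2) :
    OpenPartialHomeomorph.MDifferentiable (𝓡 2) (𝓡 2) e := mdifferentiable_of_mem_atlas he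

theorem dcoe_mfderiv_symm (he : e ∈ atlas (EuclideanSpace ℝ (Fin 2)) S2)
    (q ξ : EuclideanSpace ℝ (Fin 2)) :
    dcoe (e.symm q) (mfderiv (𝓡 2) (𝓡 2) e.symm q ξ) = fderiv ℝ (chartInv e) q ξ :=
  dcoe_mfderiv (mdifferentiableAt_atlas_symm he (by rw [target_eq_univ he]; trivial)) ξ

theorem mfderiv_chart_symm (he : e ∈ atlas (EuclideanSpace ℝ (Fin 2)) S2)
    (q ξ : EuclideanSpace ℝ (Fin 2)) :
    mfderiv (𝓡 2) (𝓡 2) e (e.symm q) (mfderiv (𝓡 2) (𝓡 2) e.symm q ξ) = ξ := by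
  have h := (mdifferentiable_chart he).comp_symm_deriv (x := q)
    (by rw [target_eq_univ he]; trivial)
  exact congrArg (fun L : EuclideanSpace ℝ (Fin 2) →L[ℝ] EuclideanSpace ℝ (Fin 2) => L ξ) h

theorem mfderiv_symm_chart (he : e ∈ atlas (EuclideanSpace ℝ (Fin 2)) S2)
    (q : EuclideanSpace ℝ (Fin 2)) (v : TangentSpace (𝓡 2) (e.symm q)) :
    mfderiv (𝓡 2) (𝓡 2) e.symm q (mfderiv (𝓡 2) (𝓡 2) e (e.symm q) v) = v := by
  have hq : q ∈ e.target := by rw [target_eq_univ he]; trivial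
  have h := (mdifferentiable_chart he).symm_comp_deriv (e.map_target hq)
  rw [e.right_inv hq] at h
  exact congrArg (fun L : TangentSpace (𝓡 2) (e.symm q) →L[ℝ] TangentSpace (𝓡 2) (e.symm q) =>
    L v) h

end Charts

/-! ### Conformal metrics -/

/-- The form `c (du₁² + du₂² + du₃²)`. -/
def conformalForm (c : S2 → ℝ) (x : S2) :
    TangentSpace (𝓡 2) x →L[ℝ] TangentSpace (𝓡 2) x →L[ℝ] ℝ :=
  c x • ∑ i, (du i x).smulRight (du i x)

theorem conformalForm_apply (c : S2 → ℝ) (x : S2) (v w : TangentSpace (𝓡 2) x) :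
    conformalForm c x v w = c x * inner ℝ (dcoe x v) (dcoe x w) := by
  simp only [conformalForm, _root_.smul_apply, _root_.sum_apply,
    ContinuousLinearMap.smulRight_apply, PiLp.inner_apply, dcoe_apply]
  simp [mul_comm]

theorem conformalForm_pos {c : S2 → ℝ} {x : S2} (hc : 0 < c x) {v : TangentSpace (𝓡 2) x}
    (hv : v ≠ 0) : 0 < conformalForm c x v v := by
  rw [conformalForm_apply]
  refine mul_pos hc (real_inner_self_pos.2 fun h => hv (dcoe_injective x ?_))
  rw [h, map_zero]

theorem contDiff_sumForm {F G : Type*} [NormedAddCommGroup F] [NormedSpace ℝ F]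
    [NormedAddCommGroup G] [NormedSpace ℝ G] (l : Fin 3 → G →L[ℝ] ℝ) :
    ContDiff ℝ ∞ (fun z : ℝ × (F →L[ℝ] G) =>
      z.1 • ∑ i, ((l i).comp z.2).smulRight ((l i).comp z.2)) := by
  have hD : ∀ i : Fin 3, ContDiff ℝ ∞ (fun z : ℝ × (F →L[ℝ] G) => (l i).comp z.2) :=
    fun i => contDiff_const.clm_comp contDiff_snd
  have h : ∀ i ∈ (Finset.univ : Finset (Fin 3)), ContDiff ℝ ∞
      (fun z : ℝ × (F →L[ℝ] G) => ((l i).comp z.2).smulRight ((l i).comp z.2)) :=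
    fun i _ => (hD i).smulRight (hD i)
  have h' := ContDiff.sum h
  exact contDiff_fst_smul h'

/-- In the trivialisation at `x₀` the form is a fixed smooth expression in `c` and in the
differential of the inclusion into `ℝ³`, both of which are smooth. -/
theorem contMDiff_conformalForm {c : S2 → ℝ} (hc : ContMDiff (𝓡 2) 𝓘(ℝ, ℝ) ∞ c) :
    ContMDiff (𝓡 2)
      ((𝓡 2).prod 𝓘(ℝ, EuclideanSpace ℝ (Fin 2) →L[ℝ] EuclideanSpace ℝ (Fin 2) →L[ℝ] ℝ)) ∞
      (fun x : S2 => Bundle.TotalSpace.mk'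
        (EuclideanSpace ℝ (Fin 2) →L[ℝ] EuclideanSpace ℝ (Fin 2) →L[ℝ] ℝ)
        (E := fun x : S2 => TangentSpace (𝓡 2) x →L[ℝ] TangentSpace (𝓡 2) x →L[ℝ] ℝ)
        x (conformalForm c x)) := by
  intro x₀
  have hT := (contMDiff_coe x₀).mfderiv_const (m := ∞) (by simp)
  let T : S2 → EuclideanSpace ℝ (Fin 2) →L[ℝ] EuclideanSpace ℝ (Fin 3) :=
    inTangentCoordinates (𝓡 2) 𝓘(ℝ, EuclideanSpace ℝ (Fin 3)) id
      ((↑) : S2 → EuclideanSpace ℝ (Fin 3))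
      (mfderiv (𝓡 2) 𝓘(ℝ, EuclideanSpace ℝ (Fin 3)) ((↑) : S2 → EuclideanSpace ℝ (Fin 3))) x₀
  have hQ := contDiff_sumForm (F := EuclideanSpace ℝ (Fin 2))
    (fun i => (EuclideanSpace.proj i : EuclideanSpace ℝ (Fin 3) →L[ℝ] ℝ))
  rw [contMDiffAt_hom_bundle]
  refine ⟨contMDiffAt_id, ?_⟩
  refine (hQ.contMDiff.contMDiffAt.comp x₀ ((hc x₀).prodMk_space hT)).congr_of_eventuallyEq ?_
  filter_upwards [(trivializationAt (EuclideanSpace ℝ (Fin 2))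
    (fun x : S2 => TangentSpace (𝓡 2) x) x₀).open_baseSet.mem_nhds
      (FiberBundle.mem_baseSet_trivializationAt' x₀)] with x hx
  have hTx : ∀ v, T x v = dcoe x
      ((trivializationAt (EuclideanSpace ℝ (Fin 2))
        (fun x : S2 => TangentSpace (𝓡 2) x) x₀).symm x v) := by
    intro v
    simp only [T, inTangentCoordinates, id]
    rw [ContinuousLinearMap.inCoordinates_eq hx (by simp; trivial)]
    simp [dcoe, mvfderiv]
    rfl
  ext v w
  rw [inCoordinates_apply_eq₂ hx hx (Set.mem_univ _)]
  have : ∀ i v, (EuclideanSpace.proj i : EuclideanSpace ℝ (Fin 3) →L[ℝ] ℝ).comp (T x) v =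
      du i x ((trivializationAt (EuclideanSpace ℝ (Fin 2))
        (fun x : S2 => TangentSpace (𝓡 2) x) x₀).symm x v) := fun i v => by
    rw [ContinuousLinearMap.comp_apply, hTx]; rfl
  simp only [Bundle.Trivial.fiberBundle_trivializationAt',
    Bundle.Trivial.linearMapAt_trivialization]
  change conformalForm c x _ _ = (c x • ∑ i,
    ((EuclideanSpace.proj i : EuclideanSpace ℝ (Fin 3) →L[ℝ] ℝ).comp (T x)).smulRight
      ((EuclideanSpace.proj i : EuclideanSpace ℝ (Fin 3) →L[ℝ] ℝ).comp (T x))) v w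
  simp only [conformalForm, _root_.smul_apply, _root_.sum_apply,
    ContinuousLinearMap.smulRight_apply, this]

/-- The metric `c (du₁² + du₂² + du₃²)` with a positive smooth factor `c`. -/
def conformalMetric (c : S2 → ℝ) (hc : ContMDiff (𝓡 2) 𝓘(ℝ, ℝ) ∞ c) (hpos : ∀ x, 0 < c x) :
    SmoothMetric 2 S2 where
  inner := conformalForm c
  symm x v w := by rw [conformalForm_apply, conformalForm_apply, real_inner_comm]
  pos x v hv := conformalForm_pos (hpos x) hv
  isVonNBounded x := isVonNBounded_of_pos (conformalForm c x) fun v hv =>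
    conformalForm_pos (hpos x) hv
  contMDiff := contMDiff_conformalForm hc

theorem conformalMetric_inner (c : S2 → ℝ) (hc : ContMDiff (𝓡 2) 𝓘(ℝ, ℝ) ∞ c)
    (hpos : ∀ x, 0 < c x) (x : S2) (v w : TangentSpace (𝓡 2) x) :
    (conformalMetric c hc hpos).inner x v w = c x * inner ℝ (dcoe x v) (dcoe x w) :=
  conformalForm_apply c x v w

end S2

end

noncomputable section

/-! ## The coordinates `(φ, u)` on the sphere -/

theorem polarParam_coord (a : ℝ) (z : ℝ × ℝ) :
    (polarParam a z).1 0 = Real.cos z.1 / Real.cosh (conformalY a z.2) ∧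
    (polarParam a z).1 1 = Real.sin z.1 / Real.cosh (conformalY a z.2) ∧
    (polarParam a z).1 2 = Real.tanh (conformalY a z.2) := ⟨rfl, rfl, rfl⟩

theorem hasDerivAt_tanh (y : ℝ) : HasDerivAt Real.tanh (1 / Real.cosh y ^ 2) y := by
  have h := (Real.hasDerivAt_sinh y).div (Real.hasDerivAt_cosh y) (Real.cosh_pos y).ne'
  have e : Real.tanh = fun y => Real.sinh y / Real.cosh y :=
    funext fun y => Real.tanh_eq_sinh_div_cosh y
  rw [e]
  convert! h using 1
  rw [show Real.cosh y * Real.cosh y - Real.sinh y * Real.sinh y = 1 by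
    nlinarith [Real.cosh_sq y]]

theorem contDiff_coe_polarParam {a : ℝ} (ha : -2 < a) :
    ContDiff ℝ ∞ (fun z => (polarParam a z).1) := by
  have hy : ContDiff ℝ ∞ (fun z : ℝ × ℝ => conformalY a z.2) :=
    (contDiff_conformalY ha).comp contDiff_snd
  have hc : ∀ z : ℝ × ℝ, Real.cosh (conformalY a z.2) ≠ 0 := fun z => (Real.cosh_pos _).ne'
  rw [contDiff_euclidean]
  refine Fin.forall_fin_succ.2 ⟨?_, Fin.forall_fin_succ.2 ⟨?_, Fin.forall_fin_succ.2
    ⟨?_, fun i => i.elim0⟩⟩⟩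
  · exact contDiff_fst.cos.div hy.cosh hc
  · exact contDiff_fst.sin.div hy.cosh hc
  · change ContDiff ℝ ∞ fun z : ℝ × ℝ => Real.tanh (conformalY a z.2)
    simp only [Real.tanh_eq_sinh_div_cosh]
    exact hy.sinh.div hy.cosh hc

theorem contMDiff_polarParam {a : ℝ} (ha : -2 < a) :
    ContMDiff 𝓘(ℝ, ℝ × ℝ) (𝓡 2) ∞ (polarParam a) := by
  have := S2.finrank_fact
  exact (contDiff_coe_polarParam ha).contMDiff.codRestrict_sphere (n := 2)
    (fun z => (polarParam a z).2)

/-- The derivative of `polarParam` as a map to `ℝ³`. -/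
theorem fderiv_polarParam {a : ℝ} (ha : -2 < a) (z v : ℝ × ℝ) :
    fderiv ℝ (fun z => (polarParam a z).1) z v = (Real.cosh (conformalY a z.2))⁻¹ •
        !₂[-Real.sin z.1 * v.1 -
            Real.cos z.1 * Real.tanh (conformalY a z.2) * ((quarticRoot a z.2)⁻¹ * v.2),
          Real.cos z.1 * v.1 -
            Real.sin z.1 * Real.tanh (conformalY a z.2) * ((quarticRoot a z.2)⁻¹ * v.2),
          (Real.cosh (conformalY a z.2))⁻¹ * ((quarticRoot a z.2)⁻¹ * v.2)] := by
  have hy : HasFDerivAt (fun z : ℝ × ℝ => conformalY a z.2)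
      ((quarticRoot a z.2)⁻¹ • ContinuousLinearMap.snd ℝ ℝ ℝ) z :=
    (hasDerivAt_conformalY' ha z.2).comp_hasFDerivAt z hasFDerivAt_snd
  have hφ : HasFDerivAt (fun z : ℝ × ℝ => z.1) (ContinuousLinearMap.fst ℝ ℝ ℝ) z := hasFDerivAt_fst
  have hc := (Real.cosh_pos (conformalY a z.2)).ne'
  have h0 := hφ.cos.mul ((hasDerivAt_inv hc).comp_hasFDerivAt z hy.cosh)
  have h1 := hφ.sin.mul ((hasDerivAt_inv hc).comp_hasFDerivAt z hy.cosh)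
  have h2 := (hasDerivAt_tanh _).comp_hasFDerivAt z hy
  have hd := ((contDiff_coe_polarParam ha).differentiable (by simp) z).hasFDerivAt
  have hi := fun i : Fin 3 =>
    (EuclideanSpace.proj (𝕜 := ℝ) i : EuclideanSpace ℝ (Fin 3) →L[ℝ] ℝ).hasFDerivAt.comp z hd
  have e0 := congrArg (fun L : ℝ × ℝ →L[ℝ] ℝ => L v) ((hi 0).unique h0)
  have e1 := congrArg (fun L : ℝ × ℝ →L[ℝ] ℝ => L v) ((hi 1).unique h1)
  have e2 := congrArg (fun L : ℝ × ℝ →L[ℝ] ℝ => L v) ((hi 2).unique h2)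
  simp at e0 e1 e2
  ext i
  rw [Real.tanh_eq_sinh_div_cosh]
  fin_cases i
  · simp [e0]; field_simp; ring
  · simp [e1]; field_simp; ring
  · simp [e2]; field_simp

/-- `(φ, y)` are the Mercator coordinates of the round sphere, with conformal factor `1 / cosh² y`;
the factor `A^(-1/2)` comes from `dy = A^(-1/4) du`. -/
theorem inner_fderiv_polarParam {a : ℝ} (ha : -2 < a) (z v w : ℝ × ℝ) :
    inner ℝ (fderiv ℝ (fun z => (polarParam a z).1) z v)
      (fderiv ℝ (fun z => (polarParam a z).1) z w) =
    (Real.cosh (conformalY a z.2) ^ 2)⁻¹ *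
      (v.1 * w.1 + (√(quarticA z.2 a 1))⁻¹ * (v.2 * w.2)) := by
  rw [fderiv_polarParam ha, fderiv_polarParam ha, ← quarticRoot_sq ha]
  have hr := (quarticRoot_pos ha z.2).ne'
  have hc := (Real.cosh_pos (conformalY a z.2)).ne'
  rw [inner_smul_left, inner_smul_right, PiLp.inner_apply, Fin.sum_univ_three,
    Real.tanh_eq_sinh_div_cosh]
  simp
  have h1 := Real.cosh_sq (conformalY a z.2)
  have h2 := Real.sin_sq_add_cos_sq z.1
  field_simp
  generalize Real.cosh (conformalY a z.2) = C at *
  generalize Real.sinh (conformalY a z.2) = S at *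
  generalize Real.sin z.1 = s at *
  generalize Real.cos z.1 = c at *
  have e : S ^ 2 = C ^ 2 - 1 := by linarith
  have e' : s ^ 2 = 1 - c ^ 2 := by linarith
  ring_nf
  simp only [e, e']
  ring

theorem dcoe_mfderiv_polarParam {a : ℝ} (ha : -2 < a) (z v : ℝ × ℝ) :
    S2.dcoe (polarParam a z) (mfderiv 𝓘(ℝ, ℝ × ℝ) (𝓡 2) (polarParam a) z v) =
      fderiv ℝ (fun z => (polarParam a z).1) z v :=
  S2.dcoe_mfderiv ((contMDiff_polarParam ha z).mdifferentiableAt (by simp)) v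

theorem bijective_mfderiv_polarParam {a : ℝ} (ha : -2 < a) (z : ℝ × ℝ) :
    Function.Bijective (mfderiv 𝓘(ℝ, ℝ × ℝ) (𝓡 2) (polarParam a) z) := by
  let L : (ℝ × ℝ) →ₗ[ℝ] EuclideanSpace ℝ (Fin 2) :=
    (mfderiv 𝓘(ℝ, ℝ × ℝ) (𝓡 2) (polarParam a) z).toLinearMap
  have hinj : Function.Injective L := by
    rw [injective_iff_map_eq_zero]
    intro v hv
    have h := inner_fderiv_polarParam ha z v v
    have h0 : fderiv ℝ (fun z => (polarParam a z).1) z v = 0 := by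
      rw [← dcoe_mfderiv_polarParam ha]
      exact (congrArg (S2.dcoe (polarParam a z)) hv).trans (map_zero _)
    have p1 := Real.cosh_pos (conformalY a z.2)
    have p2 := Real.sqrt_pos.2 (quarticA_pos ha z.2)
    rw [h0, inner_zero_left, eq_comm, mul_eq_zero_iff_left (by positivity)] at h
    have h1 := mul_self_nonneg v.1
    have p3 := inv_pos.2 p2
    have h2 : 0 ≤ (√(quarticA z.2 a 1))⁻¹ * (v.2 * v.2) := mul_nonneg p3.le (mul_self_nonneg _)
    have h3 : (√(quarticA z.2 a 1))⁻¹ * (v.2 * v.2) = 0 := by linarith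
    rw [mul_eq_zero_iff_left p3.ne'] at h3
    exact Prod.ext (mul_self_eq_zero.1 (by linarith)) (mul_self_eq_zero.1 h3)
  exact ⟨hinj, (LinearMap.injective_iff_surjective_of_finrank_eq_finrank (f := L) (by simp)).1 hinj⟩

theorem polarParam_height_mem (a : ℝ) (z : ℝ × ℝ) : (polarParam a z).1 2 ∈ Set.Ioo (-1 : ℝ) 1 :=
  ⟨Real.neg_one_lt_tanh _, Real.tanh_lt_one _⟩

theorem bijOn_polarParam {a : ℝ} (ha : -2 < a) :
    Set.BijOn (polarParam a) (Set.Ico 0 (2 * Real.pi) ×ˢ Set.univ)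
      {x : S2 | x.1 2 ≠ 1 ∧ x.1 2 ≠ -1} := by
  refine ⟨fun z _ => ⟨(polarParam_height_mem a z).2.ne, (polarParam_height_mem a z).1.ne'⟩, ?_, ?_⟩
  · intro z hz w hw h
    have h2 : Real.tanh (conformalY a z.2) = Real.tanh (conformalY a w.2) :=
      congrArg (fun x : S2 => x.1 2) h
    have e2 : z.2 = w.2 := (bijective_conformalY ha).1 (Real.tanh_injective h2)
    have h0 : Real.cos z.1 / Real.cosh (conformalY a z.2) =
      Real.cos w.1 / Real.cosh (conformalY a w.2) := congrArg (fun x : S2 => x.1 0) h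
    have h1 : Real.sin z.1 / Real.cosh (conformalY a z.2) =
      Real.sin w.1 / Real.cosh (conformalY a w.2) := congrArg (fun x : S2 => x.1 1) h
    rw [e2] at h0 h1
    have hc := (Real.cosh_pos (conformalY a w.2)).ne'
    have h0' := (div_left_inj' hc).1 h0
    have h1' := (div_left_inj' hc).1 h1
    have hang : (z.1 : Real.Angle) = w.1 := Real.Angle.cos_sin_inj h0' h1'
    obtain ⟨k, hk⟩ := Real.Angle.angle_eq_iff_two_pi_dvd_sub.1 hang
    have b1 := hz.1
    have b2 := hw.1
    have hk0 : k = 0 := by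
      have hp := Real.two_pi_pos
      have l1 : (k : ℝ) < 1 := by
        by_contra hcon
        have : 2 * Real.pi * 1 ≤ 2 * Real.pi * k := by gcongr; linarith
        linarith [b1.2, b2.1]
      have l2 : (-1 : ℝ) < k := by
        by_contra hcon
        have : 2 * Real.pi * k ≤ 2 * Real.pi * (-1) := by gcongr; linarith
        linarith [b1.1, b2.2]
      have l1' : k < 1 := by exact_mod_cast l1
      have l2' : -1 < k := by exact_mod_cast l2
      omega
    refine Prod.ext ?_ e2
    rw [hk0] at hk
    simp at hk
    linarith
  · intro x hx
    have hx2 : x.1 2 ∈ Set.Ioo (-1 : ℝ) 1 :=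
      ⟨lt_of_le_of_ne (S2.coord_mem_Icc x).1 (Ne.symm hx.2),
        lt_of_le_of_ne (S2.coord_mem_Icc x).2 hx.1⟩
    obtain ⟨y, -, hy⟩ := Real.tanh_surjOn hx2
    obtain ⟨u, rfl⟩ := (bijective_conformalY ha).2 y
    have hc := Real.cosh_pos (conformalY a u)
    have hsq := S2.coord_sq x
    have hcs := Real.cosh_sq (conformalY a u)
    set C := Real.cosh (conformalY a u)
    -- After scaling by `cosh y` the horizontal part of `x` is a unit complex number. Its argument,
    -- reduced to `[0, 2π)`, is the coordinate `φ`.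
    have hone : (C * x.1 0) ^ 2 + (C * x.1 1) ^ 2 = 1 := by
      have : C ^ 2 * (x.1 2) ^ 2 = C ^ 2 - 1 := by
        rw [← hy, Real.tanh_eq_sinh_div_cosh, div_pow, mul_div_cancel₀ _ (by positivity)]
        linarith
      nlinarith
    have hz : Complex.normSq ⟨C * x.1 0, C * x.1 1⟩ = 1 := by
      rw [Complex.normSq_mk]; linarith
    have hnz : (⟨C * x.1 0, C * x.1 1⟩ : ℂ) ≠ 0 := fun h => by rw [h] at hz; simp at hz
    have hn : ‖(⟨C * x.1 0, C * x.1 1⟩ : ℂ)‖ = 1 := by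
      rw [Complex.norm_def, hz, Real.sqrt_one]
    have hcos := Complex.cos_arg hnz
    have hsin := Complex.sin_arg (⟨C * x.1 0, C * x.1 1⟩ : ℂ)
    rw [hn, div_one] at hcos hsin
    set θ := Complex.arg ⟨C * x.1 0, C * x.1 1⟩
    refine ⟨(toIcoMod Real.two_pi_pos 0 θ, u), ⟨?_, trivial⟩, ?_⟩
    · have := toIcoMod_mem_Ico Real.two_pi_pos 0 θ
      rwa [zero_add] at this
    · have hθ : toIcoMod Real.two_pi_pos 0 θ = θ - toIcoDiv Real.two_pi_pos 0 θ * (2 * Real.pi) := by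
        rw [toIcoMod, zsmul_eq_mul]
      apply Subtype.ext
      ext i
      fin_cases i
      · change Real.cos (toIcoMod Real.two_pi_pos 0 θ) / C = x.1 0
        rw [hθ, Real.cos_sub_int_mul_two_pi, hcos]
        field_simp
      · change Real.sin (toIcoMod Real.two_pi_pos 0 θ) / C = x.1 1
        rw [hθ, Real.sin_sub_int_mul_two_pi, hsin]
        field_simp
      · exact hy

theorem range_polarParam {a : ℝ} (ha : -2 < a) :
    Set.range (polarParam a) = {x : S2 | x.1 2 ≠ 1 ∧ x.1 2 ≠ -1} := by
  apply Set.Subset.antisymm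
  · rintro _ ⟨z, rfl⟩
    exact ⟨(polarParam_height_mem a z).2.ne, (polarParam_height_mem a z).1.ne'⟩
  · rw [← (bijOn_polarParam ha).image_eq]
    exact Set.image_subset_range _ _

theorem finite_compl_range_polarParam {a : ℝ} (ha : -2 < a) :
    (Set.range (polarParam a))ᶜ.Finite := by
  refine Set.Finite.subset (Set.Finite.preimage (f := ((↑) : S2 → EuclideanSpace ℝ (Fin 3)))
    Subtype.val_injective.injOn (Set.toFinite {!₂[0, 0, 1], !₂[0, 0, -1]})) ?_
  intro x hx
  rw [range_polarParam ha] at hx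
  have hsq := S2.coord_sq x
  have h2 : x.1 2 = 1 ∨ x.1 2 = -1 := by
    by_contra hcon
    exact hx ⟨fun h => hcon (Or.inl h), fun h => hcon (Or.inr h)⟩
  have h01 : x.1 0 = 0 ∧ x.1 1 = 0 := by
    have : x.1 2 ^ 2 = 1 := by rcases h2 with h | h <;> rw [h] <;> norm_num
    constructor <;> apply pow_eq_zero_iff two_ne_zero |>.1 <;>
      nlinarith [sq_nonneg (x.1 0), sq_nonneg (x.1 1)]
  rcases h2 with h | h
  · left
    ext i
    fin_cases i
    · exact h01.1
    · exact h01.2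
    · exact h
  · right
    ext i
    fin_cases i
    · exact h01.1
    · exact h01.2
    · exact h

/-- Only finitely many points are missed. Identities on the cotangent bundle can thus be checked in
polar coordinates and extended by continuity. -/
theorem dense_chart_preimage_range_polarParam {a : ℝ} (ha : -2 < a)
    {e : OpenPartialHomeomorph S2 (EuclideanSpace ℝ (Fin 2))}
    (he : e ∈ atlas (EuclideanSpace ℝ (Fin 2)) S2) :
    Dense (e.symm ⁻¹' Set.range (polarParam a)) := by
  have hinj : Function.Injective e.symm := fun p q h =>
    e.symm.injOn (by simp [S2.target_eq_univ he]) (by simp [S2.target_eq_univ he]) h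
  have hfin := (finite_compl_range_polarParam ha).preimage hinj.injOn
  have := Set.Countable.dense_compl ℝ hfin.countable
  rwa [Set.preimage_compl, compl_compl] at this

theorem denseRange_polarParam {a : ℝ} (ha : -2 < a) : DenseRange (polarParam a) := by
  intro x
  let e := chartAt (EuclideanSpace ℝ (Fin 2)) x
  have he : e ∈ atlas (EuclideanSpace ℝ (Fin 2)) S2 := chart_mem_atlas _ x
  have hx : x ∈ e.source := mem_chart_source _ x
  have hd := dense_chart_preimage_range_polarParam ha he (e x)
  have hc : ContinuousAt e.symm (e x) := e.symm.continuousAt (e.map_source hx)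
  have := mem_closure_image hc hd
  rw [e.left_inv hx] at this
  exact closure_mono (Set.image_preimage_subset _ _) this

end

noncomputable section

/-! ## Existence and uniqueness of the system on the sphere -/

theorem contMDiff_comp_height {f : ℝ → ℝ} (hf : ∀ w ∈ Set.Icc (-1 : ℝ) 1, ContDiffAt ℝ ∞ f w) :
    ContMDiff (𝓡 2) 𝓘(ℝ, ℝ) ∞ (fun x : S2 => f (x.1 2)) := by
  intro x
  have h : ContMDiff (𝓡 2) 𝓘(ℝ, ℝ) ∞ (fun x : S2 => x.1 2) :=
    (EuclideanSpace.proj (𝕜 := ℝ) (2 : Fin 3) :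
      EuclideanSpace ℝ (Fin 3) →L[ℝ] ℝ).contDiff.contMDiff.comp S2.contMDiff_coe
  exact (hf _ (S2.coord_mem_Icc x)).contMDiffAt.comp x (h x)

theorem exists_sphere_coefficients {a : ℝ} (ha : -2 < a) : ∃ f g α β γ : S2 → ℝ,
    (ContMDiff (𝓡 2) 𝓘(ℝ, ℝ) ∞ f ∧ ContMDiff (𝓡 2) 𝓘(ℝ, ℝ) ∞ g ∧ ContMDiff (𝓡 2) 𝓘(ℝ, ℝ) ∞ α ∧
      ContMDiff (𝓡 2) 𝓘(ℝ, ℝ) ∞ β ∧ ContMDiff (𝓡 2) 𝓘(ℝ, ℝ) ∞ γ) ∧ (∀ x, 0 < f x) ∧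
    ∀ z : ℝ × ℝ,
      f (polarParam a z) = Real.cosh (conformalY a z.2) ^ 2 / √(quarticA z.2 a 1) ∧
      g (polarParam a z) = potentialAmp a z.2 * Real.cosh (conformalY a z.2) ∧
      α (polarParam a z) = - quarticRoot a z.2 / Real.cosh (conformalY a z.2) ∧
      β (polarParam a z) = Real.cosh (conformalY a z.2) *
        (z.2 - Real.tanh (conformalY a z.2) * quarticRoot a z.2) ∧
      γ (polarParam a z) = (a + 2 * z.2 ^ 2 - 2 * √(quarticA z.2 a 1)) *
        Real.cosh (conformalY a z.2) ^ 2 := by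
  obtain ⟨f, g, α, β, γ, hs, h⟩ := exists_smooth_coefficients ha
  exact ⟨fun x => f (x.1 2), fun x => g (x.1 2), fun x => α (x.1 2), fun x => β (x.1 2),
    fun x => γ (x.1 2),
    ⟨contMDiff_comp_height fun w hw => (hs w hw).1,
      contMDiff_comp_height fun w hw => (hs w hw).2.1,
      contMDiff_comp_height fun w hw => (hs w hw).2.2.1,
      contMDiff_comp_height fun w hw => (hs w hw).2.2.2.1,
      contMDiff_comp_height fun w hw => (hs w hw).2.2.2.2.1⟩,
    fun x => (hs _ (S2.coord_mem_Icc x)).2.2.2.2.2, fun z => h z.2⟩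

/-- The conformal factor is the quotient of `A^(-1/2)` and `1 / cosh² y`. In the potential, `x₀ =
cos φ / cosh y` is split off: the cofactor is a smooth function of the height alone. The form `x₀ g`
is recorded because it shows that the potential vanishes at the poles. -/
theorem exists_extendsH1 {a : ℝ} (ha : -2 < a) : ∃ (f : S2 → ℝ)
    (hf : ContMDiff (𝓡 2) 𝓘(ℝ, ℝ) ∞ f) (hpos : ∀ x, 0 < f x) (S : ConservativeSystem 2 S2),
    S.metric = S2.conformalMetric f hf hpos ∧ (∃ g : S2 → ℝ, ∀ x, S.potential x = x.1 0 * g x) ∧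
      ExtendsH1 a S := by
  obtain ⟨f, g, α, β, γ, ⟨hf, hg, -⟩, hpos, h⟩ := exists_sphere_coefficients ha
  have hU : ContMDiff (𝓡 2) 𝓘(ℝ, ℝ) ∞ (fun x : S2 => x.1 0 * g x) :=
    ((EuclideanSpace.proj (𝕜 := ℝ) (0 : Fin 3) :
      EuclideanSpace ℝ (Fin 3) →L[ℝ] ℝ).contDiff.contMDiff.comp S2.contMDiff_coe).mul hg
  refine ⟨f, hf, hpos, ⟨S2.conformalMetric f hf hpos, _, hU⟩, rfl, ⟨g, fun _ => rfl⟩, ?_, ?_⟩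
  · intro z v w
    rw [S2.conformalMetric_inner, dcoe_mfderiv_polarParam ha, dcoe_mfderiv_polarParam ha,
      inner_fderiv_polarParam ha, (h z).1]
    have := (Real.cosh_pos (conformalY a z.2)).ne'
    field_simp
  · intro z
    simp only
    rw [(h z).2.1, (polarParam_coord a z).1, potentialAmp]
    have := (Real.cosh_pos (conformalY a z.2)).ne'
    field_simp

theorem SmoothMetric.ext_inner {g₁ g₂ : SmoothMetric 2 S2} (h : ∀ x, g₁.inner x = g₂.inner x) :
    g₁ = g₂ := by
  cases g₁
  cases g₂
  congr
  exact funext h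

/-- In a trivialisation at `x₀` both metrics are continuous maps to a fixed space of bilinear forms,
so they have the same limit at `x₀` along `s`. -/
theorem SmoothMetric.ext_of_dense {g₁ g₂ : SmoothMetric 2 S2} {s : Set S2} (hs : Dense s)
    (h : ∀ x ∈ s, g₁.inner x = g₂.inner x) : g₁ = g₂ := by
  refine SmoothMetric.ext_inner fun x₀ => ?_
  have hc₁ := ((contMDiffAt_hom_bundle _).1 (g₁.contMDiff x₀)).2.continuousAt
  have hc₂ := ((contMDiffAt_hom_bundle _).1 (g₂.contMDiff x₀)).2.continuousAt
  have hne : (nhdsWithin x₀ s).NeBot := mem_closure_iff_nhdsWithin_neBot.1 (hs x₀)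
  have heq := tendsto_nhds_unique_of_eventuallyEq (hc₁.mono_left nhdsWithin_le_nhds)
    (hc₂.mono_left nhdsWithin_le_nhds) (l := nhdsWithin x₀ s) (by
      filter_upwards [self_mem_nhdsWithin] with x hx
      rw [h x hx])
  have hx : x₀ ∈ (trivializationAt (EuclideanSpace ℝ (Fin 2))
      (fun x : S2 => TangentSpace (𝓡 2) x) x₀).baseSet :=
    FiberBundle.mem_baseSet_trivializationAt' x₀
  let t := trivializationAt (EuclideanSpace ℝ (Fin 2)) (fun x : S2 => TangentSpace (𝓡 2) x) x₀
  have hv : ∀ v : TangentSpace (𝓡 2) x₀, ∃ w, t.symm x₀ w = v := fun v =>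
    ⟨(t ⟨x₀, v⟩).2, t.symm_proj_apply ⟨x₀, v⟩ hx⟩
  ext v w
  obtain ⟨v, rfl⟩ := hv v
  obtain ⟨w, rfl⟩ := hv w
  have := congrArg (fun L : EuclideanSpace ℝ (Fin 2) →L[ℝ] EuclideanSpace ℝ (Fin 2) →L[ℝ] ℝ =>
    L v w) heq
  simp only at this
  rw [inCoordinates_apply_eq₂ hx hx (Set.mem_univ _),
    inCoordinates_apply_eq₂ hx hx (Set.mem_univ _)] at this
  simpa using this

theorem ExtendsH1.unique {a : ℝ} (ha : -2 < a) {S₁ S₂ : ConservativeSystem 2 S2}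
    (h₁ : ExtendsH1 a S₁) (h₂ : ExtendsH1 a S₂) : S₁ = S₂ := by
  have hU : S₁.potential = S₂.potential := by
    refine (denseRange_polarParam ha).equalizer S₁.potential_smooth.continuous
      S₂.potential_smooth.continuous (funext fun z => ?_)
    exact (h₁.potential_eq z).trans (h₂.potential_eq z).symm
  have hg : S₁.metric = S₂.metric := by
    refine SmoothMetric.ext_of_dense (denseRange_polarParam ha) ?_
    rintro _ ⟨z, rfl⟩
    ext v w
    obtain ⟨v, rfl⟩ := (bijective_mfderiv_polarParam ha z).2 v
    obtain ⟨w, rfl⟩ := (bijective_mfderiv_polarParam ha z).2 w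
    exact (h₁.metric_eq z v w).trans (h₂.metric_eq z v w).symm
  cases S₁
  cases S₂
  simp only at hU hg
  subst hU hg
  rfl

theorem ExtendsH1.exists_conformal {a : ℝ} (ha : -2 < a) {S : ConservativeSystem 2 S2}
    (h : ExtendsH1 a S) : ∃ (f : S2 → ℝ) (hf : ContMDiff (𝓡 2) 𝓘(ℝ, ℝ) ∞ f)
      (hpos : ∀ x, 0 < f x), S.metric = S2.conformalMetric f hf hpos := by
  obtain ⟨f, hf, hpos, S', hm, -, h'⟩ := exists_extendsH1 ha
  rw [h.unique ha h']
  exact ⟨f, hf, hpos, hm⟩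

theorem ExtendsH1.mem_range_of_potential_ne_zero {a : ℝ} (ha : -2 < a)
    {S : ConservativeSystem 2 S2} (h : ExtendsH1 a S) {x : S2} (hx : S.potential x ≠ 0) :
    x ∈ Set.range (polarParam a) := by
  obtain ⟨f, hf, hpos, S', hm, ⟨g, hg⟩, h'⟩ := exists_extendsH1 ha
  rw [h.unique ha h', hg] at hx
  have h0 : x.1 0 ≠ 0 := left_ne_zero_of_mul hx
  have hs := S2.coord_sq x
  rw [range_polarParam ha]
  have hpos : 0 < x.1 0 ^ 2 := by positivity
  constructor <;> intro h2 <;> rw [h2] at hs <;> nlinarith [sq_nonneg (x.1 1)]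

theorem existsUnique_extendsH1 {a : ℝ} (ha : -2 < a) :
    ∃! S : ConservativeSystem 2 S2, ExtendsH1 a S := by
  obtain ⟨f, hf, hpos, S, hm, -, h⟩ := exists_extendsH1 ha
  exact ⟨S, h, fun S' h' => h'.unique ha h⟩

end

noncomputable section

/-! ## Poisson brackets and point transformations -/

section PointTransformations

variable {n : ℕ}

/-- The Poisson bracket in canonical coordinates. -/
def canonicalBracket (f g : EuclideanSpace ℝ (Fin n) × EuclideanSpace ℝ (Fin n) → ℝ)
    (z : EuclideanSpace ℝ (Fin n) × EuclideanSpace ℝ (Fin n)) : ℝ :=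
  ∑ i : Fin n, (fderiv ℝ f z (EuclideanSpace.single i 1, 0) *
      fderiv ℝ g z (0, EuclideanSpace.single i 1) -
    fderiv ℝ f z (0, EuclideanSpace.single i 1) * fderiv ℝ g z (EuclideanSpace.single i 1, 0))

/-- The transpose of the derivative of `ψ`, applied to a momentum. -/
def momentumPullback (ψ : EuclideanSpace ℝ (Fin n) → EuclideanSpace ℝ (Fin n))
    (z : EuclideanSpace ℝ (Fin n) × EuclideanSpace ℝ (Fin n)) : EuclideanSpace ℝ (Fin n) :=
  ∑ i, inner ℝ z.2 (fderiv ℝ ψ z.1 (EuclideanSpace.single i 1)) • EuclideanSpace.single i 1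

theorem sum_smul_single (v : EuclideanSpace ℝ (Fin n)) :
    ∑ i, v i • EuclideanSpace.single i (1 : ℝ) = v := by
  ext j
  simp [Pi.single_apply]

theorem inner_momentumPullback (ψ : EuclideanSpace ℝ (Fin n) → EuclideanSpace ℝ (Fin n))
    (z : EuclideanSpace ℝ (Fin n) × EuclideanSpace ℝ (Fin n)) (η : EuclideanSpace ℝ (Fin n)) :
    inner ℝ (momentumPullback ψ z) η = inner ℝ z.2 (fderiv ℝ ψ z.1 η) := by
  nth_rewrite 2 [← sum_smul_single η]
  simp only [momentumPullback, sum_inner, inner_smul_left, map_sum, map_smul, inner_sum,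
    inner_smul_right]
  simp [EuclideanSpace.inner_single_left, mul_comm]

/-- Differentiating `ψ'(z)ᵀ p` gives `ψ'(z)ᵀ ρ` and a term with the second derivative of `ψ`. Only
scalar products with `η` are recorded, which avoids transposes. -/
theorem hasFDerivAt_momentumPullback {ψ : EuclideanSpace ℝ (Fin n) → EuclideanSpace ℝ (Fin n)}
    {z p : EuclideanSpace ℝ (Fin n)} (hψ : ContDiffAt ℝ 2 ψ z) :
    ∃ T' : EuclideanSpace ℝ (Fin n) × EuclideanSpace ℝ (Fin n) →L[ℝ] EuclideanSpace ℝ (Fin n),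
      HasFDerivAt (momentumPullback ψ) T' (z, p) ∧
      ∀ δ ρ η, inner ℝ (T' (δ, ρ)) η =
        inner ℝ ρ (fderiv ℝ ψ z η) + inner ℝ p (fderiv ℝ (fderiv ℝ ψ) z δ η) := by
  have h2 : HasFDerivAt (fderiv ℝ ψ) (fderiv ℝ (fderiv ℝ ψ) z) z :=
    ((hψ.fderiv_right (m := 1) (by norm_num)).differentiableAt (by simp)).hasFDerivAt
  have hη : ∀ η, HasFDerivAt (fun w : EuclideanSpace ℝ (Fin n) × EuclideanSpace ℝ (Fin n) =>
      inner ℝ w.2 (fderiv ℝ ψ w.1 η)) _ (z, p) := fun η => by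
    have h3 : HasFDerivAt (fun w : EuclideanSpace ℝ (Fin n) × EuclideanSpace ℝ (Fin n) =>
      fderiv ℝ ψ w.1) _ (z, p) := h2.comp (z, p) hasFDerivAt_fst
    exact hasFDerivAt_snd.inner ℝ (h3.clm_apply (hasFDerivAt_const η (z, p)))
  have hT : DifferentiableAt ℝ (momentumPullback ψ) (z, p) := by
    unfold momentumPullback
    refine DifferentiableAt.fun_sum fun i _ => ?_
    exact (hη _).differentiableAt.smul_const _
  refine ⟨_, hT.hasFDerivAt, fun δ ρ η => ?_⟩
  have h4 := hT.hasFDerivAt.inner ℝ (hasFDerivAt_const η (z, p))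
  have h5 : (fun w => inner ℝ (momentumPullback ψ w) η) =
      fun w : EuclideanSpace ℝ (Fin n) × EuclideanSpace ℝ (Fin n) =>
        inner ℝ w.2 (fderiv ℝ ψ w.1 η) := funext fun w => inner_momentumPullback ψ w η
  rw [h5] at h4
  have h6 := congrArg (fun L : EuclideanSpace ℝ (Fin n) × EuclideanSpace ℝ (Fin n) →L[ℝ] ℝ =>
    L (δ, ρ)) (h4.unique (hη η))
  simp at h6
  rw [h6, add_comm]

theorem inner_sum_apply_single
    (L : EuclideanSpace ℝ (Fin n) × EuclideanSpace ℝ (Fin n) →L[ℝ] ℝ)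
    (ρ : EuclideanSpace ℝ (Fin n)) :
    inner ℝ (∑ i, L (0, EuclideanSpace.single i 1) • EuclideanSpace.single i (1 : ℝ)) ρ =
      L (0, ρ) := by
  have : (0, ρ) = ∑ i, ρ i • ((0 : EuclideanSpace ℝ (Fin n)),
      (EuclideanSpace.single i (1 : ℝ) : EuclideanSpace ℝ (Fin n))) := by
    refine Prod.ext ?_ ?_
    · simp [Prod.fst_sum]
    · simp only [Prod.snd_sum, Prod.smul_snd, sum_smul_single]
  rw [this, map_sum, sum_inner]
  simp only [map_smul, smul_eq_mul, inner_smul_left]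
  simp [EuclideanSpace.inner_single_left, mul_comm]

theorem sum_apply_single_mul
    (L L' : EuclideanSpace ℝ (Fin n) × EuclideanSpace ℝ (Fin n) →L[ℝ] ℝ) :
    ∑ i, (L (EuclideanSpace.single i 1, 0) * L' (0, EuclideanSpace.single i 1) -
      L (0, EuclideanSpace.single i 1) * L' (EuclideanSpace.single i 1, 0)) =
    L (∑ i, L' (0, EuclideanSpace.single i 1) • EuclideanSpace.single i (1 : ℝ), 0) -
    L' (∑ i, L (0, EuclideanSpace.single i 1) • EuclideanSpace.single i (1 : ℝ), 0) := by
  have hsum : ∀ (L L' : EuclideanSpace ℝ (Fin n) × EuclideanSpace ℝ (Fin n) →L[ℝ] ℝ),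
      ∑ i, L (EuclideanSpace.single i 1, 0) * L' (0, EuclideanSpace.single i 1) =
      L (∑ i, L' (0, EuclideanSpace.single i 1) • EuclideanSpace.single i (1 : ℝ), 0) := by
    intro L L'
    have : ((∑ i, L' (0, EuclideanSpace.single i 1) •
        (EuclideanSpace.single i (1 : ℝ) : EuclideanSpace ℝ (Fin n))), (0 :
          EuclideanSpace ℝ (Fin n))) = ∑ i, L' (0, EuclideanSpace.single i 1) •
        ((EuclideanSpace.single i (1 : ℝ) : EuclideanSpace ℝ (Fin n)),
          (0 : EuclideanSpace ℝ (Fin n))) := by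
      refine Prod.ext ?_ ?_
      · simp [Prod.fst_sum]
      · simp [Prod.snd_sum]
    rw [this, map_sum]
    simp only [map_smul, smul_eq_mul, mul_comm]
  rw [Finset.sum_sub_distrib, hsum, ← hsum L' L]
  congr 1
  exact Finset.sum_congr rfl fun i _ => mul_comm _ _

/-- The chain rule for functions related by a point transformation. -/
theorem fderiv_apply_of_eq_momentumPullback
    {ψ : EuclideanSpace ℝ (Fin n) → EuclideanSpace ℝ (Fin n)} {z p : EuclideanSpace ℝ (Fin n)}
    (hψ : DifferentiableAt ℝ ψ z)
    {T' : EuclideanSpace ℝ (Fin n) × EuclideanSpace ℝ (Fin n) →L[ℝ] EuclideanSpace ℝ (Fin n)}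
    (hT : HasFDerivAt (momentumPullback ψ) T' (z, p))
    {f f' : EuclideanSpace ℝ (Fin n) × EuclideanSpace ℝ (Fin n) → ℝ}
    (hf : DifferentiableAt ℝ f (ψ z, p))
    (hf' : DifferentiableAt ℝ f' (z, momentumPullback ψ (z, p)))
    (hff' : ∀ᶠ y in nhds z, ∀ p, f (ψ y, p) = f' (y, momentumPullback ψ (y, p)))
    (δ ρ : EuclideanSpace ℝ (Fin n)) :
    fderiv ℝ f (ψ z, p) (fderiv ℝ ψ z δ, ρ) =
      fderiv ℝ f' (z, momentumPullback ψ (z, p)) (δ, T' (δ, ρ)) := by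
  have h1 : HasFDerivAt (fun w : EuclideanSpace ℝ (Fin n) × EuclideanSpace ℝ (Fin n) =>
      (ψ w.1, w.2)) _ (z, p) :=
    (hψ.hasFDerivAt.comp (z, p) hasFDerivAt_fst).prodMk hasFDerivAt_snd
  have h2 : HasFDerivAt (fun w : EuclideanSpace ℝ (Fin n) × EuclideanSpace ℝ (Fin n) =>
      f (ψ w.1, w.2)) _ (z, p) := hf.hasFDerivAt.comp (z, p) h1
  have h3 : HasFDerivAt (fun w : EuclideanSpace ℝ (Fin n) × EuclideanSpace ℝ (Fin n) =>
      (w.1, momentumPullback ψ w)) _ (z, p) := hasFDerivAt_fst.prodMk hT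
  have h4 : HasFDerivAt (fun w : EuclideanSpace ℝ (Fin n) × EuclideanSpace ℝ (Fin n) =>
      f' (w.1, momentumPullback ψ w)) _ (z, p) := hf'.hasFDerivAt.comp (z, p) h3
  have h5 : (fun w : EuclideanSpace ℝ (Fin n) × EuclideanSpace ℝ (Fin n) => f (ψ w.1, w.2))
      =ᶠ[nhds (z, p)] fun w => f' (w.1, momentumPullback ψ w) := by
    filter_upwards [(continuousAt_fst (p := (z, p))).eventually hff'] with w hw
    exact hw w.2
  have := congrArg (fun L : EuclideanSpace ℝ (Fin n) × EuclideanSpace ℝ (Fin n) →L[ℝ] ℝ =>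
    L (δ, ρ)) (h2.unique (h4.congr_of_eventuallyEq h5))
  simpa using this

/-- The Poisson bracket is invariant under point transformations. -/
theorem canonicalBracket_pullback {ψ : EuclideanSpace ℝ (Fin n) → EuclideanSpace ℝ (Fin n)}
    {z p : EuclideanSpace ℝ (Fin n)} (hψ : ContDiffAt ℝ 2 ψ z)
    {f g f' g' : EuclideanSpace ℝ (Fin n) × EuclideanSpace ℝ (Fin n) → ℝ}
    (hf : DifferentiableAt ℝ f (ψ z, p)) (hg : DifferentiableAt ℝ g (ψ z, p))
    (hf' : DifferentiableAt ℝ f' (z, momentumPullback ψ (z, p)))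
    (hg' : DifferentiableAt ℝ g' (z, momentumPullback ψ (z, p)))
    (hff' : ∀ᶠ y in nhds z, ∀ p, f (ψ y, p) = f' (y, momentumPullback ψ (y, p)))
    (hgg' : ∀ᶠ y in nhds z, ∀ p, g (ψ y, p) = g' (y, momentumPullback ψ (y, p))) :
    canonicalBracket f g (ψ z, p) = canonicalBracket f' g' (z, momentumPullback ψ (z, p)) := by
  obtain ⟨T', hT, hT'⟩ := hasFDerivAt_momentumPullback (p := p) hψ
  have hψd := hψ.differentiableAt (by simp)
  have hsym : ∀ δ η, fderiv ℝ (fderiv ℝ ψ) z δ η = fderiv ℝ (fderiv ℝ ψ) z η δ :=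
    fun δ η => (hψ.isSymmSndFDerivAt (by simp)).eq δ η
  have kf := fderiv_apply_of_eq_momentumPullback hψd hT hf hf' hff'
  have kg := fderiv_apply_of_eq_momentumPullback hψd hT hg hg' hgg'
  unfold canonicalBracket
  rw [sum_apply_single_mul, sum_apply_single_mul]
  generalize fderiv ℝ f (ψ z, p) = Df, fderiv ℝ g (ψ z, p) = Dg at kf kg ⊢
  generalize fderiv ℝ f' (z, momentumPullback ψ (z, p)) = Df',
    fderiv ℝ g' (z, momentumPullback ψ (z, p)) = Dg' at kf kg ⊢
  -- The gradient in the momenta is a tangent vector and is pushed forward by the derivative of `ψ`;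
  -- this is the chain rule with `δ = 0`.
  have hpush : ∀ (L L' : EuclideanSpace ℝ (Fin n) × EuclideanSpace ℝ (Fin n) →L[ℝ] ℝ),
      (∀ δ ρ, L (fderiv ℝ ψ z δ, ρ) = L' (δ, T' (δ, ρ))) →
      ∑ i, L (0, EuclideanSpace.single i 1) • EuclideanSpace.single i (1 : ℝ) =
        fderiv ℝ ψ z (∑ i, L' (0, EuclideanSpace.single i 1) • EuclideanSpace.single i (1 : ℝ)) := by
    intro L L' h
    refine ext_inner_right ℝ fun ρ => ?_
    have h0 := h 0 ρ
    rw [map_zero] at h0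
    have h1 := hT' 0 ρ (∑ i, L' (0, EuclideanSpace.single i 1) • EuclideanSpace.single i (1 : ℝ))
    rw [inner_sum_apply_single, h0, real_inner_comm, ← inner_sum_apply_single, real_inner_comm, h1]
    simp
  rw [hpush _ _ kf, hpush _ _ kg, kf, kg]
  set X := ∑ i, Dg' (0, EuclideanSpace.single i 1) • EuclideanSpace.single i (1 : ℝ) with hX
  set Y := ∑ i, Df' (0, EuclideanSpace.single i 1) • EuclideanSpace.single i (1 : ℝ) with hY
  have e1 : Df' (X, T' (X, 0)) = Df' (X, 0) + inner ℝ Y (T' (X, 0)) := by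
    rw [hY, inner_sum_apply_single, ← map_add]; simp
  have e2 : Dg' (Y, T' (Y, 0)) = Dg' (Y, 0) + inner ℝ X (T' (Y, 0)) := by
    rw [hX, inner_sum_apply_single, ← map_add]; simp
  -- The only terms which do not transform tensorially contain the second derivative of `ψ`. By its
  -- symmetry they agree and cancel in the bracket.
  have e3 : inner ℝ Y (T' (X, 0)) = inner ℝ X (T' (Y, 0)) := by
    rw [← real_inner_comm Y, ← real_inner_comm X, hT', hT', hsym X Y]
    simp
  rw [e1, e2, e3]
  ring

end PointTransformations

end

noncomputable section

/-! ## Phase functions in a local parametrization of the sphere -/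

namespace PhaseFunction

/-- The phase function `F` in the canonical coordinates of the parametrization `P`. -/
def pullback (F : PhaseFunction 2 S2) (P : EuclideanSpace ℝ (Fin 2) → S2)
    (z : EuclideanSpace ℝ (Fin 2) × EuclideanSpace ℝ (Fin 2)) : ℝ :=
  F (P z.1) ((innerSL ℝ z.2).comp (ContinuousLinearMap.inverse
    (mfderiv (𝓡 2) (𝓡 2) P z.1 : EuclideanSpace ℝ (Fin 2) →L[ℝ] EuclideanSpace ℝ (Fin 2))))

end PhaseFunction

namespace S2

section Parametrization

variable {P : EuclideanSpace ℝ (Fin 2) → S2}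
  {e : OpenPartialHomeomorph S2 (EuclideanSpace ℝ (Fin 2))}

theorem isInvertible_of_bijective
    {L : EuclideanSpace ℝ (Fin 2) →L[ℝ] EuclideanSpace ℝ (Fin 2)} (hL : Function.Bijective L) :
    L.IsInvertible :=
  ⟨ContinuousLinearEquiv.ofBijective L (LinearMap.ker_eq_bot.2 hL.1)
    (LinearMap.range_eq_top.2 hL.2), ContinuousLinearEquiv.coe_ofBijective _ _ _⟩

theorem isInvertible_mfderiv {z : EuclideanSpace ℝ (Fin 2)}
    (hb : Function.Bijective (mfderiv (𝓡 2) (𝓡 2) P z)) :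
    (mfderiv (𝓡 2) (𝓡 2) P z :
      EuclideanSpace ℝ (Fin 2) →L[ℝ] EuclideanSpace ℝ (Fin 2)).IsInvertible :=
  isInvertible_of_bijective hb

theorem contDiffAt_chart_comp (he : e ∈ atlas (EuclideanSpace ℝ (Fin 2)) S2)
    (hP : ContMDiff (𝓡 2) (𝓡 2) ∞ P) {z : EuclideanSpace ℝ (Fin 2)} (hz : P z ∈ e.source) :
    ContDiffAt ℝ ∞ (e ∘ P) z := by
  have h := (contMDiffOn_of_mem_maximalAtlas (IsManifold.subset_maximalAtlas (I := 𝓡 2) (n := ∞) he)).contMDiffAt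
    (e.open_source.mem_nhds hz)
  exact contMDiffAt_iff_contDiffAt.1 (h.comp z (hP z))

theorem fderiv_chart_comp (he : e ∈ atlas (EuclideanSpace ℝ (Fin 2)) S2)
    (hP : ContMDiff (𝓡 2) (𝓡 2) ∞ P) {z : EuclideanSpace ℝ (Fin 2)} (hz : P z ∈ e.source)
    (v : EuclideanSpace ℝ (Fin 2)) :
    fderiv ℝ (e ∘ P) z v = mfderiv (𝓡 2) (𝓡 2) e (P z) (mfderiv (𝓡 2) (𝓡 2) P z v) := by
  rw [← mfderiv_eq_fderiv]
  have := mfderiv_comp z (mdifferentiableAt_atlas (I := 𝓡 2) he hz) ((hP z).mdifferentiableAt (by simp))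
  exact congrArg (fun L : EuclideanSpace ℝ (Fin 2) →L[ℝ] EuclideanSpace ℝ (Fin 2) => L v) this

theorem bijective_fderiv_chart_comp (he : e ∈ atlas (EuclideanSpace ℝ (Fin 2)) S2)
    (hP : ContMDiff (𝓡 2) (𝓡 2) ∞ P) {z : EuclideanSpace ℝ (Fin 2)} (hz : P z ∈ e.source)
    (hb : Function.Bijective (mfderiv (𝓡 2) (𝓡 2) P z)) :
    Function.Bijective (fderiv ℝ (e ∘ P) z) := by
  have h1 : Function.Bijective (mfderiv (𝓡 2) (𝓡 2) e (P z)) := by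
    refine ⟨fun v w h => ?_, fun w => ⟨mfderiv (𝓡 2) (𝓡 2) e.symm (e (P z)) w, ?_⟩⟩
    · have key := fun v => congrArg (fun L : TangentSpace (𝓡 2) (P z) →L[ℝ]
        TangentSpace (𝓡 2) (P z) => L v) ((mdifferentiable_chart he).symm_comp_deriv hz)
      have := congrArg (mfderiv (𝓡 2) (𝓡 2) e.symm (e (P z))) h
      exact (key v).symm.trans (this.trans (key w))
    · have h := (mdifferentiable_chart he).comp_symm_deriv (e.map_source hz)
      rw [e.left_inv hz] at h
      exact congrArg (fun L : EuclideanSpace ℝ (Fin 2) →L[ℝ] EuclideanSpace ℝ (Fin 2) => L w) h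
  have h2 : ⇑(fderiv ℝ (e ∘ P) z) =
      (mfderiv (𝓡 2) (𝓡 2) e (P z)) ∘ (mfderiv (𝓡 2) (𝓡 2) P z) :=
    funext fun v => fderiv_chart_comp he hP hz v
  rw [h2]
  exact h1.comp hb

/-- With `ψ = e ∘ P`, chart momenta `p` correspond to momenta `ψ'ᵀ p` in the parametrization. This
is the relation between two coordinate expressions that `canonicalBracket_pullback` requires; it
needs no inverse of `ψ`. -/
theorem inChart_eq_pullback (F : PhaseFunction 2 S2)
    (he : e ∈ atlas (EuclideanSpace ℝ (Fin 2)) S2)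
    (hP : ContMDiff (𝓡 2) (𝓡 2) ∞ P) {z : EuclideanSpace ℝ (Fin 2)} (hz : P z ∈ e.source)
    (hb : Function.Bijective (mfderiv (𝓡 2) (𝓡 2) P z)) (p : EuclideanSpace ℝ (Fin 2)) :
    F.inChart e ((e ∘ P) z, p) = F.pullback P (z, momentumPullback (e ∘ P) (z, p)) := by
  have h1 : ∀ x y : S2, x = y → F x ((innerSL ℝ p).comp (mfderiv (𝓡 2) (𝓡 2) e x)) =
      F y ((innerSL ℝ p).comp (mfderiv (𝓡 2) (𝓡 2) e y)) := by rintro x _ rfl; rfl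
  refine (h1 _ _ (e.left_inv hz)).trans ?_
  unfold PhaseFunction.pullback
  congr 1
  ext v
  obtain ⟨v, rfl⟩ := hb.2 v
  have hinv := (isInvertible_mfderiv hb).inverse_apply_eq.2 (rfl : mfderiv (𝓡 2) (𝓡 2) P z v = _)
  change inner ℝ p (mfderiv (𝓡 2) (𝓡 2) e (P z) (mfderiv (𝓡 2) (𝓡 2) P z v)) =
    inner ℝ (momentumPullback (e ∘ P) (z, p)) _
  refine (congrArg (inner ℝ p) (fderiv_chart_comp he hP hz v).symm).trans ?_
  refine (inner_momentumPullback (e ∘ P) (z, p) v).symm.trans ?_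
  exact congrArg _ hinv.symm

theorem pullback_eq_of_forall {F : PhaseFunction 2 S2} {z : EuclideanSpace ℝ (Fin 2)}
    (hb : Function.Bijective (mfderiv (𝓡 2) (𝓡 2) P z)) {Φ : ℝ → ℝ → ℝ}
    (h : ∀ p : TangentSpace (𝓡 2) (P z) →L[ℝ] ℝ, F (P z) p =
      Φ (p (mfderiv (𝓡 2) (𝓡 2) P z (EuclideanSpace.single 0 1 : EuclideanSpace ℝ (Fin 2))))
        (p (mfderiv (𝓡 2) (𝓡 2) P z (EuclideanSpace.single 1 1 : EuclideanSpace ℝ (Fin 2)))))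
    (p : EuclideanSpace ℝ (Fin 2)) : F.pullback P (z, p) = Φ (p 0) (p 1) := by
  have hinv : ∀ v, ContinuousLinearMap.inverse (mfderiv (𝓡 2) (𝓡 2) P z :
      EuclideanSpace ℝ (Fin 2) →L[ℝ] EuclideanSpace ℝ (Fin 2)) (mfderiv (𝓡 2) (𝓡 2) P z v) = v :=
    fun v => (isInvertible_mfderiv hb).inverse_apply_eq.2 rfl
  have key : ∀ v, ((innerSL ℝ p).comp (ContinuousLinearMap.inverse (mfderiv (𝓡 2) (𝓡 2) P z :
      EuclideanSpace ℝ (Fin 2) →L[ℝ] EuclideanSpace ℝ (Fin 2)))) (mfderiv (𝓡 2) (𝓡 2) P z v) =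
      inner ℝ p v := fun v => congrArg (innerSL ℝ p) (hinv v)
  refine (h _).trans ?_
  congr 1
  · exact (key _).trans (by simp [EuclideanSpace.inner_single_right])
  · exact (key _).trans (by simp [EuclideanSpace.inner_single_right])

theorem contDiff_pullback {F : PhaseFunction 2 S2} (hF : F.Smooth)
    (hP : ContMDiff (𝓡 2) (𝓡 2) ∞ P)
    (hb : ∀ z, Function.Bijective (mfderiv (𝓡 2) (𝓡 2) P z)) :
    ContDiff ℝ ∞ (F.pullback P) := by
  rw [contDiff_iff_contDiffAt]
  rintro ⟨z, p⟩
  let e := chartAt (EuclideanSpace ℝ (Fin 2)) (P z)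
  have he : e ∈ atlas (EuclideanSpace ℝ (Fin 2)) S2 := chart_mem_atlas _ _
  have hz : P z ∈ e.source := mem_chart_source _ _
  have hev : ∀ᶠ w in nhds (z, p), P w.1 ∈ e.source :=
    (hP.continuous.comp continuous_fst).continuousAt.eventually (e.open_source.mem_nhds hz)
  have hψ := contDiffAt_chart_comp he hP hz
  let D : EuclideanSpace ℝ (Fin 2) → EuclideanSpace ℝ (Fin 2) →L[ℝ] EuclideanSpace ℝ (Fin 2) :=
    fderiv ℝ (e ∘ P)
  have hD : ContDiffAt ℝ ∞ D z := hψ.fderiv_right (by simp)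
  have hDb : ∀ w, P w ∈ e.source → Function.Bijective (D w) :=
    fun w hw => bijective_fderiv_chart_comp he hP hw (hb w)
  have hDinv : ∀ w, P w ∈ e.source → (D w).IsInvertible :=
    fun w hw => isInvertible_of_bijective (hDb w hw)
  have hI : ContDiffAt ℝ ∞ (fun w => ContinuousLinearMap.inverse (D w)) z := by
    obtain ⟨Dz, hDz⟩ := hDinv z hz
    have := contDiffAt_map_inverse (n := ∞) Dz
    rw [hDz] at this
    exact this.comp z hD
  -- The chart momentum belonging to a momentum in the parametrization: the inverse transpose of the
  -- derivative of `e ∘ P`. It depends smoothly on the point, so the pullback is a smooth chart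
  -- expression composed with smooth maps.
  let μ : EuclideanSpace ℝ (Fin 2) × EuclideanSpace ℝ (Fin 2) → EuclideanSpace ℝ (Fin 2) :=
    fun w => ∑ i, inner ℝ w.2 (ContinuousLinearMap.inverse (D w.1) (EuclideanSpace.single i 1)) •
      EuclideanSpace.single i 1
  have hμ : ContDiffAt ℝ ∞ μ (z, p) := by
    refine ContDiffAt.sum fun i _ => ContDiffAt.fun_smul ?_ contDiffAt_const
    refine contDiffAt_snd.inner ℝ (ContDiffAt.clm_apply ?_ contDiffAt_const)
    exact hI.comp (z, p) contDiffAt_fst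
  have hμi : ∀ w η, inner ℝ (μ w) η =
      inner ℝ w.2 (ContinuousLinearMap.inverse (D w.1) η) := by
    intro w η
    nth_rewrite 2 [← sum_smul_single η]
    simp only [μ, sum_inner, inner_smul_left, map_sum, map_smul, inner_sum, inner_smul_right]
    simp [EuclideanSpace.inner_single_left, mul_comm]
  have hFe := (hF e he).contDiffAt (x := ((e ∘ P) z, μ (z, p)))
    (by rw [target_eq_univ he]; simp)
  have h1 : ContDiffAt ℝ ∞ (fun w : EuclideanSpace ℝ (Fin 2) × EuclideanSpace ℝ (Fin 2) =>
      ((e ∘ P) w.1, μ w)) (z, p) := (hψ.comp (z, p) contDiffAt_fst).prodMk hμ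
  refine (hFe.comp (z, p) h1).congr_of_eventuallyEq ?_
  filter_upwards [hev] with w hw
  have h2 := inChart_eq_pullback F he hP hw (hb w.1) (μ w)
  simp only [Function.comp_apply] at h2 ⊢
  rw [h2]
  congr 1
  refine Prod.ext rfl (ext_inner_right ℝ fun η => ?_)
  rw [inner_momentumPullback, hμi, (hDinv w.1 hw).inverse_apply_eq.2 rfl]

theorem poissonInChart_eq {F G : PhaseFunction 2 S2} (hF : F.Smooth) (hG : G.Smooth)
    (he : e ∈ atlas (EuclideanSpace ℝ (Fin 2)) S2) (hP : ContMDiff (𝓡 2) (𝓡 2) ∞ P)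
    (hb : ∀ z, Function.Bijective (mfderiv (𝓡 2) (𝓡 2) P z)) {z : EuclideanSpace ℝ (Fin 2)}
    (hz : P z ∈ e.source) (p : EuclideanSpace ℝ (Fin 2)) :
    F.poissonInChart G e ((e ∘ P) z, p) =
      canonicalBracket (F.pullback P) (G.pullback P) (z, momentumPullback (e ∘ P) (z, p)) := by
  have hd : ∀ {F : PhaseFunction 2 S2}, F.Smooth →
      DifferentiableAt ℝ (F.inChart e) ((e ∘ P) z, p) := fun hF =>
    ((hF e he).contDiffAt (by rw [target_eq_univ he]; simp)).differentiableAt (by simp)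
  have hd' : ∀ {F : PhaseFunction 2 S2}, F.Smooth → Differentiable ℝ (F.pullback P) := fun hF =>
    (contDiff_pullback hF hP hb).differentiable (by simp)
  have hev : ∀ᶠ y in nhds z, P y ∈ e.source :=
    hP.continuous.continuousAt.eventually (e.open_source.mem_nhds hz)
  exact canonicalBracket_pullback (contDiffAt_infty.1 (contDiffAt_chart_comp he hP hz) 2)
    (hd hF) (hd hG) (hd' hF _) (hd' hG _)
    (hev.mono fun y hy p => inChart_eq_pullback F he hP hy (hb y) p)
    (hev.mono fun y hy p => inChart_eq_pullback G he hP hy (hb y) p)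

theorem canonicalBracket_pullback_eq_zero {F G : PhaseFunction 2 S2} (hF : F.Smooth)
    (hG : G.Smooth) (hP : ContMDiff (𝓡 2) (𝓡 2) ∞ P)
    (hb : ∀ z, Function.Bijective (mfderiv (𝓡 2) (𝓡 2) P z)) (h : F.PoissonCommute G)
    (z : EuclideanSpace ℝ (Fin 2) × EuclideanSpace ℝ (Fin 2)) :
    canonicalBracket (F.pullback P) (G.pullback P) z = 0 := by
  obtain ⟨z, p⟩ := z
  let e := chartAt (EuclideanSpace ℝ (Fin 2)) (P z)
  have he : e ∈ atlas (EuclideanSpace ℝ (Fin 2)) S2 := chart_mem_atlas _ _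
  have hz : P z ∈ e.source := mem_chart_source _ _
  have hDb := bijective_fderiv_chart_comp he hP hz (hb z)
  let D := LinearEquiv.ofBijective (fderiv ℝ (e ∘ P) z).toLinearMap hDb
  -- The chart momentum whose transform under `(e ∘ P)'ᵀ` is the given `p`.
  let q := LinearMap.adjoint (D.symm : EuclideanSpace ℝ (Fin 2) →ₗ[ℝ] EuclideanSpace ℝ (Fin 2)) p
  have hq : momentumPullback (e ∘ P) (z, q) = p := by
    refine ext_inner_right ℝ fun η => ?_
    rw [inner_momentumPullback, LinearMap.adjoint_inner_left]
    exact congrArg _ (D.symm_apply_apply η)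
  have := poissonInChart_eq hF hG he hP hb hz q
  rw [hq] at this
  rw [← this]
  exact h e he _ (by rw [target_eq_univ he]; simp)

theorem contDiff_inChart {F : PhaseFunction 2 S2} (hF : F.Smooth)
    (he : e ∈ atlas (EuclideanSpace ℝ (Fin 2)) S2) : ContDiff ℝ ∞ (F.inChart e) := by
  have := hF e he
  rwa [target_eq_univ he, Set.univ_prod_univ, contDiffOn_univ] at this

/-- In each chart the bracket is continuous, and it vanishes over the dense set of points covered by
`P`. -/
theorem poissonCommute_of_pullback {F G : PhaseFunction 2 S2} (hF : F.Smooth) (hG : G.Smooth)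
    (hP : ContMDiff (𝓡 2) (𝓡 2) ∞ P)
    (hb : ∀ z, Function.Bijective (mfderiv (𝓡 2) (𝓡 2) P z))
    (hd : ∀ e ∈ atlas (EuclideanSpace ℝ (Fin 2)) S2, Dense (e.symm ⁻¹' Set.range P))
    (h : ∀ z, canonicalBracket (F.pullback P) (G.pullback P) z = 0) : F.PoissonCommute G := by
  intro e he
  have hc : Continuous (F.poissonInChart G e) := by
    have h1 := (contDiff_inChart hF he).continuous_fderiv (by simp)
    have h2 := (contDiff_inChart hG he).continuous_fderiv (by simp)
    unfold PhaseFunction.poissonInChart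
    fun_prop
  have hD : Dense ((e.symm ⁻¹' Set.range P) ×ˢ
      (Set.univ : Set (EuclideanSpace ℝ (Fin 2)))) := (hd e he).prod dense_univ
  have h0 : F.poissonInChart G e = fun _ => 0 := by
    refine Continuous.ext_on hD hc continuous_const ?_
    rintro ⟨q, p⟩ ⟨⟨z, hz⟩, -⟩
    have hq : q ∈ e.target := by rw [target_eq_univ he]; trivial
    have hz' : P z ∈ e.source := by rw [hz]; exact e.map_target hq
    have hqz : q = (e ∘ P) z := by rw [Function.comp_apply, hz, e.right_inv hq]
    rw [hqz, poissonInChart_eq hF hG he hP hb hz' p, h]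
  intro z _
  rw [h0]

end Parametrization

end S2

end

noncomputable section

/-! ## The Hamiltonian and the quartic integral in the coordinates `(φ, u)` -/

/-- The coordinates of the plane as a pair. -/
def planePair : EuclideanSpace ℝ (Fin 2) →L[ℝ] ℝ × ℝ :=
  (EuclideanSpace.proj 0 : EuclideanSpace ℝ (Fin 2) →L[ℝ] ℝ).prod (EuclideanSpace.proj 1)

theorem planePair_apply (z : EuclideanSpace ℝ (Fin 2)) : planePair z = (z 0, z 1) := rfl

theorem planePair_bijective : Function.Bijective planePair := by
  refine ⟨fun v w h => ?_, fun w => ⟨!₂[w.1, w.2], rfl⟩⟩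
  ext i
  fin_cases i
  · exact congrArg Prod.fst h
  · exact congrArg Prod.snd h

/-- The parametrization `polarParam`, with the Euclidean plane as its domain. -/
def polarMap (a : ℝ) (z : EuclideanSpace ℝ (Fin 2)) : S2 := polarParam a (planePair z)

section PolarMap

variable {a : ℝ}

theorem contMDiff_polarMap (ha : -2 < a) : ContMDiff (𝓡 2) (𝓡 2) ∞ (polarMap a) :=
  (contMDiff_polarParam ha).comp planePair.contDiff.contMDiff

theorem mfderiv_polarMap (ha : -2 < a) (z v : EuclideanSpace ℝ (Fin 2)) :
    mfderiv (𝓡 2) (𝓡 2) (polarMap a) z v =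
      mfderiv 𝓘(ℝ, ℝ × ℝ) (𝓡 2) (polarParam a) (planePair z) (planePair v) := by
  have h := mfderiv_comp z ((contMDiff_polarParam ha (planePair z)).mdifferentiableAt (by simp))
    (planePair.contDiff.contMDiff.mdifferentiableAt (n := 1) (by simp) (x := z))
  have h2 : mfderiv (𝓡 2) 𝓘(ℝ, ℝ × ℝ) planePair z = planePair :=
    planePair.hasMFDerivAt.mfderiv
  rw [h2] at h
  exact congrArg (fun L : EuclideanSpace ℝ (Fin 2) →L[ℝ] EuclideanSpace ℝ (Fin 2) => L v) h

theorem bijective_mfderiv_polarMap (ha : -2 < a) (z : EuclideanSpace ℝ (Fin 2)) :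
    Function.Bijective (mfderiv (𝓡 2) (𝓡 2) (polarMap a) z) := by
  have h : ⇑(mfderiv (𝓡 2) (𝓡 2) (polarMap a) z) =
      (mfderiv 𝓘(ℝ, ℝ × ℝ) (𝓡 2) (polarParam a) (planePair z)) ∘ planePair :=
    funext fun v => mfderiv_polarMap ha z v
  rw [h]
  exact (bijective_mfderiv_polarParam ha _).comp planePair_bijective

theorem range_polarMap (a : ℝ) : Set.range (polarMap a) = Set.range (polarParam a) :=
  planePair_bijective.2.range_comp (polarParam a)

theorem dense_chart_preimage_range_polarMap (ha : -2 < a)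
    (e : OpenPartialHomeomorph S2 (EuclideanSpace ℝ (Fin 2)))
    (he : e ∈ atlas (EuclideanSpace ℝ (Fin 2)) S2) :
    Dense (e.symm ⁻¹' Set.range (polarMap a)) := by
  rw [range_polarMap]
  exact dense_chart_preimage_range_polarParam ha he

end PolarMap

theorem SmoothMetric.kinetic_inner {n : ℕ} {M : Type*} [TopologicalSpace M]
    [ChartedSpace (EuclideanSpace ℝ (Fin n)) M] [IsManifold (𝓡 n) ∞ M] (g : SmoothMetric n M)
    (x : M) (w : TangentSpace (𝓡 n) x) :
    SmoothMetric.kinetic g x (g.inner x w) = 1 / 2 * g.inner x w w := by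
  have h : (SmoothMetric.flat g x).symm (g.inner x w) = w :=
    (SmoothMetric.flat g x).symm_apply_apply w
  unfold SmoothMetric.kinetic
  rw [h]

/-- The Hamiltonian in the canonical coordinates of `(φ, u)`. -/
def polarHamiltonian (a : ℝ) (w : EuclideanSpace ℝ (Fin 2) × EuclideanSpace ℝ (Fin 2)) : ℝ :=
  1 / 2 * (√(quarticA (w.1 1) a 1) * w.2 0 ^ 2 + √(quarticA (w.1 1) a 1) ^ 2 * w.2 1 ^ 2) +
    potentialAmp a (w.1 1) * Real.cos (w.1 0)

theorem ExtendsH1.metric_polarMap {a : ℝ} (ha : -2 < a) {S : ConservativeSystem 2 S2}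
    (h : ExtendsH1 a S) (z v w : EuclideanSpace ℝ (Fin 2)) :
    S.metric.inner (polarMap a z) (mfderiv (𝓡 2) (𝓡 2) (polarMap a) z v)
      (mfderiv (𝓡 2) (𝓡 2) (polarMap a) z w) =
      (√(quarticA (z 1) a 1))⁻¹ * (v 0 * w 0 + (√(quarticA (z 1) a 1))⁻¹ * (v 1 * w 1)) := by
  rw [mfderiv_polarMap ha, mfderiv_polarMap ha]
  exact h.metric_eq (planePair z) (planePair v) (planePair w)

/-- Every covector has the form `g(w, ·)`, and its kinetic energy is `g(w, w) / 2`. This inverts the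
metric without computing an inverse matrix. -/
theorem ExtendsH1.pullback_hamiltonian {a : ℝ} (ha : -2 < a) {S : ConservativeSystem 2 S2}
    (h : ExtendsH1 a S) : S.hamiltonian.pullback (polarMap a) = polarHamiltonian a := by
  funext ⟨z, p⟩
  refine S2.pullback_eq_of_forall (bijective_mfderiv_polarMap ha z)
    (Φ := fun s t => polarHamiltonian a (z, !₂[s, t])) ?_ p
  intro p
  obtain ⟨w', hw'⟩ := (SmoothMetric.flat S.metric (polarMap a z)).surjective p
  obtain ⟨w, rfl⟩ : ∃ w : EuclideanSpace ℝ (Fin 2),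
      mfderiv (𝓡 2) (𝓡 2) (polarMap a) z w = w' := (bijective_mfderiv_polarMap ha z).2 w'
  have hp : S.metric.inner (polarMap a z) (mfderiv (𝓡 2) (𝓡 2) (polarMap a) z w) = p := hw'
  have hB : √(quarticA (z 1) a 1) ≠ 0 := (Real.sqrt_pos.2 (quarticA_pos ha (z 1))).ne'
  have hU := h.potential_eq (planePair z)
  rw [← hp]
  unfold ConservativeSystem.hamiltonian
  rw [SmoothMetric.kinetic_inner]
  refine (congrArg₂ (fun s t => 1 / 2 * s + t) (h.metric_polarMap ha z w w) hU).trans ?_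
  refine Eq.trans ?_ (congrArg₂ (fun s t => polarHamiltonian a (z, !₂[s, t]))
    (h.metric_polarMap ha z w (EuclideanSpace.single 0 1))
    (h.metric_polarMap ha z w (EuclideanSpace.single 1 1))).symm
  simp only [polarHamiltonian, potentialAmp, planePair_apply]
  simp
  field_simp

/-! ### Covectors as ambient vectors; the quartic integral on the sphere. -/

namespace S2

/-- The ambient vector dual to a covector with respect to the round metric. -/
def velocity (x : S2) (p : TangentSpace (𝓡 2) x →L[ℝ] ℝ) : EuclideanSpace ℝ (Fin 3) :=
  dcoe x ((SmoothMetric.flat (conformalMetric (fun _ => 1) contMDiff_const fun _ => one_pos)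
    x).symm p)

theorem velocity_eq {x : S2} {p : TangentSpace (𝓡 2) x →L[ℝ] ℝ} {w : TangentSpace (𝓡 2) x}
    (h : ∀ v, inner ℝ (dcoe x w) (dcoe x v) = p v) : velocity x p = dcoe x w := by
  have : (SmoothMetric.flat (conformalMetric (fun _ => 1) contMDiff_const fun _ => one_pos) x) w =
      p := by
    ext v
    refine Eq.trans ?_ (h v)
    exact (conformalMetric_inner (fun _ => 1) contMDiff_const (fun _ => one_pos) x w v).trans
      (one_mul _)
  rw [velocity, ← this, LinearEquiv.symm_apply_apply]

section Charts

variable {e : OpenPartialHomeomorph S2 (EuclideanSpace ℝ (Fin 2))}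

theorem exists_mfderiv_symm_eq (he : e ∈ atlas (EuclideanSpace ℝ (Fin 2)) S2)
    (q : EuclideanSpace ℝ (Fin 2)) (v : TangentSpace (𝓡 2) (e.symm q)) :
    ∃ η : EuclideanSpace ℝ (Fin 2), mfderiv (𝓡 2) (𝓡 2) e.symm q η = v :=
  ⟨mfderiv (𝓡 2) (𝓡 2) e (e.symm q) v, mfderiv_symm_chart he q v⟩

/-- In a stereographic chart the round metric is `16 / (‖q‖² + 4)²` times the Euclidean one, so
raising the index divides by this factor. -/
theorem velocity_inChart (he : e ∈ atlas (EuclideanSpace ℝ (Fin 2)) S2)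
    (q p : EuclideanSpace ℝ (Fin 2)) :
    velocity (e.symm q) ((innerSL ℝ p).comp (mfderiv (𝓡 2) (𝓡 2) e (e.symm q))) =
      ((‖q‖ ^ 2 + 4) ^ 2 / 16) • fderiv ℝ (chartInv e) q p := by
  have hsmul : ((‖q‖ ^ 2 + 4) ^ 2 / 16) • fderiv ℝ (chartInv e) q p =
      dcoe (e.symm q) (mfderiv (𝓡 2) (𝓡 2) e.symm q
        (((‖q‖ ^ 2 + 4) ^ 2 / 16) • p : EuclideanSpace ℝ (Fin 2))) := by
    rw [dcoe_mfderiv_symm he, map_smul]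
  rw [hsmul]
  refine velocity_eq fun v => ?_
  obtain ⟨η, rfl⟩ := exists_mfderiv_symm_eq he q v
  refine (congrArg₂ (inner ℝ) (dcoe_mfderiv_symm he q _) (dcoe_mfderiv_symm he q _)).trans ?_
  rw [inner_fderiv_chartInv he, inner_smul_left]
  refine Eq.trans ?_ (congrArg (inner ℝ p) (mfderiv_chart_symm he q η).symm)
  simp only [conj_trivial]
  field_simp

theorem conformalMetric_kinetic_inChart {f : S2 → ℝ} (hf : ContMDiff (𝓡 2) 𝓘(ℝ, ℝ) ∞ f)
    (hpos : ∀ x, 0 < f x) (he : e ∈ atlas (EuclideanSpace ℝ (Fin 2)) S2)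
    (q p : EuclideanSpace ℝ (Fin 2)) :
    (SmoothMetric.kinetic (conformalMetric f hf hpos)).inChart e (q, p) =
      1 / 2 * ((f (e.symm q))⁻¹ * ((‖q‖ ^ 2 + 4) ^ 2 / 16 * ‖p‖ ^ 2)) := by
  have hf0 := (hpos (e.symm q)).ne'
  let w : TangentSpace (𝓡 2) (e.symm q) := mfderiv (𝓡 2) (𝓡 2) e.symm q
    (((f (e.symm q))⁻¹ * ((‖q‖ ^ 2 + 4) ^ 2 / 16)) • p : EuclideanSpace ℝ (Fin 2))
  have key : ∀ v, (conformalMetric f hf hpos).inner (e.symm q) w v =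
      inner ℝ p (mfderiv (𝓡 2) (𝓡 2) e (e.symm q) v) := by
    intro v
    obtain ⟨η, rfl⟩ := exists_mfderiv_symm_eq he q v
    rw [conformalMetric_inner]
    refine (congrArg (f (e.symm q) * ·) (congrArg₂ (inner ℝ) (dcoe_mfderiv_symm he q _)
      (dcoe_mfderiv_symm he q _))).trans ?_
    refine Eq.trans ?_ (congrArg (inner ℝ p) (mfderiv_chart_symm he q η).symm)
    beta_reduce
    rw [inner_fderiv_chartInv he, inner_smul_left]
    simp only [conj_trivial]
    field_simp
  have hp : (innerSL ℝ p).comp (mfderiv (𝓡 2) (𝓡 2) e (e.symm q)) =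
      (conformalMetric f hf hpos).inner (e.symm q) w := ContinuousLinearMap.ext fun v =>
    (key v).symm
  unfold PhaseFunction.inChart
  refine (congrArg (SmoothMetric.kinetic (conformalMetric f hf hpos) (e.symm q)) hp).trans ?_
  rw [SmoothMetric.kinetic_inner, key]
  refine (congrArg (1 / 2 * inner ℝ p ·) (mfderiv_chart_symm he q _)).trans ?_
  rw [inner_smul_right, real_inner_self_eq_norm_sq]
  ring

theorem contDiff_comp_chart_symm {f : S2 → ℝ} (hf : ContMDiff (𝓡 2) 𝓘(ℝ, ℝ) ∞ f)
    (he : e ∈ atlas (EuclideanSpace ℝ (Fin 2)) S2) : ContDiff ℝ ∞ (fun q => f (e.symm q)) := by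
  have h := contMDiffOn_symm_of_mem_maximalAtlas
    (IsManifold.subset_maximalAtlas (I := 𝓡 2) (n := ∞) he)
  rw [target_eq_univ he, contMDiffOn_univ] at h
  exact (hf.comp h).contDiff

end Charts

theorem smooth_hamiltonian {S : ConservativeSystem 2 S2} {f : S2 → ℝ}
    (hf : ContMDiff (𝓡 2) 𝓘(ℝ, ℝ) ∞ f) (hpos : ∀ x, 0 < f x)
    (hS : S.metric = conformalMetric f hf hpos) : S.hamiltonian.Smooth := by
  intro e he
  refine ContDiff.contDiffOn ?_
  have h : S.hamiltonian.inChart e = fun z => 1 / 2 * ((f (e.symm z.1))⁻¹ *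
      ((‖z.1‖ ^ 2 + 4) ^ 2 / 16 * ‖z.2‖ ^ 2)) + S.potential (e.symm z.1) := by
    funext z
    refine Eq.trans ?_ (congrArg (· + _) (conformalMetric_kinetic_inChart hf hpos he z.1 z.2))
    rw [← hS]
    rfl
  rw [h]
  have h1 := ((contDiff_comp_chart_symm hf he).inv fun q => (hpos _).ne').comp
    (contDiff_fst (E := EuclideanSpace ℝ (Fin 2)) (F := EuclideanSpace ℝ (Fin 2)) (n := ∞))
  have h2 := (contDiff_comp_chart_symm S.potential_smooth he).comp
    (contDiff_fst (E := EuclideanSpace ℝ (Fin 2)) (F := EuclideanSpace ℝ (Fin 2)) (n := ∞))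
  have h3 : ContDiff ℝ ∞ fun z : EuclideanSpace ℝ (Fin 2) × EuclideanSpace ℝ (Fin 2) =>
      (‖z.1‖ ^ 2 + 4) ^ 2 / 16 * ‖z.2‖ ^ 2 :=
    (((((contDiff_norm_sq ℝ).comp contDiff_fst).add contDiff_const).pow 2).div_const _).mul
      ((contDiff_norm_sq ℝ).comp contDiff_snd)
  exact (contDiff_const.mul (h1.mul h3)).add h2

/-- The integral of fourth degree in momenta: with the moments `M = x × v`,
it is `M₃⁴ + 4 M₃ (α M₁ + β x₁ M₃) + γ x₂²`. -/
def quarticIntegral (α β γ : S2 → ℝ) : PhaseFunction 2 S2 := fun x p =>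
  (x.1 0 * velocity x p 1 - x.1 1 * velocity x p 0) ^ 4 +
    4 * (x.1 0 * velocity x p 1 - x.1 1 * velocity x p 0) *
      (α x * (x.1 1 * velocity x p 2 - x.1 2 * velocity x p 1) +
        β x * x.1 0 * (x.1 0 * velocity x p 1 - x.1 1 * velocity x p 0)) +
    γ x * x.1 1 ^ 2

section QuarticIntegral

variable {α β γ : S2 → ℝ}

theorem quarticIntegral_inChart {e : OpenPartialHomeomorph S2 (EuclideanSpace ℝ (Fin 2))}
    (he : e ∈ atlas (EuclideanSpace ℝ (Fin 2)) S2) (q p : EuclideanSpace ℝ (Fin 2)) :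
    ∃ x v : EuclideanSpace ℝ (Fin 3), x = chartInv e q ∧
      v = ((‖q‖ ^ 2 + 4) ^ 2 / 16) • fderiv ℝ (chartInv e) q p ∧
      (quarticIntegral α β γ).inChart e (q, p) =
      (x 0 * v 1 - x 1 * v 0) ^ 4 + 4 * (x 0 * v 1 - x 1 * v 0) *
      (α (e.symm q) * (x 1 * v 2 - x 2 * v 1) +
        β (e.symm q) * x 0 * (x 0 * v 1 - x 1 * v 0)) + γ (e.symm q) * x 1 ^ 2 := by
  refine ⟨_, _, rfl, rfl, ?_⟩
  unfold PhaseFunction.inChart quarticIntegral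
  rw [velocity_inChart he]
  rfl

theorem smooth_quarticIntegral (hα : ContMDiff (𝓡 2) 𝓘(ℝ, ℝ) ∞ α)
    (hβ : ContMDiff (𝓡 2) 𝓘(ℝ, ℝ) ∞ β) (hγ : ContMDiff (𝓡 2) 𝓘(ℝ, ℝ) ∞ γ) :
    (quarticIntegral α β γ).Smooth := by
  intro e he
  refine ContDiff.contDiffOn ?_
  let x : EuclideanSpace ℝ (Fin 2) × EuclideanSpace ℝ (Fin 2) → EuclideanSpace ℝ (Fin 3) :=
    fun z => chartInv e z.1
  let v : EuclideanSpace ℝ (Fin 2) × EuclideanSpace ℝ (Fin 2) → EuclideanSpace ℝ (Fin 3) :=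
    fun z => ((‖z.1‖ ^ 2 + 4) ^ 2 / 16) • fderiv ℝ (chartInv e) z.1 z.2
  have hx : ContDiff ℝ ∞ x := (contDiff_chartInv he).comp contDiff_fst
  have hv : ContDiff ℝ ∞ v := by
    refine ContDiff.smul ((((contDiff_norm_sq ℝ).comp contDiff_fst).add contDiff_const).pow
      2 |>.div_const _) ?_
    exact (((contDiff_chartInv he).fderiv_right (m := ∞) (by simp)).comp contDiff_fst).clm_apply
      contDiff_snd
  have hxi : ∀ i, ContDiff ℝ ∞ fun z => x z i := contDiff_euclidean.1 hx
  have hvi : ∀ i, ContDiff ℝ ∞ fun z => v z i := contDiff_euclidean.1 hv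
  have hc : ∀ {c : S2 → ℝ}, ContMDiff (𝓡 2) 𝓘(ℝ, ℝ) ∞ c →
      ContDiff ℝ ∞ fun z : EuclideanSpace ℝ (Fin 2) × EuclideanSpace ℝ (Fin 2) =>
        c (e.symm z.1) := fun hc => (contDiff_comp_chart_symm hc he).comp contDiff_fst
  have h2 := ((hxi 0).mul (hvi 1)).sub ((hxi 1).mul (hvi 0))
  have h0 := ((hxi 1).mul (hvi 2)).sub ((hxi 2).mul (hvi 1))
  have h := ((h2.pow 4).add ((contDiff_const (c := (4 : ℝ)).mul h2).mul
    (((hc hα).mul h0).add (((hc hβ).mul (hxi 0)).mul h2)))).add ((hc hγ).mul ((hxi 1).pow 2))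
  convert! h using 1
  funext z
  obtain ⟨x', v', rfl, rfl, h'⟩ := quarticIntegral_inChart (α := α) (β := β) (γ := γ) he z.1 z.2
  exact h'

theorem polynomialInMomenta_quarticIntegral :
    (quarticIntegral α β γ).PolynomialInMomenta 4 := by
  intro e he q _
  let c : Fin 2 → EuclideanSpace ℝ (Fin 3) := fun i =>
    ((‖q‖ ^ 2 + 4) ^ 2 / 16) • fderiv ℝ (chartInv e) q (EuclideanSpace.single i 1)
  let V : Fin 3 → MvPolynomial (Fin 2) ℝ := fun j =>
    ∑ i, MvPolynomial.C (c i j) * MvPolynomial.X i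
  let M : Fin 3 → Fin 3 → MvPolynomial (Fin 2) ℝ := fun j k =>
    MvPolynomial.C (chartInv e q j) * V k - MvPolynomial.C (chartInv e q k) * V j
  have hC : ∀ (r : ℝ) {n : ℕ} {P : MvPolynomial (Fin 2) ℝ}, P.totalDegree ≤ n →
      (MvPolynomial.C r * P).totalDegree ≤ n := fun r n P h => by
    refine (MvPolynomial.totalDegree_mul _ _).trans ?_
    simpa using h
  have hadd : ∀ {n : ℕ} {P Q : MvPolynomial (Fin 2) ℝ}, P.totalDegree ≤ n →
      Q.totalDegree ≤ n → (P + Q).totalDegree ≤ n := fun h h' =>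
    (MvPolynomial.totalDegree_add _ _).trans (max_le h h')
  have hV : ∀ j, (V j).totalDegree ≤ 1 := fun j => by
    simp only [V, Fin.sum_univ_two]
    exact hadd (hC _ (by simp)) (hC _ (by simp))
  have hM : ∀ j k, (M j k).totalDegree ≤ 1 := fun j k =>
    (MvPolynomial.totalDegree_sub _ _).trans (max_le (hC _ (hV k)) (hC _ (hV j)))
  refine ⟨M 0 1 ^ 4 + MvPolynomial.C 4 * (M 0 1 * (MvPolynomial.C (α (e.symm q)) * M 1 2 +
    MvPolynomial.C (β (e.symm q) * chartInv e q 0) * M 0 1)) +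
    MvPolynomial.C (γ (e.symm q) * chartInv e q 1 ^ 2), ?_, fun p => ?_⟩
  · refine hadd (hadd ((MvPolynomial.totalDegree_pow _ _).trans ?_) (hC _ ?_)) (by
      rw [MvPolynomial.totalDegree_C]; omega)
    · linarith [hM 0 1]
    · refine (MvPolynomial.totalDegree_mul _ _).trans ?_
      have := hadd (hC (α (e.symm q)) (hM 1 2)) (hC (β (e.symm q) * chartInv e q 0) (hM 0 1))
      linarith [hM 0 1]
  · obtain ⟨x, v, rfl, rfl, h⟩ := quarticIntegral_inChart (α := α) (β := β) (γ := γ) he q p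
    have hv : ∀ j, (((‖q‖ ^ 2 + 4) ^ 2 / 16) • fderiv ℝ (chartInv e) q p) j =
        MvPolynomial.eval (fun i => p i) (V j) := by
      intro j
      nth_rewrite 1 [← sum_smul_single p]
      simp [V, c, Fin.sum_univ_two]
      ring
    rw [h, hv, hv, hv]
    simp [M]
    ring

end QuarticIntegral

end S2

end

noncomputable section

/-! ## The integral of fourth degree -/

/-- The quartic integral in the canonical coordinates of `(φ, u)`. -/
def polarQuartic (a : ℝ) (w : EuclideanSpace ℝ (Fin 2) × EuclideanSpace ℝ (Fin 2)) : ℝ :=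
  w.2 0 ^ 4 + 4 * w.2 0 * (w.1 1 * Real.cos (w.1 0) * w.2 0 -
    √(quarticA (w.1 1) a 1) * Real.sin (w.1 0) * w.2 1) +
    (a + 2 * w.1 1 ^ 2 - 2 * √(quarticA (w.1 1) a 1)) * Real.sin (w.1 0) ^ 2

section Quartic

variable {a : ℝ}

theorem velocity_polarMap (ha : -2 < a) (z : EuclideanSpace ℝ (Fin 2))
    (p : TangentSpace (𝓡 2) (polarMap a z) →L[ℝ] ℝ) :
    S2.velocity (polarMap a z) p = fderiv ℝ (fun z => (polarParam a z).1) (planePair z)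
      (Real.cosh (conformalY a (z 1)) ^ 2 *
          p (mfderiv (𝓡 2) (𝓡 2) (polarMap a) z
            (EuclideanSpace.single 0 1 : EuclideanSpace ℝ (Fin 2))),
        Real.cosh (conformalY a (z 1)) ^ 2 * (√(quarticA (z 1) a 1) *
          p (mfderiv (𝓡 2) (𝓡 2) (polarMap a) z
            (EuclideanSpace.single 1 1 : EuclideanSpace ℝ (Fin 2))))) := by
  have hB : √(quarticA (z 1) a 1) ≠ 0 := (Real.sqrt_pos.2 (quarticA_pos ha (z 1))).ne'
  have hC := (Real.cosh_pos (conformalY a (z 1))).ne'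
  rw [← dcoe_mfderiv_polarParam ha]
  refine S2.velocity_eq fun v => ?_
  obtain ⟨η, rfl⟩ : ∃ η : EuclideanSpace ℝ (Fin 2), mfderiv (𝓡 2) (𝓡 2) (polarMap a) z η = v :=
    (bijective_mfderiv_polarMap ha z).2 v
  let D : EuclideanSpace ℝ (Fin 2) →L[ℝ] EuclideanSpace ℝ (Fin 2) :=
    mfderiv (𝓡 2) (𝓡 2) (polarMap a) z
  have hη : p (D η) = η 0 * p (D (EuclideanSpace.single 0 1)) +
      η 1 * p (D (EuclideanSpace.single 1 1)) := by
    have h : D η = η 0 • D (EuclideanSpace.single 0 1) + η 1 • D (EuclideanSpace.single 1 1) := by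
      rw [← map_smul, ← map_smul, ← map_add, ← Fin.sum_univ_two
        (f := fun i => η i • (EuclideanSpace.single i 1 : EuclideanSpace ℝ (Fin 2))),
        sum_smul_single]
    refine (congrArg p h).trans ?_
    exact (map_add p _ _).trans (congrArg₂ (· + ·) (map_smul p _ _) (map_smul p _ _))
  refine Eq.trans ?_ hη.symm
  refine (congrArg₂ (inner ℝ) (dcoe_mfderiv_polarParam ha (planePair z) _)
    ((congrArg (S2.dcoe (polarMap a z)) (mfderiv_polarMap ha z η)).trans
      (dcoe_mfderiv_polarParam ha (planePair z) (planePair η)))).trans ?_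
  rw [inner_fderiv_polarParam ha]
  simp only [planePair_apply]
  change (Real.cosh (conformalY a (z 1)) ^ 2)⁻¹ * (Real.cosh (conformalY a (z 1)) ^ 2 *
    p (D (EuclideanSpace.single 0 1)) * η 0 + (√(quarticA (z 1) a 1))⁻¹ *
    (Real.cosh (conformalY a (z 1)) ^ 2 * (√(quarticA (z 1) a 1) *
      p (D (EuclideanSpace.single 1 1))) * η 1)) = _
  field_simp

/-- In polar coordinates `M₃ = p_φ` and `M₁ = cosh y sin φ A^(1/4) p_u - sinh y cos φ p_φ`. The
functions `α` and `β` are the ones for which `α M₁ + β x₁ M₃ = u cos φ p_φ - √A sin φ p_u`, and `γ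
x₂²` gives the term with `sin² φ`. -/
theorem pullback_quarticIntegral (ha : -2 < a) {α β γ : S2 → ℝ}
    (hα : ∀ z, α (polarParam a z) = - quarticRoot a z.2 / Real.cosh (conformalY a z.2))
    (hβ : ∀ z, β (polarParam a z) = Real.cosh (conformalY a z.2) *
        (z.2 - Real.tanh (conformalY a z.2) * quarticRoot a z.2))
    (hγ : ∀ z, γ (polarParam a z) = (a + 2 * z.2 ^ 2 - 2 * √(quarticA z.2 a 1)) *
        Real.cosh (conformalY a z.2) ^ 2) :
    (S2.quarticIntegral α β γ).pullback (polarMap a) = polarQuartic a := by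
  funext ⟨z, p⟩
  refine S2.pullback_eq_of_forall (bijective_mfderiv_polarMap ha z)
    (Φ := fun s t => polarQuartic a (z, !₂[s, t])) ?_ p
  intro p
  unfold S2.quarticIntegral
  rw [velocity_polarMap ha, fderiv_polarParam ha]
  generalize p (mfderiv (𝓡 2) (𝓡 2) (polarMap a) z
    (EuclideanSpace.single 0 1 : EuclideanSpace ℝ (Fin 2))) = s
  generalize p (mfderiv (𝓡 2) (𝓡 2) (polarMap a) z
    (EuclideanSpace.single 1 1 : EuclideanSpace ℝ (Fin 2))) = t
  unfold polarMap
  rw [hα, hβ, hγ]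
  simp only [polarParam_coord, planePair_apply, polarQuartic, ← quarticRoot_sq ha]
  have hr := (quarticRoot_pos ha (z 1)).ne'
  have hC := (Real.cosh_pos (conformalY a (z 1))).ne'
  have h1 := Real.cosh_sq (conformalY a (z 1))
  have h2 := Real.sin_sq_add_cos_sq (z 0)
  rw [Real.tanh_eq_sinh_div_cosh]
  generalize Real.cosh (conformalY a (z 1)) = C at *
  generalize Real.sinh (conformalY a (z 1)) = T at *
  generalize Real.sin (z 0) = σ at *
  generalize Real.cos (z 0) = c at *
  generalize quarticRoot a (z 1) = r at *
  have hM : c / C * (C⁻¹ * (c * (C ^ 2 * s) - σ * (T / C) * (r⁻¹ * (C ^ 2 * (r ^ 2 * t))))) -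
      σ / C * (C⁻¹ * (-(σ * (C ^ 2 * s)) - c * (T / C) * (r⁻¹ * (C ^ 2 * (r ^ 2 * t))))) = s := by
    field_simp
    linear_combination C * s * h2
  have hN : σ / C * (C⁻¹ * (C⁻¹ * (r⁻¹ * (C ^ 2 * (r ^ 2 * t))))) -
      T / C * (C⁻¹ * (c * (C ^ 2 * s) - σ * (T / C) * (r⁻¹ * (C ^ 2 * (r ^ 2 * t))))) =
      C * (σ * r * t) - T * c * s := by
    field_simp
    linear_combination -r * σ * t * h1
  simp
  rw [hM, hN]
  field_simp
  ring

theorem hasDerivAt_sqrt_quarticA (ha : -2 < a) (u : ℝ) :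
    HasDerivAt (fun u => √(quarticA u a 1)) ((a * u + 2 * u ^ 3) / √(quarticA u a 1)) u := by
  have hA : HasDerivAt (fun u => quarticA u a 1) (2 * a * u + 4 * u ^ 3) u := by
    unfold quarticA
    have := (((hasDerivAt_pow 2 u).const_mul a).const_add 1).add (hasDerivAt_pow 4 u)
    convert! this using 1
    push_cast
    ring
  convert! hA.sqrt (quarticA_pos ha u).ne' using 1
  field_simp
  ring

theorem hasDerivAt_potentialAmp (ha : -2 < a) (u : ℝ) :
    HasDerivAt (potentialAmp a)
      (√(quarticA u a 1) + u * (a * u + 2 * u ^ 3) / √(quarticA u a 1) -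
        (a + 6 * u ^ 2) / 2) u := by
  have h := (((hasDerivAt_id u).div_const 2).neg).mul
    ((((hasDerivAt_pow 2 u).const_mul 2).const_add a).sub
      ((hasDerivAt_sqrt_quarticA ha u).const_mul 2))
  convert! h using 1
  simp
  ring

theorem hasFDerivAt_coord (i : Fin 2)
    (w : EuclideanSpace ℝ (Fin 2) × EuclideanSpace ℝ (Fin 2)) :
    HasFDerivAt (fun w : EuclideanSpace ℝ (Fin 2) × EuclideanSpace ℝ (Fin 2) => w.1 i)
      ((EuclideanSpace.proj i : EuclideanSpace ℝ (Fin 2) →L[ℝ] ℝ).comp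
        (ContinuousLinearMap.fst ℝ _ _)) w :=
  ((EuclideanSpace.proj (𝕜 := ℝ) i : EuclideanSpace ℝ (Fin 2) →L[ℝ] ℝ).comp
    (ContinuousLinearMap.fst ℝ (EuclideanSpace ℝ (Fin 2))
      (EuclideanSpace ℝ (Fin 2)))).hasFDerivAt (x := w)

theorem hasFDerivAt_momentum (i : Fin 2)
    (w : EuclideanSpace ℝ (Fin 2) × EuclideanSpace ℝ (Fin 2)) :
    HasFDerivAt (fun w : EuclideanSpace ℝ (Fin 2) × EuclideanSpace ℝ (Fin 2) => w.2 i)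
      ((EuclideanSpace.proj i : EuclideanSpace ℝ (Fin 2) →L[ℝ] ℝ).comp
        (ContinuousLinearMap.snd ℝ _ _)) w :=
  ((EuclideanSpace.proj (𝕜 := ℝ) i : EuclideanSpace ℝ (Fin 2) →L[ℝ] ℝ).comp
    (ContinuousLinearMap.snd ℝ (EuclideanSpace ℝ (Fin 2))
      (EuclideanSpace ℝ (Fin 2)))).hasFDerivAt (x := w)

theorem fderiv_polarHamiltonian (ha : -2 < a)
    (w v : EuclideanSpace ℝ (Fin 2) × EuclideanSpace ℝ (Fin 2)) :
    fderiv ℝ (polarHamiltonian a) w v =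
      -potentialAmp a (w.1 1) * Real.sin (w.1 0) * v.1 0 +
      (1 / 2 * ((a * w.1 1 + 2 * w.1 1 ^ 3) / √(quarticA (w.1 1) a 1)) * w.2 0 ^ 2 +
        (a * w.1 1 + 2 * w.1 1 ^ 3) * w.2 1 ^ 2 +
        (√(quarticA (w.1 1) a 1) + w.1 1 * (a * w.1 1 + 2 * w.1 1 ^ 3) / √(quarticA (w.1 1) a 1) -
        (a + 6 * w.1 1 ^ 2) / 2) * Real.cos (w.1 0)) * v.1 1 +
      √(quarticA (w.1 1) a 1) * w.2 0 * v.2 0 + √(quarticA (w.1 1) a 1) ^ 2 * w.2 1 * v.2 1 := by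
  have hB := (Real.sqrt_pos.2 (quarticA_pos ha (w.1 1))).ne'
  have h0 := hasFDerivAt_coord 0 w
  have h1 := hasFDerivAt_coord 1 w
  have hS := (hasDerivAt_sqrt_quarticA ha (w.1 1)).comp_hasFDerivAt w h1
  have hV := (hasDerivAt_potentialAmp ha (w.1 1)).comp_hasFDerivAt w h1
  have h := (((hS.mul ((hasFDerivAt_momentum 0 w).pow 2)).add
    ((hS.pow 2).mul ((hasFDerivAt_momentum 1 w).pow 2))).const_mul (1 / 2)).add (hV.mul h0.cos)
  have e := congrArg (fun L : EuclideanSpace ℝ (Fin 2) × EuclideanSpace ℝ (Fin 2) →L[ℝ] ℝ => L v)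
    (HasFDerivAt.fderiv (f := polarHamiltonian a) h)
  refine e.trans ?_
  simp
  field_simp
  ring

theorem fderiv_polarQuartic (ha : -2 < a)
    (w v : EuclideanSpace ℝ (Fin 2) × EuclideanSpace ℝ (Fin 2)) :
    fderiv ℝ (polarQuartic a) w v =
      (-4 * w.2 0 * (w.1 1 * Real.sin (w.1 0) * w.2 0 +
          √(quarticA (w.1 1) a 1) * Real.cos (w.1 0) * w.2 1) +
        2 * (a + 2 * w.1 1 ^ 2 - 2 * √(quarticA (w.1 1) a 1)) * Real.sin (w.1 0) *
          Real.cos (w.1 0)) * v.1 0 +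
      (4 * w.2 0 * (Real.cos (w.1 0) * w.2 0 -
          (a * w.1 1 + 2 * w.1 1 ^ 3) / √(quarticA (w.1 1) a 1) * Real.sin (w.1 0) * w.2 1) +
        (4 * w.1 1 - 2 * ((a * w.1 1 + 2 * w.1 1 ^ 3) / √(quarticA (w.1 1) a 1))) *
          Real.sin (w.1 0) ^ 2) * v.1 1 +
      (4 * w.2 0 ^ 3 + 8 * w.1 1 * Real.cos (w.1 0) * w.2 0 -
        4 * √(quarticA (w.1 1) a 1) * Real.sin (w.1 0) * w.2 1) * v.2 0 -
      4 * √(quarticA (w.1 1) a 1) * Real.sin (w.1 0) * w.2 0 * v.2 1 := by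
  have hB := (Real.sqrt_pos.2 (quarticA_pos ha (w.1 1))).ne'
  have h0 := hasFDerivAt_coord 0 w
  have h1 := hasFDerivAt_coord 1 w
  have m0 := hasFDerivAt_momentum 0 w
  have m1 := hasFDerivAt_momentum 1 w
  have hS := (hasDerivAt_sqrt_quarticA ha (w.1 1)).comp_hasFDerivAt w h1
  have h := ((m0.pow 4).add ((m0.const_mul 4).mul (((h1.mul h0.cos).mul m0).sub
    ((hS.mul h0.sin).mul m1)))).add
    (((((h1.pow 2).const_mul 2).const_add a).sub (hS.const_mul 2)).mul (h0.sin.pow 2))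
  have e := congrArg (fun L : EuclideanSpace ℝ (Fin 2) × EuclideanSpace ℝ (Fin 2) →L[ℝ] ℝ => L v)
    (HasFDerivAt.fderiv (f := polarQuartic a) h)
  refine e.trans ?_
  simp
  field_simp
  ring

/-- After differentiation `√A` enters only as a symbol `B` with derivative `(a u + 2u³)/B`. The
bracket vanishes identically as a rational expression in `B`, `u`, the momenta, `sin φ` and `cos φ`;
neither `B² = A` nor `sin² + cos² = 1` is needed. -/
theorem canonicalBracket_polarQuartic (ha : -2 < a)
    (w : EuclideanSpace ℝ (Fin 2) × EuclideanSpace ℝ (Fin 2)) :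
    canonicalBracket (polarQuartic a) (polarHamiltonian a) w = 0 := by
  have hB := (Real.sqrt_pos.2 (quarticA_pos ha (w.1 1))).ne'
  unfold canonicalBracket
  rw [Fin.sum_univ_two]
  simp only [fderiv_polarQuartic ha, fderiv_polarHamiltonian ha]
  simp only [potentialAmp]
  simp
  generalize √(quarticA (w.1 1) a 1) = B at *
  generalize Real.sin (w.1 0) = s at *
  generalize Real.cos (w.1 0) = c at *
  generalize w.1 1 = u at *
  generalize w.2 0 = p at *
  generalize w.2 1 = t at *
  field_simp
  ring

/-- Where the momentum Jacobian of the integral and the Hamiltonian does not vanish, their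
differentials are independent. -/
theorem independentAt_of_jacobian_ne_zero {F G : PhaseFunction 2 S2} (hF : F.Smooth)
    (hG : G.Smooth) (ha : -2 < a) {e : OpenPartialHomeomorph S2 (EuclideanSpace ℝ (Fin 2))}
    (he : e ∈ atlas (EuclideanSpace ℝ (Fin 2)) S2) {z : EuclideanSpace ℝ (Fin 2)}
    (hz : polarMap a z ∈ e.source) (p : EuclideanSpace ℝ (Fin 2))
    (hJ : fderiv ℝ (F.pullback (polarMap a)) (z, momentumPullback (e ∘ polarMap a) (z, p))
        (0, EuclideanSpace.single 0 1) *
      fderiv ℝ (G.pullback (polarMap a)) (z, momentumPullback (e ∘ polarMap a) (z, p))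
        (0, EuclideanSpace.single 1 1) ≠
      fderiv ℝ (F.pullback (polarMap a)) (z, momentumPullback (e ∘ polarMap a) (z, p))
        (0, EuclideanSpace.single 1 1) *
      fderiv ℝ (G.pullback (polarMap a)) (z, momentumPullback (e ∘ polarMap a) (z, p))
        (0, EuclideanSpace.single 0 1)) :
    F.IndependentAt G e ((e ∘ polarMap a) z, p) := by
  have hP := contMDiff_polarMap ha
  have hb := bijective_mfderiv_polarMap ha
  have hψ := S2.contDiffAt_chart_comp he hP hz
  obtain ⟨T', hT, hT'⟩ := hasFDerivAt_momentumPullback (p := p) (contDiffAt_infty.1 hψ 2)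
  have hev : ∀ᶠ y in nhds z, polarMap a y ∈ e.source :=
    hP.continuous.continuousAt.eventually (e.open_source.mem_nhds hz)
  have key : ∀ {F : PhaseFunction 2 S2}, F.Smooth → ∀ ρ,
      fderiv ℝ (F.inChart e) ((e ∘ polarMap a) z, p) (0, ρ) =
        fderiv ℝ (F.pullback (polarMap a)) (z, momentumPullback (e ∘ polarMap a) (z, p))
          (0, T' (0, ρ)) := by
    intro F hF ρ
    have := fderiv_apply_of_eq_momentumPullback (hψ.differentiableAt (by simp)) hT
      ((S2.contDiff_inChart hF he).differentiable (by simp) _)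
      ((S2.contDiff_pullback hF hP hb).differentiable (by simp) _)
      (hev.mono fun y hy p => S2.inChart_eq_pullback F he hP hy (hb y) p) 0 ρ
    rwa [map_zero] at this
  have hsurj : ∀ η, ∃ ρ, T' (0, ρ) = η := by
    let L : EuclideanSpace ℝ (Fin 2) →ₗ[ℝ] EuclideanSpace ℝ (Fin 2) :=
      (T'.comp (ContinuousLinearMap.inr ℝ _ _)).toLinearMap
    have hinj : Function.Injective L := by
      rw [injective_iff_map_eq_zero]
      intro ρ hρ
      refine ext_inner_right ℝ fun η => ?_
      obtain ⟨η, rfl⟩ := (S2.bijective_fderiv_chart_comp he hP hz (hb z)).2 η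
      have h := hT' 0 ρ η
      have hρ' : T' (0, ρ) = 0 := hρ
      rw [hρ'] at h
      simpa using h.symm
    exact (LinearMap.injective_iff_surjective (f := L)).1 hinj
  unfold PhaseFunction.IndependentAt
  rw [LinearIndependent.pair_iff]
  intro s t hst
  have h : ∀ η, s * fderiv ℝ (F.pullback (polarMap a))
      (z, momentumPullback (e ∘ polarMap a) (z, p)) (0, η) +
      t * fderiv ℝ (G.pullback (polarMap a))
        (z, momentumPullback (e ∘ polarMap a) (z, p)) (0, η) = 0 := by
    intro η
    obtain ⟨ρ, rfl⟩ := hsurj η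
    rw [← key hF, ← key hG]
    exact congrArg (fun L : EuclideanSpace ℝ (Fin 2) × EuclideanSpace ℝ (Fin 2) →L[ℝ] ℝ =>
      L (0, ρ)) hst
  have h0 := h (EuclideanSpace.single 0 1)
  have h1 := h (EuclideanSpace.single 1 1)
  rw [← sub_ne_zero] at hJ
  refine ⟨(mul_eq_zero_iff_right hJ).1 ?_, (mul_eq_zero_iff_right hJ).1 ?_⟩
  · linear_combination fderiv ℝ (G.pullback (polarMap a))
      (z, momentumPullback (e ∘ polarMap a) (z, p)) (0, EuclideanSpace.single 1 1) * h0 -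
      fderiv ℝ (G.pullback (polarMap a))
        (z, momentumPullback (e ∘ polarMap a) (z, p)) (0, EuclideanSpace.single 0 1) * h1
  · linear_combination fderiv ℝ (F.pullback (polarMap a))
      (z, momentumPullback (e ∘ polarMap a) (z, p)) (0, EuclideanSpace.single 0 1) * h1 -
      fderiv ℝ (F.pullback (polarMap a))
        (z, momentumPullback (e ∘ polarMap a) (z, p)) (0, EuclideanSpace.single 1 1) * h0

theorem frequently_eval_ne_zero {P : Polynomial ℝ} (hP : P ≠ 0) :
    ∃ᶠ t in nhds (0 : ℝ), P.eval t ≠ 0 := by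
  have hd : Dense {t : ℝ | P.eval t ≠ 0} := by
    have h := Set.Countable.dense_compl ℝ
      (Set.Finite.countable (s := {t : ℝ | P.IsRoot t}) (Polynomial.finite_setOfPred_isRoot hP))
    exact h
  exact mem_closure_iff_frequently.1 (hd 0)

theorem independent_of_pullback_eq (ha : -2 < a) {F G : PhaseFunction 2 S2} (hF : F.Smooth)
    (hG : G.Smooth) (hF' : F.pullback (polarMap a) = polarQuartic a)
    (hG' : G.pullback (polarMap a) = polarHamiltonian a) : F.Independent G := by
  intro e he
  have hP := contMDiff_polarMap ha
  have hb := bijective_mfderiv_polarMap ha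
  have hD : Dense ((e.symm ⁻¹' Set.range (polarMap a)) ×ˢ
      (Set.univ : Set (EuclideanSpace ℝ (Fin 2)))) :=
    (dense_chart_preimage_range_polarMap ha e he).prod dense_univ
  have hcl : (e.symm ⁻¹' Set.range (polarMap a)) ×ˢ (Set.univ : Set (EuclideanSpace ℝ (Fin 2))) ⊆
      closure {z | z.1 ∈ e.target ∧ F.IndependentAt G e z} := by
    rintro ⟨q, p⟩ ⟨⟨z, hz⟩, -⟩
    have hq : q ∈ e.target := by rw [S2.target_eq_univ he]; trivial
    have hzs : polarMap a z ∈ e.source := by rw [hz]; exact e.map_target hq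
    have hqz : (e ∘ polarMap a) z = q := by rw [Function.comp_apply, hz, e.right_inv hq]
    have hB := Real.sqrt_pos.2 (quarticA_pos ha (z 1))
    -- A chart direction along which the polar momenta move by `(1, 1)`. Both then grow, and the
    -- Jacobian becomes a polynomial of exact degree four in the parameter of the line.
    obtain ⟨ρ, hρ⟩ : ∃ ρ, momentumPullback (e ∘ polarMap a) (z, ρ) = !₂[1, 1] := by
      let D := LinearEquiv.ofBijective (fderiv ℝ (e ∘ polarMap a) z).toLinearMap
        (S2.bijective_fderiv_chart_comp he hP hzs (hb z))
      refine ⟨LinearMap.adjoint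
        (D.symm : EuclideanSpace ℝ (Fin 2) →ₗ[ℝ] EuclideanSpace ℝ (Fin 2)) !₂[1, 1], ?_⟩
      refine ext_inner_right ℝ fun η => ?_
      rw [inner_momentumPullback, LinearMap.adjoint_inner_left]
      exact congrArg _ (D.symm_apply_apply η)
    have hline : ∀ t : ℝ, momentumPullback (e ∘ polarMap a) (z, p + t • ρ) =
        momentumPullback (e ∘ polarMap a) (z, p) + t • !₂[1, 1] := by
      intro t
      refine ext_inner_right ℝ fun η => ?_
      rw [← hρ, inner_add_left, inner_smul_left]
      simp only [inner_momentumPullback, inner_add_left, inner_smul_left]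
    set π := momentumPullback (e ∘ polarMap a) (z, p)
    set B := √(quarticA (z 1) a 1)
    let X : Polynomial ℝ := Polynomial.X
    let C : ℝ → Polynomial ℝ := Polynomial.C
    let J : Polynomial ℝ :=
      (C 4 * (C (π 0) + X) ^ 3 + C (8 * z 1 * Real.cos (z 0)) * (C (π 0) + X) -
        C (4 * B * Real.sin (z 0)) * (C (π 1) + X)) * (C (B ^ 2) * (C (π 1) + X)) +
      C (4 * B * Real.sin (z 0)) * (C (π 0) + X) * (C B * (C (π 0) + X))
    have hJ : J ≠ 0 := by
      intro h
      have hv : ∀ t : ℝ, J.eval t = 0 := fun t => by rw [h, Polynomial.eval_zero]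
      have h0 := hv 0
      have h1 := hv 1
      have h2 := hv (-1)
      have h3 := hv 2
      have h4 := hv (-2)
      simp only [J, C, X, Polynomial.eval_add, Polynomial.eval_sub, Polynomial.eval_mul,
        Polynomial.eval_pow, Polynomial.eval_C, Polynomial.eval_X] at h0 h1 h2 h3 h4
      -- The fourth difference at `-2, …, 2`, equal to `4!` times the leading coefficient `4 B²`.
      have : 96 * B ^ 2 = 0 := by linear_combination h3 - 4 * h1 + 6 * h0 - 4 * h2 + h4
      exact hB.ne' (by simpa using this)
    have hfreq := frequently_eval_ne_zero hJ
    have hcont : Filter.Tendsto (fun t : ℝ => (q, p + t • ρ)) (nhds 0) (nhds (q, p)) := by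
      have : Continuous fun t : ℝ => (q, p + t • ρ) := by fun_prop
      convert! this.tendsto 0 using 2
      simp
    refine mem_closure_iff_frequently.2 (hcont.frequently (hfreq.mono fun t ht => ⟨hq, ?_⟩))
    rw [← hqz]
    refine independentAt_of_jacobian_ne_zero hF hG ha he hzs _ ?_
    rw [hline, hF', hG']
    simp only [fderiv_polarQuartic ha, fderiv_polarHamiltonian ha]
    rw [← sub_ne_zero]
    convert! ht using 1
    simp [J, C, X]
    ring
  intro w _
  have h := hD.mono hcl
  rw [dense_iff_closure_eq, closure_closure] at h
  rw [h]
  trivial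

theorem ExtendsH1.smooth_hamiltonian (ha : -2 < a) {S : ConservativeSystem 2 S2}
    (h : ExtendsH1 a S) : S.hamiltonian.Smooth := by
  obtain ⟨f, hf, hpos, hS⟩ := h.exists_conformal ha
  exact S2.smooth_hamiltonian hf hpos hS

theorem ExtendsH1.hasIntegralOfDegree_four (ha : -2 < a) {S : ConservativeSystem 2 S2}
    (h : ExtendsH1 a S) : S.HasIntegralOfDegree 4 := by
  obtain ⟨f, g, α, β, γ, ⟨-, -, hα, hβ, hγ⟩, -, hc⟩ := exists_sphere_coefficients ha
  have hF := S2.smooth_quarticIntegral hα hβ hγ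
  have hH := h.smooth_hamiltonian ha
  have hF' := pullback_quarticIntegral ha (fun z => (hc z).2.2.1) (fun z => (hc z).2.2.2.1)
    (fun z => (hc z).2.2.2.2)
  have hH' := h.pullback_hamiltonian ha
  refine ⟨S2.quarticIntegral α β γ, ⟨hF, ?_⟩, S2.polynomialInMomenta_quarticIntegral,
    independent_of_pullback_eq ha hF hH hF' hH'⟩
  refine S2.poissonCommute_of_pullback hF hH (contMDiff_polarMap ha)
    (bijective_mfderiv_polarMap ha) (dense_chart_preimage_range_polarMap ha) fun w => ?_
  rw [hF', hH']
  exact canonicalBracket_polarQuartic ha w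

end Quartic

end

noncomputable section

/-! ## Quadratic integrals -/

section PartialDerivatives

variable {f : ℝ × ℝ → ℝ}

theorem hasDerivAt_slice_fst (hf : ContDiff ℝ ∞ f) (x y : ℝ) :
    HasDerivAt (fun x => f (x, y)) (fderiv ℝ f (x, y) (1, 0)) x :=
  (hf.differentiable (by simp) (x, y)).hasFDerivAt.comp_hasDerivAt x
    ((hasDerivAt_id x).prodMk (hasDerivAt_const x y))

theorem hasDerivAt_slice_snd (hf : ContDiff ℝ ∞ f) (x y : ℝ) :
    HasDerivAt (fun y => f (x, y)) (fderiv ℝ f (x, y) (0, 1)) y :=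
  (hf.differentiable (by simp) (x, y)).hasFDerivAt.comp_hasDerivAt y
    ((hasDerivAt_const y x).prodMk (hasDerivAt_id y))

theorem contDiff_fderiv_apply_const (hf : ContDiff ℝ ∞ f) (v : ℝ × ℝ) :
    ContDiff ℝ ∞ fun z => fderiv ℝ f z v :=
  (hf.fderiv_right (m := ∞) (by simp)).clm_apply contDiff_const

theorem eq_of_hasDerivAt_eq {f g f' : ℝ → ℝ} (hf : ∀ x, HasDerivAt f (f' x) x)
    (hg : ∀ x, HasDerivAt g (f' x) x) (h0 : f 0 = g 0) (x : ℝ) : f x = g x := by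
  have h : ∀ x, HasDerivAt (fun x => f x - g x) 0 x := fun x => by
    simpa using (hf x).fun_sub (hg x)
  have := is_const_of_deriv_eq_zero (fun x => (h x).differentiableAt) (fun x => (h x).deriv) x 0
  linarith

end PartialDerivatives

/-- The ten evaluation points determine the ten coefficients. -/
theorem cubic_coefficients_eq_zero {c30 c21 c12 c03 c20 c11 c02 c10 c01 c00 : ℝ}
    (h : ∀ x y : ℝ, c30 * x ^ 3 + c21 * x ^ 2 * y + c12 * x * y ^ 2 + c03 * y ^ 3 + c20 * x ^ 2 +
      c11 * x * y + c02 * y ^ 2 + c10 * x + c01 * y + c00 = 0) :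
    (c30 = 0 ∧ c21 = 0 ∧ c12 = 0 ∧ c03 = 0) ∧ (c20 = 0 ∧ c11 = 0 ∧ c02 = 0) ∧
      (c10 = 0 ∧ c01 = 0) ∧ c00 = 0 := by
  have h0 := h 0 0
  have h1 := h 1 0
  have h2 := h (-1) 0
  have h3 := h 2 0
  have h4 := h 0 1
  have h5 := h 0 (-1)
  have h6 := h 0 2
  have h7 := h 1 1
  have h8 := h 1 (-1)
  have h9 := h (-1) 1
  norm_num at h0 h1 h2 h3 h4 h5 h6 h7 h8 h9
  refine ⟨⟨?_, ?_, ?_, ?_⟩, ⟨?_, ?_, ?_⟩, ⟨?_, ?_⟩, ?_⟩ <;> linarith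

/-! ### Determination of all integrals of degree at most two. -/

section Quartic

variable {a : ℝ}

theorem sqrt_quarticA_sq (ha : -2 < a) (u : ℝ) :
    √(quarticA u a 1) ^ 2 = 1 + a * u ^ 2 + u ^ 4 := by
  rw [Real.sq_sqrt (quarticA_pos ha u).le, quarticA]

theorem sqrt_quarticA_neg (a u : ℝ) : √(quarticA (-u) a 1) = √(quarticA u a 1) := by
  rw [quarticA_neg]

/-- The fraction is `(√A)'`, which is proportional to `u` when `a = 2`. Squaring and comparing `u =
1` with `u = 2` gives `β² (a + 5)(a - 2) = 0`. -/
theorem eq_zero_of_mul_eq_mul_deriv_sqrt (ha : -2 < a) (ha2 : a ≠ 2) {κ β : ℝ}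
    (h : ∀ u : ℝ, κ * u = β * ((a * u + 2 * u ^ 3) / √(quarticA u a 1))) : β = 0 := by
  have hs : ∀ u : ℝ, κ ^ 2 * u ^ 2 * (1 + a * u ^ 2 + u ^ 4) =
      β ^ 2 * (a * u + 2 * u ^ 3) ^ 2 := by
    intro u
    have hB := (Real.sqrt_pos.2 (quarticA_pos ha u)).ne'
    have h1 := h u
    field_simp at h1
    rw [← sqrt_quarticA_sq ha]
    linear_combination (κ * u * √(quarticA u a 1) + β * (a * u + 2 * u ^ 3)) * h1
  have h1 := hs 1
  have h2 := hs 2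
  by_contra hβ
  have hβ2 : 0 < β ^ 2 := by positivity
  have ha' : a + 2 ≠ 0 := by linarith
  have h1' : κ ^ 2 = β ^ 2 * (a + 2) := by
    refine mul_right_cancel₀ ha' ?_
    linear_combination h1
  rw [h1'] at h2
  have h3 : (a + 5) * (a - 2) = 0 := by
    refine mul_left_cancel₀ hβ2.ne' ?_
    linear_combination h2 / 12
  rcases mul_eq_zero.1 h3 with h | h
  · linarith
  · exact ha2 (by linarith)

/-- Multiplying by `2√A` and squaring gives a polynomial identity of degree four in `x = u²`, whose
constant terms agree. The values at `1, …, 4` therefore suffice: the coefficient of `x⁴` gives `δ² =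
4g²`, that of `x³` gives `g (δ - a g) = 0`, and together they force `a² = 4` unless `g = 0`. -/
theorem eq_zero_of_mul_eq_mul_sq (ha : -2 < a) (ha2 : a ≠ 2) {g δ : ℝ}
    (h : ∀ u : ℝ, g * (√(quarticA u a 1) - 1 +
      u / 2 * ((a * u + 2 * u ^ 3) / √(quarticA u a 1))) = δ * u ^ 2) : g = 0 := by
  have hs : ∀ x : ℝ, 0 ≤ x → g ^ 2 * (2 + 3 * a * x + 4 * x ^ 2) ^ 2 =
      4 * (1 + a * x + x ^ 2) * (g + δ * x) ^ 2 := by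
    intro x hx
    have hB := (Real.sqrt_pos.2 (quarticA_pos ha (√x))).ne'
    have h1 := h (√x)
    have h2 := sqrt_quarticA_sq ha (√x)
    have hx2 := Real.sq_sqrt hx
    have hx4 : √x ^ 4 = x ^ 2 := by
      rw [show √x ^ 4 = (√x ^ 2) ^ 2 by ring, hx2]
    rw [hx4, hx2] at h2
    generalize √(quarticA (√x) a 1) = B at *
    have h3 : g * (2 + 3 * a * x + 4 * x ^ 2) = 2 * B * (g + δ * x) := by
      field_simp at h1
      linear_combination h1 - 2 * g * h2 + (2 * B * δ - g * a) * hx2 - 2 * g * hx4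
    rw [← mul_pow, h3, ← h2]
    ring
  have h1 := hs 1 (by norm_num)
  have h2 := hs 2 (by norm_num)
  have h3 := hs 3 (by norm_num)
  have h4 := hs 4 (by norm_num)
  have e4 : δ ^ 2 = 4 * g ^ 2 := by
    linear_combination (-1 / 96) * h4 + (4 / 96) * h3 - (6 / 96) * h2 + (4 / 96) * h1
  have e3 : g * (δ - a * g) = 0 := by
    have : 24 * a * g ^ 2 - 8 * g * δ - 4 * a * δ ^ 2 = 0 := by
      linear_combination (1 / 6) * h3 - (3 / 6) * h2 + (3 / 6) * h1 + 24 * e4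
    rw [e4] at this
    linear_combination (-1 / 8) * this
  by_contra hg
  have hδ : δ = a * g := by
    rcases mul_eq_zero.1 e3 with h | h
    · exact absurd h hg
    · linarith
  rw [hδ] at e4
  have h5 : (a - 2) * (a + 2) = 0 := by
    refine mul_left_cancel₀ (pow_ne_zero 2 hg) ?_
    linear_combination e4
  rcases mul_eq_zero.1 h5 with h | h
  · exact ha2 (by linarith)
  · linarith

/-- The equations for the leading coefficients of a quadratic integral. -/
theorem leading_coefficients (ha : -2 < a) (ha2 : a ≠ 2) {α b c : ℝ × ℝ → ℝ}
    (hα : ContDiff ℝ ∞ α) (hb : ContDiff ℝ ∞ b) (hc : ContDiff ℝ ∞ c)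
    (h30 : ∀ x u, fderiv ℝ α (x, u) (1, 0) * √(quarticA u a 1) -
      b (x, u) * ((a * u + 2 * u ^ 3) / √(quarticA u a 1)) = 0)
    (h21 : ∀ x u, 2 * fderiv ℝ b (x, u) (1, 0) * √(quarticA u a 1) +
      fderiv ℝ α (x, u) (0, 1) * √(quarticA u a 1) ^ 2 -
      c (x, u) * ((a * u + 2 * u ^ 3) / √(quarticA u a 1)) = 0)
    (h12 : ∀ x u, fderiv ℝ c (x, u) (1, 0) * √(quarticA u a 1) +
      2 * fderiv ℝ b (x, u) (0, 1) * √(quarticA u a 1) ^ 2 -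
      2 * b (x, u) * (a * u + 2 * u ^ 3) = 0)
    (h03 : ∀ x u, fderiv ℝ c (x, u) (0, 1) * √(quarticA u a 1) ^ 2 -
      2 * c (x, u) * (a * u + 2 * u ^ 3) = 0) :
    ∃ γ α₀ : ℝ, ∀ x u, α (x, u) = γ * √(quarticA u a 1) + α₀ ∧ b (x, u) = 0 ∧
      c (x, u) = γ * √(quarticA u a 1) ^ 2 := by
  have hBne : ∀ u, √(quarticA u a 1) ≠ 0 := fun u =>
    (Real.sqrt_pos.2 (quarticA_pos ha u)).ne'
  have hB0 : √(quarticA 0 a 1) = 1 := by simp [quarticA]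
  have hB' := hasDerivAt_sqrt_quarticA ha
  have hcx := contDiff_fderiv_apply_const hc (1, 0)
  have hcxx := contDiff_fderiv_apply_const hcx (1, 0)
  have hbx := contDiff_fderiv_apply_const hb (1, 0)
  -- The equations are triangular. With `B = √A`, `h03` makes `c / B²` independent of `u`, then
  -- `h12` makes `b / B` affine in `u`, and `h21` integrates to `α`. Unknown functions of `φ` alone
  -- remain, and `h30` turns into the single relation `hmain`.
  have ec : ∀ x u, c (x, u) = c (x, 0) * √(quarticA u a 1) ^ 2 := by
    intro x u
    have h1 : ∀ u, HasDerivAt (fun u => c (x, u) / √(quarticA u a 1) ^ 2) 0 u := by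
      intro u
      convert! (hasDerivAt_slice_snd hc x u).div ((hB' u).pow 2) (pow_ne_zero 2 (hBne u)) using 1
      have h := h03 x u
      have := hBne u
      rw [eq_comm, div_eq_zero_iff]
      left
      simp
      field_simp
      linear_combination h
    have h2 := eq_of_hasDerivAt_eq h1 (fun u => hasDerivAt_const u (c (x, 0))) (by simp [hB0]) u
    have := hBne u
    field_simp at h2
    linear_combination h2
  have ecx : ∀ x u, fderiv ℝ c (x, u) (1, 0) =
      fderiv ℝ c (x, 0) (1, 0) * √(quarticA u a 1) ^ 2 := by
    intro x u
    have h1 := (hasDerivAt_slice_fst hc x 0).mul_const (√(quarticA u a 1) ^ 2)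
    rw [← show (fun x => c (x, u)) = _ from funext fun x => ec x u] at h1
    exact (hasDerivAt_slice_fst hc x u).unique h1
  have eb : ∀ x u, b (x, u) =
      √(quarticA u a 1) * (b (x, 0) - fderiv ℝ c (x, 0) (1, 0) * u / 2) := by
    intro x u
    have h1 : ∀ u, HasDerivAt (fun u => b (x, u) / √(quarticA u a 1))
        (-(fderiv ℝ c (x, 0) (1, 0)) / 2) u := by
      intro u
      convert! (hasDerivAt_slice_snd hb x u).div (hB' u) (hBne u) using 1
      have h := h12 x u
      rw [ecx] at h
      have := hBne u
      field_simp
      linear_combination -h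
    have h2 := eq_of_hasDerivAt_eq h1 (g := fun u => b (x, 0) - fderiv ℝ c (x, 0) (1, 0) * u / 2)
      (fun u => ?_) (by simp [hB0]) u
    · have := hBne u
      field_simp at h2
      linear_combination h2 / 2
    · convert! (((hasDerivAt_id u).const_mul (fderiv ℝ c (x, 0) (1, 0))).div_const 2).const_sub
        (b (x, 0)) using 1
      simp; ring
  have ebx : ∀ x u, fderiv ℝ b (x, u) (1, 0) = √(quarticA u a 1) * (fderiv ℝ b (x, 0) (1, 0) -
      fderiv ℝ (fun z => fderiv ℝ c z (1, 0)) (x, 0) (1, 0) * u / 2) := by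
    intro x u
    have h1 := ((hasDerivAt_slice_fst hb x 0).sub
      (((hasDerivAt_slice_fst hcx x 0).mul_const u).div_const 2)).const_mul (√(quarticA u a 1))
    exact (hasDerivAt_slice_fst hb x u).unique
      (h1.congr_of_eventuallyEq (Filter.Eventually.of_forall fun x => eb x u))
  have eα : ∀ x u, α (x, u) = α (x, 0) + c (x, 0) * (√(quarticA u a 1) - 1) -
      2 * fderiv ℝ b (x, 0) (1, 0) * u +
      fderiv ℝ (fun z => fderiv ℝ c z (1, 0)) (x, 0) (1, 0) * (u ^ 2 / 2) := by
    intro x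
    refine eq_of_hasDerivAt_eq (f := fun u => α (x, u)) (fun u => hasDerivAt_slice_snd hα x u)
      (fun u => ?_) (by simp [hB0])
    have h1 := ((((hB' u).sub_const 1).const_mul (c (x, 0))).const_add (α (x, 0)) |>.sub
      ((hasDerivAt_id u).const_mul (2 * fderiv ℝ b (x, 0) (1, 0)))).add
      (((hasDerivAt_pow 2 u).div_const 2).const_mul
        (fderiv ℝ (fun z => fderiv ℝ c z (1, 0)) (x, 0) (1, 0)))
    convert! h1 using 1
    have h := h21 x u
    rw [ebx, ec] at h
    have := hBne u
    simp
    field_simp at h ⊢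
    linear_combination (mul_eq_zero.1 h).resolve_left this
  have eαx : ∀ x u, fderiv ℝ α (x, u) (1, 0) = fderiv ℝ α (x, 0) (1, 0) +
      fderiv ℝ c (x, 0) (1, 0) * (√(quarticA u a 1) - 1) -
      2 * fderiv ℝ (fun z => fderiv ℝ b z (1, 0)) (x, 0) (1, 0) * u +
      fderiv ℝ (fun z => fderiv ℝ (fun z => fderiv ℝ c z (1, 0)) z (1, 0)) (x, 0) (1, 0) *
        (u ^ 2 / 2) := by
    intro x u
    have h1 := (((hasDerivAt_slice_fst hα x 0).add
      ((hasDerivAt_slice_fst hc x 0).mul_const (√(quarticA u a 1) - 1))).sub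
      (((hasDerivAt_slice_fst hbx x 0).const_mul 2).mul_const u)).add
      ((hasDerivAt_slice_fst hcxx x 0).mul_const (u ^ 2 / 2))
    exact (hasDerivAt_slice_fst hα x u).unique
      (h1.congr_of_eventuallyEq (Filter.Eventually.of_forall fun x => eα x u))
  have hmain : ∀ x u, fderiv ℝ α (x, 0) (1, 0) +
      fderiv ℝ c (x, 0) (1, 0) * (√(quarticA u a 1) - 1) -
      2 * fderiv ℝ (fun z => fderiv ℝ b z (1, 0)) (x, 0) (1, 0) * u +
      fderiv ℝ (fun z => fderiv ℝ (fun z => fderiv ℝ c z (1, 0)) z (1, 0)) (x, 0) (1, 0) *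
        (u ^ 2 / 2) = (a * u + 2 * u ^ 3) / √(quarticA u a 1) *
        (b (x, 0) - fderiv ℝ c (x, 0) (1, 0) * u / 2) := by
    intro x u
    have h := h30 x u
    rw [eαx, eb] at h
    have := hBne u
    field_simp at h ⊢
    linear_combination h
  have hα0 : ∀ x, fderiv ℝ α (x, 0) (1, 0) = 0 := fun x => by
    simpa [hB0] using hmain x 0
  -- As `√A` is even in `u` and its derivative odd, `hmain` splits by parity. The odd part forces `b
  -- = 0` on `u = 0`; the even part, used next, forces `∂c/∂φ = 0` there.
  have hb0 : ∀ x, b (x, 0) = 0 := fun x => by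
    refine eq_zero_of_mul_eq_mul_deriv_sqrt ha ha2
      (κ := -2 * fderiv ℝ (fun z => fderiv ℝ b z (1, 0)) (x, 0) (1, 0)) fun u => ?_
    have h1 := hmain x u
    have h2 := hmain x (-u)
    rw [sqrt_quarticA_neg] at h2
    have h3 : (a * -u + 2 * (-u) ^ 3) / √(quarticA u a 1) =
      -((a * u + 2 * u ^ 3) / √(quarticA u a 1)) := by ring
    rw [h3] at h2
    linear_combination (h1 - h2) / 2
  have hcx0 : ∀ x, fderiv ℝ c (x, 0) (1, 0) = 0 := fun x => by
    refine eq_zero_of_mul_eq_mul_sq ha ha2 (δ := -(1 / 2) *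
      fderiv ℝ (fun z => fderiv ℝ (fun z => fderiv ℝ c z (1, 0)) z (1, 0)) (x, 0) (1, 0))
      fun u => ?_
    have h1 := hmain x u
    rw [hα0, hb0] at h1
    have h2 := hmain x (-u)
    rw [sqrt_quarticA_neg, hα0, hb0] at h2
    have h3 : (a * -u + 2 * (-u) ^ 3) / √(quarticA u a 1) =
      -((a * u + 2 * u ^ 3) / √(quarticA u a 1)) := by ring
    rw [h3] at h2
    linear_combination (h1 + h2) / 2
  have hconst : ∀ {f : ℝ × ℝ → ℝ}, ContDiff ℝ ∞ f → (∀ x, fderiv ℝ f (x, 0) (1, 0) = 0) →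
      ∀ x, f (x, 0) = f (0, 0) := fun {f} hf h x =>
    eq_of_hasDerivAt_eq (f := fun x => f (x, 0)) (f' := fun _ => 0)
      (fun x => by simpa [h] using hasDerivAt_slice_fst hf x 0)
      (fun x => hasDerivAt_const x (f (0, 0))) rfl x
  have hbx0 : ∀ x, fderiv ℝ b (x, 0) (1, 0) = 0 := fun x =>
    (hasDerivAt_slice_fst hb x 0).unique ((hasDerivAt_const x (0 : ℝ)).congr_of_eventuallyEq
      (Filter.Eventually.of_forall fun x => hb0 x))
  have hcxx0 : ∀ x, fderiv ℝ (fun z => fderiv ℝ c z (1, 0)) (x, 0) (1, 0) = 0 := fun x =>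
    (hasDerivAt_slice_fst hcx x 0).unique ((hasDerivAt_const x (0 : ℝ)).congr_of_eventuallyEq
      (Filter.Eventually.of_forall fun x => hcx0 x))
  refine ⟨c (0, 0), α (0, 0) - c (0, 0), fun x u => ⟨?_, ?_, ?_⟩⟩
  · rw [eα, hbx0, hcxx0, hconst hα hα0, hconst hc hcx0]
    ring
  · rw [eb, hb0, hcx0]
    ring
  · rw [ec, hconst hc hcx0]

/-- The equations for the linear coefficients of a quadratic integral. -/
theorem linear_coefficients (ha : -2 < a) (ha2 : a ≠ 2) {m n : ℝ × ℝ → ℝ}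
    (hm : ContDiff ℝ ∞ m) (hn : ContDiff ℝ ∞ n)
    (h20 : ∀ x u, fderiv ℝ m (x, u) (1, 0) * √(quarticA u a 1) -
      1 / 2 * n (x, u) * ((a * u + 2 * u ^ 3) / √(quarticA u a 1)) = 0)
    (h11 : ∀ x u, fderiv ℝ n (x, u) (1, 0) * √(quarticA u a 1) +
      fderiv ℝ m (x, u) (0, 1) * √(quarticA u a 1) ^ 2 = 0)
    (h02 : ∀ x u, fderiv ℝ n (x, u) (0, 1) * √(quarticA u a 1) ^ 2 -
      n (x, u) * (a * u + 2 * u ^ 3) = 0) :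
    ∃ m₀ : ℝ, ∀ x u, m (x, u) = m₀ ∧ n (x, u) = 0 := by
  have hBne : ∀ u, √(quarticA u a 1) ≠ 0 := fun u =>
    (Real.sqrt_pos.2 (quarticA_pos ha u)).ne'
  have hB0 : √(quarticA 0 a 1) = 1 := by simp [quarticA]
  have hB' := hasDerivAt_sqrt_quarticA ha
  have hnx := contDiff_fderiv_apply_const hn (1, 0)
  have en : ∀ x u, n (x, u) = n (x, 0) * √(quarticA u a 1) := by
    intro x u
    have h1 : ∀ u, HasDerivAt (fun u => n (x, u) / √(quarticA u a 1)) 0 u := by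
      intro u
      convert! (hasDerivAt_slice_snd hn x u).div (hB' u) (hBne u) using 1
      have h := h02 x u
      have := hBne u
      rw [eq_comm, div_eq_zero_iff]
      left
      field_simp
      linear_combination h
    have h2 := eq_of_hasDerivAt_eq h1 (fun u => hasDerivAt_const u (n (x, 0))) (by simp [hB0]) u
    have := hBne u
    field_simp at h2
    linear_combination h2
  have enx : ∀ x u, fderiv ℝ n (x, u) (1, 0) =
      fderiv ℝ n (x, 0) (1, 0) * √(quarticA u a 1) := by
    intro x u
    have h1 := (hasDerivAt_slice_fst hn x 0).mul_const (√(quarticA u a 1))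
    exact (hasDerivAt_slice_fst hn x u).unique
      (h1.congr_of_eventuallyEq (Filter.Eventually.of_forall fun x => en x u))
  have em : ∀ x u, m (x, u) = m (x, 0) - fderiv ℝ n (x, 0) (1, 0) * u := by
    intro x
    refine eq_of_hasDerivAt_eq (f := fun u => m (x, u)) (fun u => hasDerivAt_slice_snd hm x u)
      (fun u => ?_) (by simp)
    convert! ((hasDerivAt_id u).const_mul (fderiv ℝ n (x, 0) (1, 0))).const_sub (m (x, 0)) using 1
    have h := h11 x u
    rw [enx] at h
    refine mul_right_cancel₀ (pow_ne_zero 2 (hBne u)) ?_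
    simp
    linear_combination h
  have emx : ∀ x u, fderiv ℝ m (x, u) (1, 0) = fderiv ℝ m (x, 0) (1, 0) -
      fderiv ℝ (fun z => fderiv ℝ n z (1, 0)) (x, 0) (1, 0) * u := by
    intro x u
    have h1 := (hasDerivAt_slice_fst hm x 0).sub ((hasDerivAt_slice_fst hnx x 0).mul_const u)
    exact (hasDerivAt_slice_fst hm x u).unique
      (h1.congr_of_eventuallyEq (Filter.Eventually.of_forall fun x => em x u))
  have hmain : ∀ x u, fderiv ℝ m (x, 0) (1, 0) -
      fderiv ℝ (fun z => fderiv ℝ n z (1, 0)) (x, 0) (1, 0) * u =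
      1 / 2 * n (x, 0) * ((a * u + 2 * u ^ 3) / √(quarticA u a 1)) := by
    intro x u
    have h := h20 x u
    rw [emx, en] at h
    have := hBne u
    refine mul_right_cancel₀ this ?_
    field_simp at h ⊢
    linear_combination h
  have hm0 : ∀ x, fderiv ℝ m (x, 0) (1, 0) = 0 := fun x => by
    simpa using hmain x 0
  -- What is left of `hmain` is a proportionality between `u` and `(√A)'`.
  have hn0 : ∀ x, n (x, 0) = 0 := fun x => by
    refine eq_zero_of_mul_eq_mul_deriv_sqrt ha ha2
      (κ := -2 * fderiv ℝ (fun z => fderiv ℝ n z (1, 0)) (x, 0) (1, 0)) fun u => ?_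
    have h1 := hmain x u
    rw [hm0] at h1
    linear_combination 2 * h1
  have hnx0 : ∀ x, fderiv ℝ n (x, 0) (1, 0) = 0 := fun x =>
    (hasDerivAt_slice_fst hn x 0).unique ((hasDerivAt_const x (0 : ℝ)).congr_of_eventuallyEq
      (Filter.Eventually.of_forall fun x => hn0 x))
  refine ⟨m (0, 0), fun x u => ⟨?_, ?_⟩⟩
  · rw [em, hnx0]
    have := eq_of_hasDerivAt_eq (f := fun x => m (x, 0)) (f' := fun _ => 0)
      (fun x => by simpa [hm0] using hasDerivAt_slice_fst hm x 0)
      (fun x => hasDerivAt_const x (m (0, 0))) rfl x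
    rw [this]
    ring
  · rw [en, hn0, zero_mul]

theorem fderiv_comp_coord {f : ℝ × ℝ → ℝ} (hf : ContDiff ℝ ∞ f)
    (w : EuclideanSpace ℝ (Fin 2) × EuclideanSpace ℝ (Fin 2)) :
    HasFDerivAt (fun w : EuclideanSpace ℝ (Fin 2) × EuclideanSpace ℝ (Fin 2) => f (w.1 0, w.1 1))
      ((fderiv ℝ f (w.1 0, w.1 1)).comp
        (((EuclideanSpace.proj 0 : EuclideanSpace ℝ (Fin 2) →L[ℝ] ℝ).comp
          (ContinuousLinearMap.fst ℝ _ _)).prod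
          ((EuclideanSpace.proj 1 : EuclideanSpace ℝ (Fin 2) →L[ℝ] ℝ).comp
            (ContinuousLinearMap.fst ℝ _ _)))) w :=
  (hf.differentiable (by simp) (w.1 0, w.1 1)).hasFDerivAt.comp w
    ((hasFDerivAt_coord 0 w).prodMk (hasFDerivAt_coord 1 w))

theorem potentialAmp_zero (a : ℝ) : potentialAmp a 0 = 0 := by simp [potentialAmp]

theorem potentialAmp_one_ne_zero (ha : -2 < a) (ha2 : a ≠ 2) : potentialAmp a 1 ≠ 0 := by
  intro h
  have hs := sqrt_quarticA_sq ha 1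
  have hp := Real.sqrt_pos.2 (quarticA_pos ha 1)
  rw [potentialAmp] at h
  generalize √(quarticA 1 a 1) = s at *
  have h1 : s * (s - 2) = 0 := by linear_combination hs - 2 * h
  rcases mul_eq_zero.1 h1 with h2 | h2
  · exact hp.ne' h2
  · have : s = 2 := by linarith
    rw [this] at hs
    exact ha2 (by linarith)

/-- A function of degree two in the momenta which commutes with the Hamiltonian. -/
theorem eq_of_canonicalBracket_eq_zero (ha : -2 < a) (ha2 : a ≠ 2) {α b c m n k : ℝ × ℝ → ℝ}
    (hα : ContDiff ℝ ∞ α) (hb : ContDiff ℝ ∞ b) (hc : ContDiff ℝ ∞ c) (hm : ContDiff ℝ ∞ m)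
    (hn : ContDiff ℝ ∞ n) (hk : ContDiff ℝ ∞ k)
    {F : EuclideanSpace ℝ (Fin 2) × EuclideanSpace ℝ (Fin 2) → ℝ}
    (hF : ∀ w, F w = α (w.1 0, w.1 1) * w.2 0 ^ 2 + 2 * b (w.1 0, w.1 1) * w.2 0 * w.2 1 +
      c (w.1 0, w.1 1) * w.2 1 ^ 2 + m (w.1 0, w.1 1) * w.2 0 + n (w.1 0, w.1 1) * w.2 1 +
      k (w.1 0, w.1 1))
    (h : ∀ w, canonicalBracket F (polarHamiltonian a) w = 0) :
    ∃ γ r : ℝ, ∀ w, F w = 2 * γ * polarHamiltonian a w + r := by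
  have hFd : ∀ w v, fderiv ℝ F w v =
      fderiv ℝ α (w.1 0, w.1 1) (v.1 0, v.1 1) * w.2 0 ^ 2 +
      2 * fderiv ℝ b (w.1 0, w.1 1) (v.1 0, v.1 1) * w.2 0 * w.2 1 +
      fderiv ℝ c (w.1 0, w.1 1) (v.1 0, v.1 1) * w.2 1 ^ 2 +
      fderiv ℝ m (w.1 0, w.1 1) (v.1 0, v.1 1) * w.2 0 +
      fderiv ℝ n (w.1 0, w.1 1) (v.1 0, v.1 1) * w.2 1 +
      fderiv ℝ k (w.1 0, w.1 1) (v.1 0, v.1 1) +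
      (2 * α (w.1 0, w.1 1) * w.2 0 + 2 * b (w.1 0, w.1 1) * w.2 1 + m (w.1 0, w.1 1)) * v.2 0 +
      (2 * b (w.1 0, w.1 1) * w.2 0 + 2 * c (w.1 0, w.1 1) * w.2 1 + n (w.1 0, w.1 1)) *
        v.2 1 := by
    intro w v
    have m0 := hasFDerivAt_momentum 0 w
    have m1 := hasFDerivAt_momentum 1 w
    have hD := ((((((fderiv_comp_coord hα w).mul (m0.pow 2)).add
      ((((fderiv_comp_coord hb w).const_mul 2).mul m0).mul m1)).add
      ((fderiv_comp_coord hc w).mul (m1.pow 2))).add ((fderiv_comp_coord hm w).mul m0)).add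
      ((fderiv_comp_coord hn w).mul m1)).add (fderiv_comp_coord hk w)
    have e := congrArg (fun L : EuclideanSpace ℝ (Fin 2) × EuclideanSpace ℝ (Fin 2) →L[ℝ] ℝ =>
      L v) (HasFDerivAt.fderiv
        (hD.congr_of_eventuallyEq (f₁ := F) (Filter.Eventually.of_forall fun w => hF w)))
    refine e.trans ?_
    simp
    ring
  -- For fixed `(φ, u)` the bracket is a polynomial of degree three in the momenta. The cubic and
  -- the quadratic parts involve the kinetic energy only; the remaining parts contain the potential.
  have hcoef : ∀ x u : ℝ, _ := fun x u => cubic_coefficients_eq_zero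
    (c30 := fderiv ℝ α (x, u) (1, 0) * √(quarticA u a 1) -
      b (x, u) * ((a * u + 2 * u ^ 3) / √(quarticA u a 1)))
    (c21 := 2 * fderiv ℝ b (x, u) (1, 0) * √(quarticA u a 1) +
      fderiv ℝ α (x, u) (0, 1) * √(quarticA u a 1) ^ 2 -
      c (x, u) * ((a * u + 2 * u ^ 3) / √(quarticA u a 1)))
    (c12 := fderiv ℝ c (x, u) (1, 0) * √(quarticA u a 1) +
      2 * fderiv ℝ b (x, u) (0, 1) * √(quarticA u a 1) ^ 2 -
      2 * b (x, u) * (a * u + 2 * u ^ 3))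
    (c03 := fderiv ℝ c (x, u) (0, 1) * √(quarticA u a 1) ^ 2 -
      2 * c (x, u) * (a * u + 2 * u ^ 3))
    (c20 := fderiv ℝ m (x, u) (1, 0) * √(quarticA u a 1) -
      1 / 2 * n (x, u) * ((a * u + 2 * u ^ 3) / √(quarticA u a 1)))
    (c11 := fderiv ℝ n (x, u) (1, 0) * √(quarticA u a 1) +
      fderiv ℝ m (x, u) (0, 1) * √(quarticA u a 1) ^ 2)
    (c02 := fderiv ℝ n (x, u) (0, 1) * √(quarticA u a 1) ^ 2 -
      n (x, u) * (a * u + 2 * u ^ 3))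
    (c10 := fderiv ℝ k (x, u) (1, 0) * √(quarticA u a 1) +
      2 * α (x, u) * potentialAmp a u * Real.sin x - 2 * b (x, u) *
        deriv (potentialAmp a) u * Real.cos x)
    (c01 := fderiv ℝ k (x, u) (0, 1) * √(quarticA u a 1) ^ 2 +
      2 * b (x, u) * potentialAmp a u * Real.sin x - 2 * c (x, u) *
        deriv (potentialAmp a) u * Real.cos x)
    (c00 := m (x, u) * potentialAmp a u * Real.sin x - n (x, u) *
        deriv (potentialAmp a) u * Real.cos x) (by
      intro s t
      have h1 := h (!₂[x, u], !₂[s, t])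
      unfold canonicalBracket at h1
      rw [Fin.sum_univ_two] at h1
      simp only [hFd, fderiv_polarHamiltonian ha] at h1
      rw [(hasDerivAt_potentialAmp ha u).deriv]
      simp at h1
      simp only [Prod.mk_zero_zero, map_zero] at h1
      linear_combination h1)
  obtain ⟨γ, α₀, hlead⟩ := leading_coefficients ha ha2 hα hb hc (fun x u => (hcoef x u).1.1)
    (fun x u => (hcoef x u).1.2.1) (fun x u => (hcoef x u).1.2.2.1)
    (fun x u => (hcoef x u).1.2.2.2)
  obtain ⟨m₀, hlin⟩ := linear_coefficients ha ha2 hm hn (fun x u => (hcoef x u).2.1.1)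
    (fun x u => (hcoef x u).2.1.2.1) (fun x u => (hcoef x u).2.1.2.2)
  have hBne : ∀ u, √(quarticA u a 1) ≠ 0 := fun u =>
    (Real.sqrt_pos.2 (quarticA_pos ha u)).ne'
  have hh1 := potentialAmp_one_ne_zero ha ha2
  -- A linear part `m₀ p_φ` would require the potential to be independent of `φ`; it is tested at `φ
  -- = π/2`, `u = 1`.
  have hm0 : m₀ = 0 := by
    have := (hcoef (Real.pi / 2) 1).2.2.2
    rw [(hlin _ _).1, (hlin _ _).2] at this
    simpa [hh1] using this
  have hk1 : ∀ x u, k (x, u) = k (x, 0) + 2 * γ * potentialAmp a u * Real.cos x := by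
    intro x
    refine eq_of_hasDerivAt_eq (f := fun u => k (x, u)) (fun u => hasDerivAt_slice_snd hk x u)
      (fun u => ?_) (by simp [potentialAmp_zero])
    have hd := (hasDerivAt_potentialAmp ha u).differentiableAt.hasDerivAt
    convert! ((hd.const_mul (2 * γ)).mul_const (Real.cos x)).const_add (k (x, 0)) using 1
    have h1 := (hcoef x u).2.2.1.2
    rw [(hlead x u).2.1, (hlead x u).2.2] at h1
    refine mul_right_cancel₀ (pow_ne_zero 2 (hBne u)) ?_
    linear_combination h1
  have hk2 : ∀ x u, fderiv ℝ k (x, u) (1, 0) =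
      fderiv ℝ k (x, 0) (1, 0) - 2 * γ * potentialAmp a u * Real.sin x := by
    intro x u
    have h1 := (hasDerivAt_slice_fst hk x 0).add
      ((Real.hasDerivAt_cos x).const_mul (2 * γ * potentialAmp a u))
    refine ((hasDerivAt_slice_fst hk x u).unique
      (h1.congr_of_eventuallyEq (Filter.Eventually.of_forall fun x => hk1 x u))).trans ?_
    ring
  have hk3 : ∀ x u, fderiv ℝ k (x, 0) (1, 0) * √(quarticA u a 1) +
      2 * α₀ * potentialAmp a u * Real.sin x = 0 := by
    intro x u
    have h1 := (hcoef x u).2.2.1.1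
    rw [(hlead x u).1, (hlead x u).2.1, hk2] at h1
    linear_combination h1
  have hk0 : ∀ x, fderiv ℝ k (x, 0) (1, 0) = 0 := fun x => by
    have h1 := hk3 x 0
    rw [potentialAmp_zero] at h1
    simpa [hBne] using h1
  -- On `u = 0` the potential vanishes, so `k` is constant there. A summand `α₀ p_φ²` is then
  -- excluded by the dependence of the potential on `φ`.
  have hα0 : α₀ = 0 := by
    have h1 := hk3 (Real.pi / 2) 1
    rw [hk0] at h1
    simpa [hh1] using h1
  refine ⟨γ, k (0, 0), fun w => ?_⟩
  have hkc : k (w.1 0, 0) = k (0, 0) :=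
    eq_of_hasDerivAt_eq (f := fun x => k (x, 0)) (f' := fun _ => 0)
      (fun x => by simpa [hk0] using hasDerivAt_slice_fst hk x 0)
      (fun x => hasDerivAt_const x (k (0, 0))) rfl (w.1 0)
  rw [hF, (hlead _ _).1, (hlead _ _).2.1, (hlead _ _).2.2, (hlin _ _).1, (hlin _ _).2, hk1, hkc,
    hm0, hα0, polarHamiltonian]
  ring

/-- A polynomial of degree at most two in two variables. -/
theorem exists_eval_eq_quadratic {P : MvPolynomial (Fin 2) ℝ} (hP : P.totalDegree ≤ 2) :
    ∃ A B C D E G : ℝ, ∀ p : Fin 2 → ℝ, MvPolynomial.eval p P =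
      A * p 0 ^ 2 + B * (p 0 * p 1) + C * p 1 ^ 2 + D * p 0 + E * p 1 + G := by
  let Q : ((Fin 2 → ℝ) → ℝ) → Prop := fun f => ∃ A B C D E G : ℝ, ∀ p : Fin 2 → ℝ, f p =
      A * p 0 ^ 2 + B * (p 0 * p 1) + C * p 1 ^ 2 + D * p 0 + E * p 1 + G
  have h : Q (∑ d ∈ P.support, fun p => P.coeff d * ∏ i, p i ^ d i) := by
    refine Finset.sum_induction _ Q ?_ ?_ ?_
    · rintro f g ⟨A, B, C, D, E, G, hf⟩ ⟨A', B', C', D', E', G', hg⟩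
      refine ⟨A + A', B + B', C + C', D + D', E + E', G + G', fun p => ?_⟩
      rw [Pi.add_apply, hf, hg]
      ring
    · exact ⟨0, 0, 0, 0, 0, 0, fun p => by simp⟩
    · intro d hd
      have h2 := (MvPolynomial.le_totalDegree hd).trans hP
      rw [Finsupp.sum_fintype _ _ fun _ => rfl, Fin.sum_univ_two] at h2
      simp only [Fin.prod_univ_two]
      generalize P.coeff d = r
      generalize d 0 = i at *
      generalize d 1 = j at *
      have hi : i ≤ 2 := by omega
      have hj : j ≤ 2 := by omega
      interval_cases i <;> interval_cases j
      · exact ⟨0, 0, 0, 0, 0, r, fun p => by simp⟩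
      · exact ⟨0, 0, 0, 0, r, 0, fun p => by simp⟩
      · exact ⟨0, 0, r, 0, 0, 0, fun p => by simp⟩
      · exact ⟨0, 0, 0, r, 0, 0, fun p => by simp⟩
      · exact ⟨0, r, 0, 0, 0, 0, fun p => by simp⟩
      · omega
      · exact ⟨r, 0, 0, 0, 0, 0, fun p => by simp⟩
      · omega
      · omega
  obtain ⟨A, B, C, D, E, G, h⟩ := h
  refine ⟨A, B, C, D, E, G, fun p => ?_⟩
  rw [MvPolynomial.eval_eq', ← h]
  simp

/-- The coefficients of a function of degree two in the momenta, recovered from its values. -/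
theorem pullback_eq_quadratic (ha : -2 < a) {F : PhaseFunction 2 S2}
    (hF : F.PolynomialInMomenta 2) (z : EuclideanSpace ℝ (Fin 2)) :
    ∃ A B C D E G : ℝ, ∀ p, F.pullback (polarMap a) (z, p) =
      A * p 0 ^ 2 + B * (p 0 * p 1) + C * p 1 ^ 2 + D * p 0 + E * p 1 + G := by
  let e := chartAt (EuclideanSpace ℝ (Fin 2)) (polarMap a z)
  have he : e ∈ atlas (EuclideanSpace ℝ (Fin 2)) S2 := chart_mem_atlas _ _
  have hz : polarMap a z ∈ e.source := mem_chart_source _ _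
  have hb := bijective_mfderiv_polarMap ha z
  have hP := contMDiff_polarMap ha
  let D := LinearEquiv.ofBijective (fderiv ℝ (e ∘ polarMap a) z).toLinearMap
    (S2.bijective_fderiv_chart_comp he hP hz hb)
  let T := LinearMap.adjoint (D.symm : EuclideanSpace ℝ (Fin 2) →ₗ[ℝ] EuclideanSpace ℝ (Fin 2))
  have hT : ∀ p, momentumPullback (e ∘ polarMap a) (z, T p) = p := by
    intro p
    refine ext_inner_right ℝ fun η => ?_
    rw [inner_momentumPullback, LinearMap.adjoint_inner_left]
    exact congrArg _ (D.symm_apply_apply η)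
  obtain ⟨P, hdeg, hP'⟩ := hF e he ((e ∘ polarMap a) z)
    (by rw [S2.target_eq_univ he]; trivial)
  obtain ⟨A, B, C, D', E, G, hQ⟩ := exists_eval_eq_quadratic hdeg
  have hTp : ∀ p i, T p i = p 0 * T (EuclideanSpace.single 0 1) i +
      p 1 * T (EuclideanSpace.single 1 1) i := by
    intro p i
    nth_rewrite 1 [← sum_smul_single p]
    simp [Fin.sum_univ_two]
  set s := T (EuclideanSpace.single 0 1)
  set t := T (EuclideanSpace.single 1 1)
  refine ⟨A * s 0 ^ 2 + B * (s 0 * s 1) + C * s 1 ^ 2,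
    2 * A * s 0 * t 0 + B * (s 0 * t 1 + s 1 * t 0) + 2 * C * s 1 * t 1,
    A * t 0 ^ 2 + B * (t 0 * t 1) + C * t 1 ^ 2, D' * s 0 + E * s 1, D' * t 0 + E * t 1, G,
    fun p => ?_⟩
  have h1 := S2.inChart_eq_pullback F he hP hz hb (T p)
  rw [hT] at h1
  rw [← h1, hP', hQ, hTp p 0, hTp p 1]
  ring

/-- There is no independent integral of degree at most two. -/
theorem ExtendsH1.everywhereDependent (ha : -2 < a) (ha2 : a ≠ 2) {S : ConservativeSystem 2 S2}
    (h : ExtendsH1 a S) {F : PhaseFunction 2 S2} (hF : S.IsFirstIntegral F)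
    (hF2 : F.PolynomialInMomenta 2) : F.EverywhereDependent S.hamiltonian := by
  have hP := contMDiff_polarMap ha
  have hb := bijective_mfderiv_polarMap ha
  have hH := h.smooth_hamiltonian ha
  have hbr := S2.canonicalBracket_pullback_eq_zero hF.1 hH hP hb hF.2
  rw [h.pullback_hamiltonian ha] at hbr
  have hsm := S2.contDiff_pullback hF.1 hP hb
  let f : ℝ → ℝ → ℝ × ℝ → ℝ := fun s t z => F.pullback (polarMap a) (!₂[z.1, z.2], !₂[s, t])
  have hf : ∀ s t, ContDiff ℝ ∞ (f s t) := by
    intro s t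
    refine hsm.comp (ContDiff.prodMk ?_ contDiff_const)
    rw [contDiff_euclidean]
    intro i
    fin_cases i
    · exact contDiff_fst
    · exact contDiff_snd
  -- The coefficients are finite differences of values of `F` at the momenta `0`, `±e₀`, `±e₁` and
  -- `e₀ + e₁`; this makes their smoothness evident.
  obtain ⟨γ, r, hγ⟩ := eq_of_canonicalBracket_eq_zero ha ha2
    (α := fun z => (f 1 0 z + f (-1) 0 z) / 2 - f 0 0 z)
    (b := fun z => (f 1 1 z - f 1 0 z - f 0 1 z + f 0 0 z) / 2)
    (c := fun z => (f 0 1 z + f 0 (-1) z) / 2 - f 0 0 z)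
    (m := fun z => (f 1 0 z - f (-1) 0 z) / 2)
    (n := fun z => (f 0 1 z - f 0 (-1) z) / 2)
    (k := f 0 0)
    ((((hf _ _).add (hf _ _)).div_const _).sub (hf _ _))
    (((((hf _ _).sub (hf _ _)).sub (hf _ _)).add (hf _ _)).div_const _)
    ((((hf _ _).add (hf _ _)).div_const _).sub (hf _ _))
    (((hf _ _).sub (hf _ _)).div_const _)
    (((hf _ _).sub (hf _ _)).div_const _) (hf _ _)
    (F := F.pullback (polarMap a)) (fun w => by
      have hw : !₂[w.1 0, w.1 1] = w.1 := by
        ext i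
        fin_cases i <;> rfl
      obtain ⟨A, B, C, D, E, G, hq⟩ := pullback_eq_quadratic ha hF2 w.1
      simp only [f, hw]
      have := hq w.2
      rw [Prod.mk.eta] at this
      simp only [this, hq]
      simp
      ring) hbr
  intro e he w _ hind
  have hD : Dense ((e.symm ⁻¹' Set.range (polarMap a)) ×ˢ
      (Set.univ : Set (EuclideanSpace ℝ (Fin 2)))) :=
    (dense_chart_preimage_range_polarMap ha e he).prod dense_univ
  have hFc := S2.contDiff_inChart hF.1 he
  have hHc := S2.contDiff_inChart hH he
  -- The relation `F = 2γH + r` holds over the polar coordinates and extends to the poles by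
  -- density. It makes `dF` a multiple of `dH` everywhere.
  have heq : F.inChart e = fun w => 2 * γ * S.hamiltonian.inChart e w + r := by
    refine Continuous.ext_on hD hFc.continuous
      ((continuous_const.mul hHc.continuous).add continuous_const) ?_
    rintro ⟨q, p⟩ ⟨⟨z, hz⟩, -⟩
    have hq : q ∈ e.target := by rw [S2.target_eq_univ he]; trivial
    have hzs : polarMap a z ∈ e.source := by rw [hz]; exact e.map_target hq
    have hqz : (e ∘ polarMap a) z = q := by rw [Function.comp_apply, hz, e.right_inv hq]
    simp only
    rw [← hqz, S2.inChart_eq_pullback F he hP hzs (hb z), S2.inChart_eq_pullback _ he hP hzs (hb z),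
      h.pullback_hamiltonian ha, hγ]
  have hfd : fderiv ℝ (F.inChart e) w = (2 * γ) • fderiv ℝ (S.hamiltonian.inChart e) w := by
    rw [heq]
    have hd := (hHc.differentiable (by simp) w).hasFDerivAt
    exact ((hd.const_mul (2 * γ)).add_const r).fderiv
  have h1 := (LinearIndependent.pair_iff.1 hind) 1 (-(2 * γ)) (by
    rw [hfd]
    simp)
  exact one_ne_zero h1.1

end Quartic

end

noncomputable section

/-! ## The round sphere -/

namespace S2

theorem hasFDerivAt_norm_sq_add (q : EuclideanSpace ℝ (Fin 2)) :
    HasFDerivAt (fun q : EuclideanSpace ℝ (Fin 2) => ‖q‖ ^ 2 + 4) (2 • innerSL ℝ q) q :=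
  (hasStrictFDerivAt_norm_sq q).hasFDerivAt.add_const 4

theorem pd_conformalFactor (i : Fin 2) (r : ℝ) (q : EuclideanSpace ℝ (Fin 2)) :
    SmoothMetric.pd i (fun q : EuclideanSpace ℝ (Fin 2) => 16 / (‖q‖ ^ 2 + 4) ^ 2 * r) q =
      -64 * q i / (‖q‖ ^ 2 + 4) ^ 3 * r := by
  have hpos : ‖q‖ ^ 2 + 4 ≠ 0 := by positivity
  have h := (((hasDerivAt_inv (pow_ne_zero 2 hpos)).comp_hasFDerivAt q
    ((hasFDerivAt_norm_sq_add q).pow 2)).const_mul 16).mul_const r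
  have e := congrArg (fun L : EuclideanSpace ℝ (Fin 2) →L[ℝ] ℝ => L (EuclideanSpace.single i 1))
    h.fderiv
  refine e.trans ?_
  simp [EuclideanSpace.inner_single_right]
  field_simp
  ring

/-- The functions in terms of which the Christoffel symbols of the round metric are expressed. -/
def roundCoeff (i : Fin 2) (q : EuclideanSpace ℝ (Fin 2)) : ℝ := -2 * q i / (‖q‖ ^ 2 + 4)

theorem hasFDerivAt_roundCoeff (i : Fin 2) (q : EuclideanSpace ℝ (Fin 2)) :
    ∃ L : EuclideanSpace ℝ (Fin 2) →L[ℝ] ℝ, HasFDerivAt (roundCoeff i) L q ∧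
      ∀ m, L (EuclideanSpace.single m 1) = -2 * (if i = m then 1 else 0) / (‖q‖ ^ 2 + 4) +
        4 * q i * q m / (‖q‖ ^ 2 + 4) ^ 2 := by
  have hpos : ‖q‖ ^ 2 + 4 ≠ 0 := by positivity
  have h := ((EuclideanSpace.proj (𝕜 := ℝ) i : EuclideanSpace ℝ (Fin 2) →L[ℝ] ℝ).hasFDerivAt
    (x := q)).const_mul (-2) |>.mul ((hasDerivAt_inv hpos).comp_hasFDerivAt q
      (hasFDerivAt_norm_sq_add q))
  refine ⟨_, h, fun m => ?_⟩
  simp [EuclideanSpace.inner_single_right]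
  split_ifs <;> field_simp <;> ring

theorem conformalMetric_gram {f : S2 → ℝ} (hf : ContMDiff (𝓡 2) 𝓘(ℝ, ℝ) ∞ f)
    (hpos : ∀ x, 0 < f x) {e : OpenPartialHomeomorph S2 (EuclideanSpace ℝ (Fin 2))}
    (he : e ∈ atlas (EuclideanSpace ℝ (Fin 2)) S2) (q : EuclideanSpace ℝ (Fin 2)) (i j : Fin 2) :
    SmoothMetric.gram (conformalMetric f hf hpos) e q i j =
      f (e.symm q) * (16 / (‖q‖ ^ 2 + 4) ^ 2 * if i = j then 1 else 0) := by
  refine (conformalMetric_inner f hf hpos _ _ _).trans ?_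
  refine (congrArg (f (e.symm q) * ·) ((congrArg₂ (inner ℝ) (dcoe_mfderiv_symm he q _)
      (dcoe_mfderiv_symm he q _)).trans (inner_fderiv_chartInv he q _ _))).trans ?_
  simp [EuclideanSpace.inner_single_right, eq_comm]

/-- The metric in a chart is `λ δᵢⱼ` with `λ = 16 / (‖q‖² + 4)²`. With `σ = ½ log λ` its Christoffel
symbols are `σᵢ δⱼₖ + σⱼ δᵢₖ - σₖ δᵢⱼ`, where `σᵢ` is `roundCoeff i`; the curvature components are
then checked index by index. -/
theorem hasConstantCurvature_one {f : S2 → ℝ} (hf : ContMDiff (𝓡 2) 𝓘(ℝ, ℝ) ∞ f)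
    (hpos : ∀ x, 0 < f x) (h1 : ∀ x, f x = 1) :
    SmoothMetric.HasConstantCurvature (conformalMetric f hf hpos) 1 := by
  intro e he q _ l k i j
  have hg : ∀ q i j, SmoothMetric.gram (conformalMetric f hf hpos) e q i j =
      16 / (‖q‖ ^ 2 + 4) ^ 2 * if i = j then 1 else 0 := fun q i j => by
    rw [conformalMetric_gram hf hpos he, h1, one_mul]
  have hginv : ∀ q, (SmoothMetric.gram (conformalMetric f hf hpos) e q)⁻¹ =
      ((‖q‖ ^ 2 + 4) ^ 2 / 16) • (1 : Matrix (Fin 2) (Fin 2) ℝ) := by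
    intro q
    have hpos : ‖q‖ ^ 2 + 4 ≠ 0 := by positivity
    refine Matrix.inv_eq_right_inv ?_
    have : SmoothMetric.gram (conformalMetric f hf ‹_›) e q =
        (16 / (‖q‖ ^ 2 + 4) ^ 2) • (1 : Matrix (Fin 2) (Fin 2) ℝ) := by
      ext i j
      rw [hg, Matrix.smul_apply, Matrix.one_apply, smul_eq_mul]
    rw [this, Matrix.smul_mul, one_mul, smul_smul]
    field_simp
    simp
  have hchr : ∀ k i j, SmoothMetric.christoffel (conformalMetric f hf hpos) e k i j = fun q =>
      roundCoeff i q * (if j = k then 1 else 0) + roundCoeff j q * (if i = k then 1 else 0) -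
        roundCoeff k q * (if i = j then 1 else 0) := by
    intro k i j
    funext q
    have hpos : ‖q‖ ^ 2 + 4 ≠ 0 := by positivity
    unfold SmoothMetric.christoffel
    simp only [hg, hginv, pd_conformalFactor, roundCoeff, Matrix.smul_apply, Matrix.one_apply,
      smul_eq_mul]
    rw [Finset.sum_eq_single k (fun l _ hl => by simp [hl.symm]) (by simp)]
    simp only [if_true]
    field_simp
    ring
  have hpd : ∀ m k i j, SmoothMetric.pd m
      (SmoothMetric.christoffel (conformalMetric f hf hpos) e k i j) q =
      (-2 * (if i = m then 1 else 0) / (‖q‖ ^ 2 + 4) + 4 * q i * q m / (‖q‖ ^ 2 + 4) ^ 2) *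
        (if j = k then 1 else 0) +
      (-2 * (if j = m then 1 else 0) / (‖q‖ ^ 2 + 4) + 4 * q j * q m / (‖q‖ ^ 2 + 4) ^ 2) *
        (if i = k then 1 else 0) -
      (-2 * (if k = m then 1 else 0) / (‖q‖ ^ 2 + 4) + 4 * q k * q m / (‖q‖ ^ 2 + 4) ^ 2) *
        (if i = j then 1 else 0) := by
    intro m k i j
    obtain ⟨Li, hi, hi'⟩ := hasFDerivAt_roundCoeff i q
    obtain ⟨Lj, hj, hj'⟩ := hasFDerivAt_roundCoeff j q
    obtain ⟨Lk, hk, hk'⟩ := hasFDerivAt_roundCoeff k q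
    have h := ((hi.mul_const (if j = k then (1 : ℝ) else 0)).add
      (hj.mul_const (if i = k then (1 : ℝ) else 0))).sub
      (hk.mul_const (if i = j then (1 : ℝ) else 0))
    rw [hchr]
    refine (congrArg (fun L : EuclideanSpace ℝ (Fin 2) →L[ℝ] ℝ =>
      L (EuclideanSpace.single m 1)) h.fderiv).trans ?_
    simp only [← hi', ← hj', ← hk']
    change (if j = k then (1 : ℝ) else 0) * Li _ + (if i = k then (1 : ℝ) else 0) * Lj _ -
      (if i = j then (1 : ℝ) else 0) * Lk _ = _
    ring
  have hN : ‖q‖ ^ 2 = q 0 ^ 2 + q 1 ^ 2 := by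
    rw [EuclideanSpace.real_norm_sq_eq, Fin.sum_univ_two]
  unfold SmoothMetric.riemann
  simp only [hpd]
  simp only [hg, hchr, Fin.sum_univ_two, roundCoeff]
  have hpos : q 0 ^ 2 + q 1 ^ 2 + 4 ≠ 0 := by positivity
  rw [hN]
  fin_cases l <;> fin_cases k <;> fin_cases i <;> fin_cases j <;> simp <;>
    try (field_simp; ring)

end S2

/-! ### The parameter value `a = 2`. -/

theorem conformalY_two (u : ℝ) : conformalY 2 u = Real.arsinh u := by
  refine eq_of_hasDerivAt_eq (fun u => hasDerivAt_conformalY' (by norm_num) u) (fun u => ?_)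
    (by simp [conformalY]) u
  convert! Real.hasDerivAt_arsinh u using 2
  have h4 := quarticRoot_pow_four (a := 2) (by norm_num) u
  have hp := quarticRoot_pos (a := 2) (by norm_num) u
  refine (Real.sqrt_eq_iff_mul_self_eq (by positivity) hp.le).2 ?_ |>.symm
  have hq : quarticA u 2 1 = (1 + u ^ 2) ^ 2 := by rw [quarticA]; ring
  rw [hq] at h4
  nlinarith [sq_nonneg u, sq_nonneg (quarticRoot 2 u)]

theorem sqrt_quarticA_two (u : ℝ) : √(quarticA u 2 1) = 1 + u ^ 2 := by
  rw [show quarticA u 2 1 = (1 + u ^ 2) ^ 2 by rw [quarticA]; ring, Real.sqrt_sq (by positivity)]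

theorem ExtendsH1.potential_eq_zero {S : ConservativeSystem 2 S2} (h : ExtendsH1 2 S) (x : S2) :
    S.potential x = 0 := by
  refine congrFun ((denseRange_polarParam (a := 2) (by norm_num)).equalizer
    S.potential_smooth.continuous continuous_const (funext fun z => ?_)) x
  rw [Function.comp_apply, h.potential_eq, sqrt_quarticA_two]
  simp only [Function.comp_apply]
  ring

theorem ExtendsH1.hasConstantCurvature {S : ConservativeSystem 2 S2} (h : ExtendsH1 2 S) :
    SmoothMetric.HasConstantCurvature S.metric 1 := by
  have h2 : (-2 : ℝ) < 2 := by norm_num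
  obtain ⟨f, hf, hpos, hS⟩ := h.exists_conformal h2
  have h1 : ∀ x, f x = 1 := by
    refine congrFun ((denseRange_polarParam h2).equalizer hf.continuous continuous_const
      (funext fun z => ?_))
    have hz := h.metric_eq z (1, 0) (1, 0)
    rw [hS, S2.conformalMetric_inner, dcoe_mfderiv_polarParam h2, inner_fderiv_polarParam h2,
      sqrt_quarticA_two, conformalY_two, Real.cosh_arsinh, Real.sq_sqrt (by positivity)] at hz
    have : (1 : ℝ) + z.2 ^ 2 ≠ 0 := by positivity
    simp only [Function.comp_apply]
    field_simp at hz
    simpa using hz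
  rw [hS]
  exact S2.hasConstantCurvature_one hf hpos h1

end

noncomputable section

/-! ## Hessians at critical points -/

section SecondDerivative

variable {E F : Type*} [NormedAddCommGroup E] [NormedSpace ℝ E] [NormedAddCommGroup F]
  [NormedSpace ℝ F]

/-- The second-order chain rule has one more term, the first derivative of `f` applied to the second
derivative of `ψ`; it vanishes at a critical point. This is why Hessians at critical points are
invariants. -/
theorem fderiv_fderiv_comp_of_fderiv_eq_zero {f : F → ℝ} (hf : ContDiff ℝ ∞ f) {ψ : E → F} {z : E}
    (hψ : ContDiffAt ℝ ∞ ψ z) (h0 : fderiv ℝ f (ψ z) = 0) (v w : E) :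
    fderiv ℝ (fderiv ℝ fun z => f (ψ z)) z v w =
      fderiv ℝ (fderiv ℝ f) (ψ z) (fderiv ℝ ψ z v) (fderiv ℝ ψ z w) := by
  have hev : (fderiv ℝ fun z => f (ψ z)) =ᶠ[nhds z]
      fun y => (fderiv ℝ f (ψ y)).comp (fderiv ℝ ψ y) := by
    filter_upwards [(contDiffAt_infty.1 hψ 2).eventually (by simp)] with y hy
    exact fderiv_comp y (hf.differentiable (by simp) _) (hy.differentiableAt (by simp))
  have h1 : HasFDerivAt (fun y => fderiv ℝ f (ψ y)) _ z :=
    (((hf.fderiv_right (m := ∞) (by simp)).differentiable (by simp)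
      (ψ z)).hasFDerivAt).comp z (hψ.differentiableAt (by simp)).hasFDerivAt
  have h2 := (((hψ.fderiv_right (m := ∞) (by simp)).differentiableAt (by simp))).hasFDerivAt
  rw [hev.fderiv_eq, (h1.clm_comp h2).fderiv, h0]
  simp

end SecondDerivative

namespace ConservativeSystem

variable {S : ConservativeSystem 2 S2}

/-- `x` is a critical point of the potential. -/
def IsCritical (S : ConservativeSystem 2 S2) (x : S2) : Prop :=
  mfderiv (𝓡 2) 𝓘(ℝ, ℝ) S.potential x = 0

/-- In the parametrization `P`, `α` is an eigenvalue at the point `z` of the Hessian of the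
potential with respect to the metric. -/
def IsHessianEigenvalue (S : ConservativeSystem 2 S2) (P : EuclideanSpace ℝ (Fin 2) → S2)
    (z : EuclideanSpace ℝ (Fin 2)) (α : ℝ) : Prop :=
  ∃ v : EuclideanSpace ℝ (Fin 2), v ≠ 0 ∧ ∀ w : EuclideanSpace ℝ (Fin 2),
    fderiv ℝ (fderiv ℝ fun z => S.potential (P z)) z v w =
      α * S.metric.inner (P z) (mfderiv (𝓡 2) (𝓡 2) P z v) (mfderiv (𝓡 2) (𝓡 2) P z w)

section Parametrization

variable {P : EuclideanSpace ℝ (Fin 2) → S2} {z : EuclideanSpace ℝ (Fin 2)}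

theorem fderiv_potential_comp (hP : ContMDiff (𝓡 2) (𝓡 2) ∞ P) (z v : EuclideanSpace ℝ (Fin 2)) :
    fderiv ℝ (fun z => S.potential (P z)) z v =
      mfderiv (𝓡 2) 𝓘(ℝ, ℝ) S.potential (P z) (mfderiv (𝓡 2) (𝓡 2) P z v) := by
  rw [← mfderiv_eq_fderiv]
  have := mfderiv_comp z ((S.potential_smooth (P z)).mdifferentiableAt (by simp))
    ((hP z).mdifferentiableAt (by simp))
  exact congrArg (fun L : EuclideanSpace ℝ (Fin 2) →L[ℝ] ℝ => L v) this

theorem isCritical_iff (hP : ContMDiff (𝓡 2) (𝓡 2) ∞ P)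
    (hb : Function.Bijective (mfderiv (𝓡 2) (𝓡 2) P z)) :
    S.IsCritical (P z) ↔ fderiv ℝ (fun z => S.potential (P z)) z = 0 := by
  constructor
  · intro h
    ext1 v
    rw [fderiv_potential_comp hP]
    exact congrArg (fun L : EuclideanSpace ℝ (Fin 2) →L[ℝ] ℝ => L (mfderiv (𝓡 2) (𝓡 2) P z v)) h
  · intro h
    refine ContinuousLinearMap.ext fun v => ?_
    obtain ⟨v, rfl⟩ := hb.2 v
    refine (fderiv_potential_comp hP z v).symm.trans ?_
    rw [h]
    rfl

theorem inner_congr_point (g : SmoothMetric 2 S2) {x y : S2} (h : x = y)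
    (v w : EuclideanSpace ℝ (Fin 2)) : g.inner x v w = g.inner y v w := by
  subst h
  rfl

theorem isHessianEigenvalue_chart {e : OpenPartialHomeomorph S2 (EuclideanSpace ℝ (Fin 2))}
    (he : e ∈ atlas (EuclideanSpace ℝ (Fin 2)) S2) (hP : ContMDiff (𝓡 2) (𝓡 2) ∞ P)
    (hz : P z ∈ e.source) (hb : Function.Bijective (mfderiv (𝓡 2) (𝓡 2) P z))
    (hcrit : S.IsCritical (P z)) (α : ℝ) :
    S.IsHessianEigenvalue P z α ↔ S.IsHessianEigenvalue e.symm (e (P z)) α := by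
  have hψ := S2.contDiffAt_chart_comp he hP hz
  have hDb := S2.bijective_fderiv_chart_comp he hP hz hb
  have hf := S2.contDiff_comp_chart_symm S.potential_smooth he
  have hev : (fun y => S.potential (P y)) =ᶠ[nhds z]
      fun y => S.potential (e.symm ((e ∘ P) y)) := by
    filter_upwards [hP.continuous.continuousAt.eventually (e.open_source.mem_nhds hz)] with y hy
    rw [Function.comp_apply, e.left_inv hy]
  have h0 : fderiv ℝ (fun q => S.potential (e.symm q)) ((e ∘ P) z) = 0 := by
    have h1 := (isCritical_iff hP hb).1 hcrit
    rw [hev.fderiv_eq] at h1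
    have h2 := fderiv_comp z (hf.differentiable (by simp) ((e ∘ P) z))
      (hψ.differentiableAt (by simp))
    ext1 v
    obtain ⟨v, rfl⟩ := hDb.2 v
    have h3 := congrArg (fun L : EuclideanSpace ℝ (Fin 2) →L[ℝ] ℝ => L v) (h2.symm.trans h1)
    exact h3
  have hD2 : ∀ v w, fderiv ℝ (fderiv ℝ fun y => S.potential (P y)) z v w =
      fderiv ℝ (fderiv ℝ fun q => S.potential (e.symm q)) (e (P z))
        (fderiv ℝ (e ∘ P) z v) (fderiv ℝ (e ∘ P) z w) := by
    intro v w
    rw [hev.fderiv.fderiv_eq]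
    exact fderiv_fderiv_comp_of_fderiv_eq_zero hf hψ h0 v w
  have hdP : ∀ v : EuclideanSpace ℝ (Fin 2),
      mfderiv (𝓡 2) (𝓡 2) e.symm (e (P z)) (fderiv ℝ (e ∘ P) z v) =
        mfderiv (𝓡 2) (𝓡 2) P z v := by
    intro v
    refine (congrArg (mfderiv (𝓡 2) (𝓡 2) e.symm (e (P z)))
      (S2.fderiv_chart_comp he hP hz v)).trans ?_
    have h := (S2.mdifferentiable_chart he).symm_comp_deriv hz
    exact congrArg (fun L : TangentSpace (𝓡 2) (P z) →L[ℝ] TangentSpace (𝓡 2) (P z) =>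
      L (mfderiv (𝓡 2) (𝓡 2) P z v)) h
  have hg : ∀ v w : EuclideanSpace ℝ (Fin 2),
      S.metric.inner (P z) (mfderiv (𝓡 2) (𝓡 2) P z v) (mfderiv (𝓡 2) (𝓡 2) P z w) =
      S.metric.inner (e.symm (e (P z)))
        (mfderiv (𝓡 2) (𝓡 2) e.symm (e (P z)) (fderiv ℝ (e ∘ P) z v))
        (mfderiv (𝓡 2) (𝓡 2) e.symm (e (P z)) (fderiv ℝ (e ∘ P) z w)) := by
    intro v w
    refine (inner_congr_point S.metric (e.left_inv hz).symm _ _).trans ?_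
    exact (congrArg₂ (fun v w : EuclideanSpace ℝ (Fin 2) =>
      S.metric.inner (e.symm (e (P z))) v w) (hdP v) (hdP w)).symm
  constructor
  · rintro ⟨v, hv, h⟩
    refine ⟨fderiv ℝ (e ∘ P) z v, fun h' => hv (hDb.1 (h'.trans (map_zero _).symm)), fun w => ?_⟩
    obtain ⟨w, rfl⟩ := hDb.2 w
    rw [← hD2, h, hg]
  · rintro ⟨v, hv, h⟩
    obtain ⟨v, rfl⟩ := hDb.2 v
    refine ⟨v, ?_, fun w => ?_⟩
    · rintro rfl
      exact hv (map_zero _)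
    · rw [hD2, h, hg]

/-- The eigenvalues of the Hessian do not depend on the parametrization. -/
theorem isHessianEigenvalue_congr {P' : EuclideanSpace ℝ (Fin 2) → S2}
    {z' : EuclideanSpace ℝ (Fin 2)} (hP : ContMDiff (𝓡 2) (𝓡 2) ∞ P)
    (hb : Function.Bijective (mfderiv (𝓡 2) (𝓡 2) P z)) (hP' : ContMDiff (𝓡 2) (𝓡 2) ∞ P')
    (hb' : Function.Bijective (mfderiv (𝓡 2) (𝓡 2) P' z')) (h : P z = P' z')
    (hcrit : S.IsCritical (P z)) (α : ℝ) :
    S.IsHessianEigenvalue P z α ↔ S.IsHessianEigenvalue P' z' α := by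
  have he := chart_mem_atlas (EuclideanSpace ℝ (Fin 2)) (P z)
  rw [isHessianEigenvalue_chart he hP (mem_chart_source _ _) hb hcrit,
    isHessianEigenvalue_chart he hP' (by rw [← h]; exact mem_chart_source _ _) hb'
      (by rw [← h]; exact hcrit), h]

end Parametrization

/-! ### Equivalent systems -/

theorem exists_forall_eq {G B : EuclideanSpace ℝ (Fin 2) →L[ℝ] EuclideanSpace ℝ (Fin 2) →L[ℝ] ℝ}
    (hG : ∀ v, v ≠ 0 → 0 < G v v) (v : EuclideanSpace ℝ (Fin 2)) : ∃ u, ∀ y, G u y = B v y := by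
  let f : EuclideanSpace ℝ (Fin 2) →ₗ[ℝ] (EuclideanSpace ℝ (Fin 2) →L[ℝ] ℝ) := G.toLinearMap
  have hinj : Function.Injective f := by
    rw [injective_iff_map_eq_zero]
    intro v hv
    by_contra h
    have h1 := hG v h
    have h2 : G v = 0 := hv
    rw [h2] at h1
    simp at h1
  have hd : Module.finrank ℝ (EuclideanSpace ℝ (Fin 2)) =
      Module.finrank ℝ (EuclideanSpace ℝ (Fin 2) →L[ℝ] ℝ) :=
    ((InnerProductSpace.toDual ℝ (EuclideanSpace ℝ (Fin 2))).toLinearEquiv).finrank_eq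
  obtain ⟨u, hu⟩ := (LinearMap.injective_iff_surjective_of_finrank_eq_finrank hd).1 hinj (B v)
  exact ⟨u, fun y => congrArg (fun L : EuclideanSpace ℝ (Fin 2) →L[ℝ] ℝ => L y) hu⟩

/-- Two scalar products whose dual quadratic forms are proportional are proportional. -/
theorem eq_mul_of_dual_eq_mul
    {G B : EuclideanSpace ℝ (Fin 2) →L[ℝ] EuclideanSpace ℝ (Fin 2) →L[ℝ] ℝ}
    (hG : ∀ v, v ≠ 0 → 0 < G v v) (hB : ∀ v, v ≠ 0 → 0 < B v v) (hGs : ∀ v w, G v w = G w v)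
    (hBs : ∀ v w, B v w = B w v) {κ : ℝ}
    (h : ∀ v u, (∀ y, G u y = B v y) → B v v = κ * G u u) (v y : EuclideanSpace ℝ (Fin 2)) :
    G v y = κ * B v y := by
  have hpol : ∀ v u w t, (∀ y, G u y = B v y) → (∀ y, G t y = B w y) → B v w = κ * G u t := by
    intro v u w t hu ht
    have h1 := h v u hu
    have h2 := h w t ht
    have h3 := h (v + w) (u + t) fun y => by simp [hu, ht]
    simp only [map_add, _root_.add_apply] at h3
    rw [hBs w v, hGs t u] at h3
    linear_combination (h3 - h1 - h2) / 2
  obtain ⟨u, hu⟩ := exists_forall_eq (G := G) (B := B) hG v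
  -- `w` is the vector whose dual is `v - κ u`. The polarised hypothesis `hpol` then gives `G(v - κ
  -- u, v - κ u) = 0`.
  obtain ⟨w, hw⟩ := exists_forall_eq (G := B) (B := G) hB (v - κ • u)
  have hd : v - κ • u = 0 := by
    by_contra hne
    have h1 := hpol v u w (v - κ • u) hu fun y => (hw y).symm
    rw [hBs, hw, hGs u] at h1
    have h2 := hG _ hne
    have h3 : G (v - κ • u) (v - κ • u) = G (v - κ • u) v - κ * G (v - κ • u) u := by
      conv_lhs => rw [map_sub (G (v - κ • u)), map_smul, smul_eq_mul]
    linarith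
  rw [← hu]
  rw [sub_eq_zero] at hd
  conv_lhs => rw [hd, map_smul, _root_.smul_apply, smul_eq_mul]

variable {S₁ S₂ : ConservativeSystem 2 S2}

/-- Proportional kinetic energies mean proportional metrics, with the factor on the other side.
Positivity of both metrics forces `κ > 0`; the sign of `κ'` stays free. -/
theorem Equivalent.exists_isometry (h : S₁.Equivalent S₂) :
    ∃ (φ : S2 ≃ₘ^∞⟮𝓡 2, 𝓡 2⟯ S2) (κ κ' : ℝ), 0 < κ ∧ κ' ≠ 0 ∧
      (∀ (x : S2) (v w : TangentSpace (𝓡 2) x), S₂.metric.inner x v w =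
        κ * S₁.metric.inner (φ x) (mfderiv (𝓡 2) (𝓡 2) φ x v) (mfderiv (𝓡 2) (𝓡 2) φ x w)) ∧
      ∀ x : S2, S₁.potential (φ x) = κ' * S₂.potential x := by
  obtain ⟨φ, κ, κ', hκ, hκ', hK, hU⟩ := h
  have hinj : ∀ x, Function.Injective (mfderiv (𝓡 2) (𝓡 2) φ x) := fun x =>
    (φ.mfderivToContinuousLinearEquiv (by simp) x).injective
  have key : ∀ (x : S2) (v w : TangentSpace (𝓡 2) x), S₂.metric.inner x v w =
      κ * S₁.metric.inner (φ x) (mfderiv (𝓡 2) (𝓡 2) φ x v) (mfderiv (𝓡 2) (𝓡 2) φ x w) := by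
    intro x
    let D : EuclideanSpace ℝ (Fin 2) →L[ℝ] EuclideanSpace ℝ (Fin 2) := mfderiv (𝓡 2) (𝓡 2) φ x
    let g₁ : EuclideanSpace ℝ (Fin 2) →L[ℝ] EuclideanSpace ℝ (Fin 2) →L[ℝ] ℝ :=
      S₁.metric.inner (φ x)
    let B : EuclideanSpace ℝ (Fin 2) →L[ℝ] EuclideanSpace ℝ (Fin 2) →L[ℝ] ℝ :=
      g₁.bilinearComp D D
    refine eq_mul_of_dual_eq_mul (G := S₂.metric.inner x) (B := B) (S₂.metric.pos x)
      (fun v hv => S₁.metric.pos (φ x) (D v) fun h0 => hv (hinj x (h0.trans (map_zero _).symm)))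
      (S₂.metric.symm x) (fun v w => S₁.metric.symm (φ x) (D v) (D w)) ?_
    intro v u hu
    have h1 := hK x (S₁.metric.inner (φ x) (D v))
    have h2 : (S₁.metric.inner (φ x) (D v)).comp (mfderiv (𝓡 2) (𝓡 2) φ x) =
        S₂.metric.inner x u := ContinuousLinearMap.ext fun y => (hu y).symm
    rw [h2] at h1
    have h3 := (SmoothMetric.kinetic_inner S₁.metric (φ x) (D v)).symm.trans
      (h1.trans (congrArg (κ * ·) (SmoothMetric.kinetic_inner S₂.metric x u)))
    change S₁.metric.inner (φ x) (D v) (D v) = _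
    linear_combination 2 * h3
  refine ⟨φ, κ, κ', ?_, hκ', key, hU⟩
  let x : S2 := ⟨EuclideanSpace.single 0 1, by simp⟩
  let v : EuclideanSpace ℝ (Fin 2) := EuclideanSpace.single 0 1
  have hv : v ≠ 0 := fun h => by simpa [v] using congrArg (fun w : EuclideanSpace ℝ (Fin 2) => w 0) h
  have h1 := key x v v
  have h2 := S₂.metric.pos x v hv
  have h3 := S₁.metric.pos (φ x) (mfderiv (𝓡 2) (𝓡 2) φ x v)
    fun h0 => hv (hinj x (h0.trans (map_zero _).symm))
  rw [h1] at h2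
  exact pos_of_mul_pos_left h2 h3.le

section Diffeomorphism

variable (φ : S2 ≃ₘ^∞⟮𝓡 2, 𝓡 2⟯ S2) {κ κ' : ℝ} {P : EuclideanSpace ℝ (Fin 2) → S2}

theorem bijective_mfderiv_diffeomorph_comp (hP : ContMDiff (𝓡 2) (𝓡 2) ∞ P)
    {z : EuclideanSpace ℝ (Fin 2)} (hb : Function.Bijective (mfderiv (𝓡 2) (𝓡 2) P z)) :
    Function.Bijective (mfderiv (𝓡 2) (𝓡 2) (φ ∘ P) z) := by
  have h := mfderiv_comp z ((φ.contMDiff (P z)).mdifferentiableAt (by simp))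
    ((hP z).mdifferentiableAt (by simp))
  rw [h]
  exact (φ.mfderivToContinuousLinearEquiv (by simp) (P z)).bijective.comp hb

theorem isCritical_diffeomorph (hκ' : κ' ≠ 0)
    (hU : ∀ x : S2, S₁.potential (φ x) = κ' * S₂.potential x) (x : S2) :
    S₁.IsCritical (φ x) ↔ S₂.IsCritical x := by
  let e := chartAt (EuclideanSpace ℝ (Fin 2)) x
  have he : e ∈ atlas (EuclideanSpace ℝ (Fin 2)) S2 := chart_mem_atlas _ _
  have hP : ContMDiff (𝓡 2) (𝓡 2) ∞ e.symm := by
    have h := contMDiffOn_symm_of_mem_maximalAtlas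
      (IsManifold.subset_maximalAtlas (I := 𝓡 2) (n := ∞) he)
    rwa [S2.target_eq_univ he, contMDiffOn_univ] at h
  have hb : Function.Bijective (mfderiv (𝓡 2) (𝓡 2) e.symm (e x)) :=
    ⟨Function.LeftInverse.injective (S2.mfderiv_chart_symm he (e x)),
      fun v => S2.exists_mfderiv_symm_eq he (e x) v⟩
  have hx : e.symm (e x) = x := e.left_inv (mem_chart_source _ _)
  have h1 := isCritical_iff (S := S₂) hP hb
  have h2 := isCritical_iff (S := S₁) (φ.contMDiff.comp hP)
    (bijective_mfderiv_diffeomorph_comp φ hP hb)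
  simp only [Function.comp_apply, hU] at h2
  rw [hx] at h1 h2
  rw [h1, h2]
  have hd := (S2.contDiff_comp_chart_symm S₂.potential_smooth he).differentiable (by simp) (e x)
  rw [fderiv_const_mul hd, smul_eq_zero_iff_right hκ']

/-- The second derivative of the potential is multiplied by `κ'` and the metric by `κ⁻¹`, so
relative eigenvalues are multiplied by `κ κ'`. -/
theorem isHessianEigenvalue_diffeomorph
    (hg : ∀ (x : S2) (v w : TangentSpace (𝓡 2) x), S₂.metric.inner x v w =
      κ * S₁.metric.inner (φ x) (mfderiv (𝓡 2) (𝓡 2) φ x v) (mfderiv (𝓡 2) (𝓡 2) φ x w))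
    (hκ' : κ' ≠ 0) (hU : ∀ x : S2, S₁.potential (φ x) = κ' * S₂.potential x)
    (hP : ContMDiff (𝓡 2) (𝓡 2) ∞ P) (z : EuclideanSpace ℝ (Fin 2)) (α : ℝ) :
    S₁.IsHessianEigenvalue (φ ∘ P) z (κ * κ' * α) ↔ S₂.IsHessianEigenvalue P z α := by
  have hUP : ContDiff ℝ ∞ fun z => S₂.potential (P z) := (S₂.potential_smooth.comp hP).contDiff
  have hD2 : ∀ v w, fderiv ℝ (fderiv ℝ fun z => S₁.potential ((φ ∘ P) z)) z v w =
      κ' * fderiv ℝ (fderiv ℝ fun z => S₂.potential (P z)) z v w := by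
    intro v w
    simp only [Function.comp_apply, hU]
    have h1 : (fderiv ℝ fun z => κ' * S₂.potential (P z)) =
        fun z => κ' • fderiv ℝ (fun z => S₂.potential (P z)) z :=
      funext fun z => fderiv_const_mul (hUP.differentiable (by simp) z) κ'
    rw [h1, fderiv_fun_const_smul
      (((hUP.fderiv_right (m := ∞) (by simp)).differentiable (by simp)) z)]
    rfl
  have hinner : ∀ v w : EuclideanSpace ℝ (Fin 2),
      S₂.metric.inner (P z) (mfderiv (𝓡 2) (𝓡 2) P z v) (mfderiv (𝓡 2) (𝓡 2) P z w) =
      κ * S₁.metric.inner ((φ ∘ P) z) (mfderiv (𝓡 2) (𝓡 2) (φ ∘ P) z v)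
        (mfderiv (𝓡 2) (𝓡 2) (φ ∘ P) z w) := by
    intro v w
    have h := mfderiv_comp z ((φ.contMDiff (P z)).mdifferentiableAt (by simp))
      ((hP z).mdifferentiableAt (by simp))
    rw [hg]
    have h' : ∀ v : EuclideanSpace ℝ (Fin 2), mfderiv (𝓡 2) (𝓡 2) (φ ∘ P) z v =
        mfderiv (𝓡 2) (𝓡 2) φ (P z) (mfderiv (𝓡 2) (𝓡 2) P z v) := fun v =>
      congrArg (fun L : EuclideanSpace ℝ (Fin 2) →L[ℝ] EuclideanSpace ℝ (Fin 2) => L v) h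
    exact (congrArg₂ (fun v w : EuclideanSpace ℝ (Fin 2) =>
      κ * S₁.metric.inner ((φ ∘ P) z) v w) (h' v) (h' w)).symm
  refine exists_congr fun v => and_congr_right fun _ => forall_congr' fun w => ?_
  rw [hD2, hinner, ← mul_assoc, show κ * κ' * α = κ' * (α * κ) by ring, mul_assoc κ']
  exact mul_right_inj' hκ'

end Diffeomorphism

end ConservativeSystem

end

noncomputable section

/-! ## Critical points of the potential of the family -/

section ProductCosine

variable {f f' f'' : ℝ → ℝ}

theorem fderiv_mul_cos (hf : ∀ u, HasDerivAt f (f' u) u) (z : EuclideanSpace ℝ (Fin 2)) :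
    fderiv ℝ (fun z : EuclideanSpace ℝ (Fin 2) => f (z 1) * Real.cos (z 0)) z =
      (f' (z 1) * Real.cos (z 0)) • (EuclideanSpace.proj 1 : EuclideanSpace ℝ (Fin 2) →L[ℝ] ℝ) -
        (f (z 1) * Real.sin (z 0)) • (EuclideanSpace.proj 0 : EuclideanSpace ℝ (Fin 2) →L[ℝ] ℝ) := by
  have h0 := (EuclideanSpace.proj (𝕜 := ℝ) (0 : Fin 2) :
    EuclideanSpace ℝ (Fin 2) →L[ℝ] ℝ).hasFDerivAt (x := z)
  have h1 := (EuclideanSpace.proj (𝕜 := ℝ) (1 : Fin 2) :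
    EuclideanSpace ℝ (Fin 2) →L[ℝ] ℝ).hasFDerivAt (x := z)
  have h := ((hf (z 1)).comp_hasFDerivAt z h1).mul
    ((Real.hasDerivAt_cos (z 0)).comp_hasFDerivAt z h0)
  refine h.fderiv.trans ?_
  ext v
  simp
  ring

theorem fderiv_fderiv_mul_cos (hf : ∀ u, HasDerivAt f (f' u) u)
    (hf' : ∀ u, HasDerivAt f' (f'' u) u) (z v w : EuclideanSpace ℝ (Fin 2)) :
    fderiv ℝ (fderiv ℝ fun z : EuclideanSpace ℝ (Fin 2) => f (z 1) * Real.cos (z 0)) z v w =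
      (f'' (z 1) * Real.cos (z 0) * v 1 - f' (z 1) * Real.sin (z 0) * v 0) * w 1 -
        (f' (z 1) * Real.sin (z 0) * v 1 + f (z 1) * Real.cos (z 0) * v 0) * w 0 := by
  have h0 := (EuclideanSpace.proj (𝕜 := ℝ) (0 : Fin 2) :
    EuclideanSpace ℝ (Fin 2) →L[ℝ] ℝ).hasFDerivAt (x := z)
  have h1 := (EuclideanSpace.proj (𝕜 := ℝ) (1 : Fin 2) :
    EuclideanSpace ℝ (Fin 2) →L[ℝ] ℝ).hasFDerivAt (x := z)
  rw [funext (fderiv_mul_cos hf)]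
  have h2 := ((hf' (z 1)).comp_hasFDerivAt z h1).mul
    ((Real.hasDerivAt_cos (z 0)).comp_hasFDerivAt z h0)
  have h3 := ((hf (z 1)).comp_hasFDerivAt z h1).mul
    ((Real.hasDerivAt_sin (z 0)).comp_hasFDerivAt z h0)
  have h := (h2.smul_const (EuclideanSpace.proj 1 : EuclideanSpace ℝ (Fin 2) →L[ℝ] ℝ)).sub
    (h3.smul_const (EuclideanSpace.proj 0 : EuclideanSpace ℝ (Fin 2) →L[ℝ] ℝ))
  refine (congrArg (fun L : EuclideanSpace ℝ (Fin 2) →L[ℝ] EuclideanSpace ℝ (Fin 2) →L[ℝ] ℝ =>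
    L v w) h.fderiv).trans ?_
  simp
  ring

end ProductCosine

section Potential

variable {a : ℝ}

/-- The factor of `potentialAmp` other than `u`. -/
def potentialFactor (a u : ℝ) : ℝ := √(quarticA u a 1) - (a + 2 * u ^ 2) / 2

theorem potentialAmp_eq (a u : ℝ) : potentialAmp a u = u * potentialFactor a u := by
  rw [potentialAmp, potentialFactor]
  ring

/-- The factored form of the derivative shows the critical points: apart from zeros of
`potentialFactor` they lie on `√A = 2u²`. -/
theorem hasDerivAt_potentialAmp' (ha : -2 < a) (u : ℝ) :
    HasDerivAt (potentialAmp a)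
      ((√(quarticA u a 1) - 2 * u ^ 2) * (potentialFactor a u / √(quarticA u a 1))) u := by
  have hB := (Real.sqrt_pos.2 (quarticA_pos ha u)).ne'
  convert! hasDerivAt_potentialAmp ha u using 1
  rw [potentialFactor]
  field_simp
  ring

/-- The derivative of the last factor is left unevaluated. The second derivative is used only where
`√A = 2u²`, which kills this term, or where `cos φ = 0`. -/
theorem hasDerivAt_deriv_potentialAmp (ha : -2 < a) (u : ℝ) :
    HasDerivAt
      (fun u => (√(quarticA u a 1) - 2 * u ^ 2) * (potentialFactor a u / √(quarticA u a 1)))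
      (((a * u + 2 * u ^ 3) / √(quarticA u a 1) - 4 * u) *
          (potentialFactor a u / √(quarticA u a 1)) +
        (√(quarticA u a 1) - 2 * u ^ 2) *
          deriv (fun u => potentialFactor a u / √(quarticA u a 1)) u) u := by
  have hB := hasDerivAt_sqrt_quarticA ha u
  have hg : DifferentiableAt ℝ (potentialFactor a) u := by
    unfold potentialFactor
    have := hB.differentiableAt
    fun_prop
  have hk : HasDerivAt (fun u => potentialFactor a u / √(quarticA u a 1))
      (deriv (fun u => potentialFactor a u / √(quarticA u a 1)) u) u :=
    (hg.fun_div hB.differentiableAt (Real.sqrt_pos.2 (quarticA_pos ha u)).ne').hasDerivAt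
  have h2 := hB.sub ((hasDerivAt_pow 2 u).const_mul 2)
  convert! h2.mul hk using 1
  simp
  exact Or.inl (by ring)

end Potential

theorem exists_ne_zero_forall_diagonal {p q r s α : ℝ} (h : ∃ v : EuclideanSpace ℝ (Fin 2), v ≠ 0 ∧
    ∀ w : EuclideanSpace ℝ (Fin 2), p * (v 0 * w 0) + q * (v 1 * w 1) =
      α * (r * (v 0 * w 0) + s * (v 1 * w 1))) : p = α * r ∨ q = α * s := by
  obtain ⟨v, hv, h⟩ := h
  have h0 := h (EuclideanSpace.single 0 1)
  have h1 := h (EuclideanSpace.single 1 1)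
  simp at h0 h1
  by_cases hv0 : v 0 = 0
  · right
    have hv1 : v 1 ≠ 0 := by
      intro hv1
      apply hv
      ext i
      fin_cases i
      · exact hv0
      · exact hv1
    apply mul_right_cancel₀ hv1
    linear_combination h1
  · left
    apply mul_right_cancel₀ hv0
    linear_combination h0

namespace ExtendsH1

open ConservativeSystem

variable {a : ℝ} {S : ConservativeSystem 2 S2}

theorem potential_polarMap (h : ExtendsH1 a S) (z : EuclideanSpace ℝ (Fin 2)) :
    S.potential (polarMap a z) = potentialAmp a (z 1) * Real.cos (z 0) :=
  h.potential_eq (planePair z)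

theorem isCritical_polarMap_iff (ha : -2 < a) (h : ExtendsH1 a S) (z : EuclideanSpace ℝ (Fin 2)) :
    S.IsCritical (polarMap a z) ↔
      (√(quarticA (z 1) a 1) - 2 * z 1 ^ 2) * potentialFactor a (z 1) * Real.cos (z 0) = 0 ∧
        potentialAmp a (z 1) * Real.sin (z 0) = 0 := by
  have hB := (Real.sqrt_pos.2 (quarticA_pos ha (z 1))).ne'
  rw [isCritical_iff (contMDiff_polarMap ha) (bijective_mfderiv_polarMap ha z),
    funext h.potential_polarMap, fderiv_mul_cos (hasDerivAt_potentialAmp' ha)]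
  constructor
  · intro h0
    have e0 := congrArg (fun L : EuclideanSpace ℝ (Fin 2) →L[ℝ] ℝ =>
      L (EuclideanSpace.single 0 1)) h0
    have e1 := congrArg (fun L : EuclideanSpace ℝ (Fin 2) →L[ℝ] ℝ =>
      L (EuclideanSpace.single 1 1)) h0
    simp at e0 e1
    constructor
    · simp only [mul_eq_zero]
      tauto
    · simp only [mul_eq_zero]
      tauto
  · rintro ⟨h1, h2⟩
    rw [h2, show (√(quarticA (z 1) a 1) - 2 * z 1 ^ 2) *
      (potentialFactor a (z 1) / √(quarticA (z 1) a 1)) * Real.cos (z 0) =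
      (√(quarticA (z 1) a 1) - 2 * z 1 ^ 2) * potentialFactor a (z 1) * Real.cos (z 0) /
        √(quarticA (z 1) a 1) by ring, h1]
    simp

theorem isHessianEigenvalue_polarMap_iff (ha : -2 < a) (h : ExtendsH1 a S)
    (z : EuclideanSpace ℝ (Fin 2)) (α : ℝ) :
    S.IsHessianEigenvalue (polarMap a) z α ↔ ∃ v : EuclideanSpace ℝ (Fin 2), v ≠ 0 ∧
      ∀ w : EuclideanSpace ℝ (Fin 2),
        fderiv ℝ (fderiv ℝ fun z : EuclideanSpace ℝ (Fin 2) =>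
          potentialAmp a (z 1) * Real.cos (z 0)) z v w =
        α * ((√(quarticA (z 1) a 1))⁻¹ *
          (v 0 * w 0 + (√(quarticA (z 1) a 1))⁻¹ * (v 1 * w 1))) := by
  unfold IsHessianEigenvalue
  rw [funext h.potential_polarMap]
  refine exists_congr fun v => and_congr_right fun _ => forall_congr' fun w => ?_
  rw [h.metric_polarMap ha]

/-- At the critical point `φ = π / 2`, `u = 0`, where the potential vanishes, the Hessian has
eigenvalues of opposite signs. -/
theorem isHessianEigenvalue_saddle (ha : -2 < a) (h : ExtendsH1 a S) {ε : ℝ} (hε : ε ^ 2 = 1) :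
    S.IsHessianEigenvalue (polarMap a) !₂[Real.pi / 2, 0] (ε * (1 - a / 2)) := by
  rw [isHessianEigenvalue_polarMap_iff ha h]
  -- At `u = 0` one has `A = 1`, so the metric is Euclidean, and the Hessian is purely off-diagonal
  -- with entry `-(1 - a/2)`; its eigenvectors are the diagonals.
  refine ⟨!₂[1, -ε], fun h0 => ?_, fun w => ?_⟩
  · have := congrArg (fun v : EuclideanSpace ℝ (Fin 2) => v 0) h0
    simp at this
  · rw [fderiv_fderiv_mul_cos (hasDerivAt_potentialAmp' ha) (hasDerivAt_deriv_potentialAmp ha)]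
    simp [potentialFactor, quarticA]
    linear_combination (1 - a / 2) * w 1 * hε

theorem isCritical_saddle (ha : -2 < a) (h : ExtendsH1 a S) :
    S.IsCritical (polarMap a !₂[Real.pi / 2, 0]) := by
  rw [isCritical_polarMap_iff ha h]
  simp [potentialAmp_zero]

theorem potential_saddle (h : ExtendsH1 a S) :
    S.potential (polarMap a !₂[Real.pi / 2, 0]) = 0 := by
  rw [h.potential_polarMap]
  simp

/-- A nonzero value excludes the poles and makes the amplitude and `cos φ` nonzero. The two critical
equations then reduce to `sin φ = 0` and `√A = 2u²`. -/
theorem exists_of_isCritical (ha : -2 < a) (h : ExtendsH1 a S) {x : S2} (hx : S.IsCritical x)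
    (h0 : S.potential x ≠ 0) : ∃ z : EuclideanSpace ℝ (Fin 2), polarMap a z = x ∧
      Real.cos (z 0) ^ 2 = 1 ∧ √(quarticA (z 1) a 1) = 2 * z 1 ^ 2 := by
  obtain ⟨z, rfl⟩ : x ∈ Set.range (polarMap a) := by
    rw [range_polarMap]
    exact h.mem_range_of_potential_ne_zero ha h0
  refine ⟨z, rfl, ?_⟩
  rw [isCritical_polarMap_iff ha h] at hx
  rw [h.potential_polarMap] at h0
  have hA := left_ne_zero_of_mul h0
  have hc := right_ne_zero_of_mul h0
  have hg : potentialFactor a (z 1) ≠ 0 := by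
    rw [potentialAmp_eq] at hA
    exact right_ne_zero_of_mul hA
  refine ⟨?_, ?_⟩
  · have := (mul_eq_zero.1 hx.2).resolve_left hA
    have h1 := Real.sin_sq_add_cos_sq (z 0)
    rw [this] at h1
    linarith
  · have := (mul_eq_zero.1 ((mul_eq_zero.1 hx.1).resolve_right hc)).resolve_right hg
    linarith

theorem three_mul_pow_four (ha : -2 < a) {u : ℝ} (hu : √(quarticA u a 1) = 2 * u ^ 2) :
    0 < u ^ 2 ∧ 3 * (u ^ 2) ^ 2 = a * u ^ 2 + 1 := by
  have h1 := sqrt_quarticA_sq ha u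
  rw [hu] at h1
  have h2 := Real.sqrt_pos.2 (quarticA_pos ha u)
  rw [hu] at h2
  exact ⟨by linarith, by linear_combination h1⟩

/-- The roots of `3x² - a x - 1` have product `-1/3`, so only one is positive. -/
theorem eq_of_three_mul_sq {x y : ℝ} (hx : 0 < x) (hy : 0 < y) (h : 3 * x ^ 2 = a * x + 1)
    (h' : 3 * y ^ 2 = a * y + 1) : x = y := by
  have h1 : (x - y) * (3 * (x * y) + 1) = 0 := by linear_combination y * h - x * h'
  have h2 : 3 * (x * y) + 1 ≠ 0 := by positivity
  exact sub_eq_zero.1 ((mul_eq_zero.1 h1).resolve_right h2)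

theorem potential_sq_of_isCritical (h : ExtendsH1 a S) {z : EuclideanSpace ℝ (Fin 2)}
    (hc : Real.cos (z 0) ^ 2 = 1) (hu : √(quarticA (z 1) a 1) = 2 * z 1 ^ 2) :
    S.potential (polarMap a z) ^ 2 = z 1 ^ 2 * (z 1 ^ 2 - a / 2) ^ 2 := by
  rw [h.potential_polarMap, mul_pow, hc, potentialAmp_eq, potentialFactor, hu]
  ring

/-- All the nonzero critical values of the potential have the same square. -/
theorem potential_sq_eq (ha : -2 < a) (h : ExtendsH1 a S) {x y : S2} (hx : S.IsCritical x)
    (hx0 : S.potential x ≠ 0) (hy : S.IsCritical y) (hy0 : S.potential y ≠ 0) :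
    S.potential x ^ 2 = S.potential y ^ 2 := by
  obtain ⟨z, rfl, hc, hu⟩ := h.exists_of_isCritical ha hx hx0
  obtain ⟨z', rfl, hc', hu'⟩ := h.exists_of_isCritical ha hy hy0
  obtain ⟨h1, h2⟩ := three_mul_pow_four ha hu
  obtain ⟨h1', h2'⟩ := three_mul_pow_four ha hu'
  rw [h.potential_sq_of_isCritical hc hu, h.potential_sq_of_isCritical hc' hu',
    eq_of_three_mul_sq h1 h1' h2 h2']

/-- With `sin φ = 0` the mixed term disappears. In the second derivative in `u` only the derivative
of `√A - 2u²` contributes, namely `(a - 6u²)/(2u)`. -/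
theorem hessian_of_isCritical (ha : -2 < a) (h : ExtendsH1 a S) {z : EuclideanSpace ℝ (Fin 2)}
    (hc : Real.cos (z 0) ^ 2 = 1) (hu : √(quarticA (z 1) a 1) = 2 * z 1 ^ 2)
    (v w : EuclideanSpace ℝ (Fin 2)) :
    fderiv ℝ (fderiv ℝ fun z : EuclideanSpace ℝ (Fin 2) =>
        potentialAmp a (z 1) * Real.cos (z 0)) z v w =
      -S.potential (polarMap a z) * (v 0 * w 0) +
        (a - 6 * z 1 ^ 2) * S.potential (polarMap a z) / (2 * z 1 ^ 2) ^ 2 * (v 1 * w 1) := by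
  have hs : Real.sin (z 0) = 0 := by
    have h1 := Real.sin_sq_add_cos_sq (z 0)
    exact pow_eq_zero_iff (two_ne_zero) |>.1 (by linarith)
  have hpos := (three_mul_pow_four ha hu).1
  have hz : z 1 ≠ 0 := by
    intro h0
    simp [h0] at hpos
  rw [fderiv_fderiv_mul_cos (hasDerivAt_potentialAmp' ha) (hasDerivAt_deriv_potentialAmp ha),
    hs, h.potential_polarMap, hu, potentialAmp_eq]
  field_simp
  ring

theorem isHessianEigenvalue_of_isCritical (ha : -2 < a) (h : ExtendsH1 a S)
    {z : EuclideanSpace ℝ (Fin 2)} (hc : Real.cos (z 0) ^ 2 = 1)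
    (hu : √(quarticA (z 1) a 1) = 2 * z 1 ^ 2) {α : ℝ}
    (hα : S.IsHessianEigenvalue (polarMap a) z α) :
    α = -(2 * z 1 ^ 2) * S.potential (polarMap a z) ∨
      α = (a - 6 * z 1 ^ 2) * S.potential (polarMap a z) := by
  have hpos := (three_mul_pow_four ha hu).1
  have hz : 2 * z 1 ^ 2 ≠ 0 := by linarith
  have hz1 : z 1 ≠ 0 := by
    intro h0
    simp [h0] at hpos
  rw [isHessianEigenvalue_polarMap_iff ha h] at hα
  have key := exists_ne_zero_forall_diagonal (p := -S.potential (polarMap a z))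
    (q := (a - 6 * z 1 ^ 2) * S.potential (polarMap a z) / (2 * z 1 ^ 2) ^ 2)
    (r := (2 * z 1 ^ 2)⁻¹) (s := ((2 * z 1 ^ 2) ^ 2)⁻¹) (α := α) (by
      obtain ⟨v, hv, hα⟩ := hα
      refine ⟨v, hv, fun w => ?_⟩
      rw [← h.hessian_of_isCritical ha hc hu, hα, hu]
      field_simp)
  rcases key with key | key
  · left
    rw [eq_mul_inv_iff_mul_eq₀ hz] at key
    linarith
  · right
    rw [div_eq_mul_inv] at key
    exact (mul_right_cancel₀ (inv_ne_zero (pow_ne_zero 2 hz)) key).symm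

theorem isHessianEigenvalue_first (ha : -2 < a) (h : ExtendsH1 a S)
    {z : EuclideanSpace ℝ (Fin 2)} (hc : Real.cos (z 0) ^ 2 = 1)
    (hu : √(quarticA (z 1) a 1) = 2 * z 1 ^ 2) :
    S.IsHessianEigenvalue (polarMap a) z (-(2 * z 1 ^ 2) * S.potential (polarMap a z)) := by
  have hpos := (three_mul_pow_four ha hu).1
  have hz : z 1 ≠ 0 := by
    intro h0
    simp [h0] at hpos
  rw [isHessianEigenvalue_polarMap_iff ha h]
  refine ⟨EuclideanSpace.single 0 1, by simp, fun w => ?_⟩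
  rw [h.hessian_of_isCritical ha hc hu, hu]
  simp
  field_simp

theorem isHessianEigenvalue_second (ha : -2 < a) (h : ExtendsH1 a S)
    {z : EuclideanSpace ℝ (Fin 2)} (hc : Real.cos (z 0) ^ 2 = 1)
    (hu : √(quarticA (z 1) a 1) = 2 * z 1 ^ 2) :
    S.IsHessianEigenvalue (polarMap a) z ((a - 6 * z 1 ^ 2) * S.potential (polarMap a z)) := by
  have hpos := (three_mul_pow_four ha hu).1
  have hz : z 1 ≠ 0 := by
    intro h0
    simp [h0] at hpos
  rw [isHessianEigenvalue_polarMap_iff ha h]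
  refine ⟨EuclideanSpace.single 1 1, by simp, fun w => ?_⟩
  rw [h.hessian_of_isCritical ha hc hu, hu]
  simp
  field_simp

theorem exists_isCritical (ha : -2 < a) (ha2 : a ≠ 2) (h : ExtendsH1 a S) :
    ∃ z : EuclideanSpace ℝ (Fin 2), Real.cos (z 0) ^ 2 = 1 ∧
      √(quarticA (z 1) a 1) = 2 * z 1 ^ 2 ∧ S.IsCritical (polarMap a z) ∧
        S.potential (polarMap a z) ≠ 0 := by
  have hr : |a| < √(a ^ 2 + 12) := by
    rw [← Real.sqrt_sq_eq_abs]
    exact Real.sqrt_lt_sqrt (sq_nonneg a) (by linarith)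
  have hr' := Real.sq_sqrt (show 0 ≤ a ^ 2 + 12 by positivity)
  -- `u²` is taken to be the positive root `(a + √(a² + 12))/6` of `3x² = a x + 1`.
  set r := √(a ^ 2 + 12)
  have hx : 0 < (a + r) / 6 := by
    have := neg_abs_le a
    linarith
  have hu2 := Real.sq_sqrt hx.le
  set u := √((a + r) / 6)
  have hu : √(quarticA u a 1) = 2 * u ^ 2 := by
    rw [Real.sqrt_eq_iff_eq_sq (quarticA_pos ha u).le (by positivity), quarticA,
      show u ^ 4 = (u ^ 2) ^ 2 by ring, hu2]
    linear_combination (-1 / 12) * hr'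
  obtain ⟨hpos, h3⟩ := three_mul_pow_four ha hu
  refine ⟨!₂[0, u], by simp, hu, ?_, ?_⟩
  · rw [isCritical_polarMap_iff ha h]
    simp [hu]
  · intro h0
    have h1 := h.potential_sq_of_isCritical (z := !₂[0, u]) (by simp) hu
    rw [h0] at h1
    simp only [Matrix.cons_val_one, Matrix.cons_val_fin_one] at h1
    -- The critical value vanishes only for `u² = a/2`, and then `3x² = a x + 1` gives `a² = 4`.
    have h2 : u ^ 2 = a / 2 := by
      have : (u ^ 2 - a / 2) ^ 2 = 0 :=
        (mul_eq_zero.1 (h1.symm.trans (by norm_num))).resolve_left hpos.ne'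
      have := pow_eq_zero_iff (two_ne_zero) |>.1 this
      linarith
    rw [h2] at h3 hpos
    have : (a - 2) * (a + 2) = 0 := by linear_combination 4 * h3
    rcases mul_eq_zero.1 this with h | h
    · exact ha2 (by linarith)
    · linarith

theorem exists_potential_ne_zero (ha : -2 < a) (ha2 : a ≠ 2) (h : ExtendsH1 a S) :
    ∃ x, S.potential x ≠ 0 := by
  obtain ⟨z, -, -, -, hz⟩ := h.exists_isCritical ha ha2
  exact ⟨_, hz⟩

/-- If one parameter is `2`, exactly one of the potentials vanishes identically. Otherwise a
critical point of nonzero value is carried to another one. Divided by minus the critical value, the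
eigenvalues there are `2x` and `6x - a`, and these pairs correspond up to the factor `κ`. -/
theorem not_equivalent_of_ne {a₁ a₂ : ℝ} (ha₁ : -2 < a₁) (ha₂ : -2 < a₂) (hne : a₁ ≠ a₂)
    {S₁ S₂ : ConservativeSystem 2 S2} (h₁ : ExtendsH1 a₁ S₁) (h₂ : ExtendsH1 a₂ S₂) :
    ¬ S₁.Equivalent S₂ := by
  intro hE
  obtain ⟨φ, κ, κ', hκ, hκ', hg, hU⟩ := hE.exists_isometry
  by_cases e₁ : a₁ = 2
  · subst e₁
    obtain ⟨x, hx⟩ := h₂.exists_potential_ne_zero ha₂ hne.symm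
    have := hU x
    rw [h₁.potential_eq_zero] at this
    exact mul_ne_zero hκ' hx this.symm
  by_cases e₂ : a₂ = 2
  · subst e₂
    obtain ⟨x, hx⟩ := h₁.exists_potential_ne_zero ha₁ e₁
    have := hU (φ.symm x)
    rw [h₂.potential_eq_zero, mul_zero, φ.apply_symm_apply] at this
    exact hx this
  obtain ⟨z₂, hc₂, hu₂, hcr, hV⟩ := h₂.exists_isCritical ha₂ e₂
  have hcr₁ := (isCritical_diffeomorph φ hκ' hU _).2 hcr
  have hU₁ := hU (polarMap a₂ z₂)
  have hV₁ : S₁.potential (φ (polarMap a₂ z₂)) ≠ 0 := hU₁ ▸ mul_ne_zero hκ' hV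
  obtain ⟨z₁, hz, hc₁, hu₁⟩ := h₁.exists_of_isCritical ha₁ hcr₁ hV₁
  rw [← hz] at hU₁
  have key : ∀ α, S₂.IsHessianEigenvalue (polarMap a₂) z₂ α →
      S₁.IsHessianEigenvalue (polarMap a₁) z₁ (κ * κ' * α) := by
    intro α hα
    have h := (isHessianEigenvalue_diffeomorph φ hg hκ' hU (contMDiff_polarMap ha₂) z₂ α).2 hα
    exact (isHessianEigenvalue_congr (φ.contMDiff.comp (contMDiff_polarMap ha₂))
      (bijective_mfderiv_diffeomorph_comp φ (contMDiff_polarMap ha₂)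
        (bijective_mfderiv_polarMap ha₂ z₂)) (contMDiff_polarMap ha₁)
      (bijective_mfderiv_polarMap ha₁ z₁) hz.symm hcr₁ _).1 h
  have k1 := h₁.isHessianEigenvalue_of_isCritical ha₁ hc₁ hu₁
    (key _ (h₂.isHessianEigenvalue_first ha₂ hc₂ hu₂))
  have k2 := h₁.isHessianEigenvalue_of_isCritical ha₁ hc₁ hu₁
    (key _ (h₂.isHessianEigenvalue_second ha₂ hc₂ hu₂))
  obtain ⟨p₁, q₁⟩ := three_mul_pow_four ha₁ hu₁
  obtain ⟨p₂, q₂⟩ := three_mul_pow_four ha₂ hu₂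
  rw [hU₁] at k1 k2
  have hW : κ' * S₂.potential (polarMap a₂ z₂) ≠ 0 := mul_ne_zero hκ' hV
  set W := S₂.potential (polarMap a₂ z₂)
  generalize z₁ 1 ^ 2 = x₁ at *
  generalize z₂ 1 ^ 2 = x₂ at *
  -- From `x (3x - a) = 1` with `x > 0` one gets `3x > a`. Hence `2x < 6x - a`, and since `κ > 0`
  -- the smaller eigenvalue ratio must go to the smaller one.
  have m₁ : 0 < 4 * x₁ - a₁ := by
    by_contra hcon
    nlinarith
  have m₂ : 0 < 4 * x₂ - a₂ := by
    by_contra hcon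
    nlinarith
  have k1' : κ * (2 * x₂) = 2 * x₁ ∨ κ * (2 * x₂) = 6 * x₁ - a₁ := by
    refine k1.imp (fun h => ?_) fun h => ?_ <;>
    · apply mul_right_cancel₀ hW
      linear_combination -h
  have k2' : κ * (6 * x₂ - a₂) = 2 * x₁ ∨ κ * (6 * x₂ - a₂) = 6 * x₁ - a₁ := by
    refine k2.imp (fun h => ?_) fun h => ?_ <;>
    · apply mul_right_cancel₀ hW
      linear_combination -h
  have hm : 0 < κ * (4 * x₂ - a₂) := mul_pos hκ m₂
  have e1 : κ * (2 * x₂) = 2 * x₁ := by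
    rcases k1' with h | h
    · exact h
    · rcases k2' with h' | h' <;> nlinarith
  have e2 : κ * (6 * x₂ - a₂) = 6 * x₁ - a₁ := by
    rcases k2' with h | h
    · nlinarith
    · exact h
  -- With `x₁ = κ x₂` and `a₁ = κ a₂`, the expression `3x² - a x` scales by `κ²`, but it equals `1`
  -- in both systems.
  have hκ1 : κ ^ 2 = 1 := by
    have hx : x₁ = κ * x₂ := by linarith
    have ha : a₁ = κ * a₂ := by linarith
    rw [hx, ha] at q₁
    linear_combination q₁ - κ ^ 2 * q₂
  have : κ = 1 := by nlinarith
  subst this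
  exact hne (by linarith)

end ExtendsH1

end

noncomputable section

/-! ## Critical points of the Goryachev potentials -/

namespace S2

open ConservativeSystem

variable {b c : ℝ}

/-- The Goryachev potential on the ambient space, modified by a multiple of the equation of the
sphere. -/
def goryachevAmbient (b c μ : ℝ) (y : EuclideanSpace ℝ (Fin 3)) : ℝ :=
  -2 * b * y 0 * y 1 - c * (y 0 ^ 2 - y 1 ^ 2) - y 0 -
    μ / 2 * (y 0 ^ 2 + y 1 ^ 2 + y 2 ^ 2 - 1)

theorem contDiff_goryachevAmbient (b c μ : ℝ) : ContDiff ℝ ∞ (goryachevAmbient b c μ) := by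
  unfold goryachevAmbient
  fun_prop

theorem goryachev_potential (b c μ : ℝ) (x : S2) :
    (goryachev b c).potential x = goryachevAmbient b c μ x.1 := by
  rw [goryachevAmbient, coord_sq]
  simp [goryachev]

theorem fderiv_goryachevAmbient (b c μ : ℝ) (y : EuclideanSpace ℝ (Fin 3)) :
    fderiv ℝ (goryachevAmbient b c μ) y =
      (-2 * b * y 1 - 2 * c * y 0 - 1 - μ * y 0) •
          (EuclideanSpace.proj 0 : EuclideanSpace ℝ (Fin 3) →L[ℝ] ℝ) +
        (-2 * b * y 0 + 2 * c * y 1 - μ * y 1) •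
          (EuclideanSpace.proj 1 : EuclideanSpace ℝ (Fin 3) →L[ℝ] ℝ) +
        (-μ * y 2) • (EuclideanSpace.proj 2 : EuclideanSpace ℝ (Fin 3) →L[ℝ] ℝ) := by
  have hp : ∀ i : Fin 3, HasFDerivAt (fun y : EuclideanSpace ℝ (Fin 3) => y i)
      (EuclideanSpace.proj i : EuclideanSpace ℝ (Fin 3) →L[ℝ] ℝ) y := fun i =>
    (EuclideanSpace.proj (𝕜 := ℝ) i : EuclideanSpace ℝ (Fin 3) →L[ℝ] ℝ).hasFDerivAt
  have h := (((((hp 0).const_mul (-2 * b)).mul (hp 1)).sub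
    ((((hp 0).pow 2).sub ((hp 1).pow 2)).const_mul c)).sub (hp 0)).sub
      ((((((hp 0).pow 2).add ((hp 1).pow 2)).add ((hp 2).pow 2)).sub_const 1).const_mul (μ / 2))
  refine h.fderiv.trans ?_
  ext v
  simp
  ring

theorem fderiv_fderiv_goryachevAmbient (b c μ : ℝ) (y v w : EuclideanSpace ℝ (Fin 3)) :
    fderiv ℝ (fderiv ℝ (goryachevAmbient b c μ)) y v w =
      (-2 * b * v 1 - 2 * c * v 0 - μ * v 0) * w 0 + (-2 * b * v 0 + 2 * c * v 1 - μ * v 1) * w 1 -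
        μ * v 2 * w 2 := by
  have hp : ∀ i : Fin 3, HasFDerivAt (fun y : EuclideanSpace ℝ (Fin 3) => y i)
      (EuclideanSpace.proj i : EuclideanSpace ℝ (Fin 3) →L[ℝ] ℝ) y := fun i =>
    (EuclideanSpace.proj (𝕜 := ℝ) i : EuclideanSpace ℝ (Fin 3) →L[ℝ] ℝ).hasFDerivAt
  rw [funext (fderiv_goryachevAmbient b c μ)]
  have h0 := ((((hp 1).const_mul (-2 * b)).sub ((hp 0).const_mul (2 * c))).sub_const 1).sub
    ((hp 0).const_mul μ)
  have h1 := ((((hp 0).const_mul (-2 * b)).add ((hp 1).const_mul (2 * c)))).sub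
    ((hp 1).const_mul μ)
  have h2 := (hp 2).const_mul (-μ)
  have h := ((h0.smul_const (EuclideanSpace.proj 0 : EuclideanSpace ℝ (Fin 3) →L[ℝ] ℝ)).add
    (h1.smul_const (EuclideanSpace.proj 1 : EuclideanSpace ℝ (Fin 3) →L[ℝ] ℝ))).add
    (h2.smul_const (EuclideanSpace.proj 2 : EuclideanSpace ℝ (Fin 3) →L[ℝ] ℝ))
  refine (congrArg (fun L : EuclideanSpace ℝ (Fin 3) →L[ℝ] EuclideanSpace ℝ (Fin 3) →L[ℝ] ℝ =>
    L v w) h.fderiv).trans ?_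
  simp
  ring

/-- The tangent vectors of the sphere are exactly the ambient vectors orthogonal to `x`, so it
suffices to test the ambient gradient on those. -/
theorem isCritical_goryachev_iff (x : S2) : (goryachev b c).IsCritical x ↔
    ∀ y : EuclideanSpace ℝ (Fin 3), x.1 0 * y 0 + x.1 1 * y 1 + x.1 2 * y 2 = 0 →
      (-2 * b * x.1 1 - 2 * c * x.1 0 - 1) * y 0 + (-2 * b * x.1 0 + 2 * c * x.1 1) * y 1 = 0 := by
  have hfun : (goryachev b c).potential = fun x : S2 => goryachevAmbient b c 0 x.1 :=
    funext (goryachev_potential b c 0)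
  have hd : ∀ v : TangentSpace (𝓡 2) x, mfderiv (𝓡 2) 𝓘(ℝ, ℝ) (goryachev b c).potential x v =
      (-2 * b * x.1 1 - 2 * c * x.1 0 - 1) * dcoe x v 0 +
        (-2 * b * x.1 0 + 2 * c * x.1 1) * dcoe x v 1 := by
    intro v
    have h := mfderiv_comp x
      ((contDiff_goryachevAmbient b c 0).contMDiff.mdifferentiableAt (n := ∞) (x := x.1) (by simp))
      ((contMDiff_coe x).mdifferentiableAt (by simp))
    rw [hfun]
    refine (congrArg (fun L : EuclideanSpace ℝ (Fin 2) →L[ℝ] ℝ => L v) h).trans ?_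
    refine (congrArg (fun L : EuclideanSpace ℝ (Fin 3) →L[ℝ] ℝ => L (dcoe x v))
      (mfderiv_eq_fderiv.trans (fderiv_goryachevAmbient b c 0 x.1))).trans ?_
    simp
  have hin : ∀ y : EuclideanSpace ℝ (Fin 3),
      inner ℝ x.1 y = x.1 0 * y 0 + x.1 1 * y 1 + x.1 2 * y 2 := by
    intro y
    simp [PiLp.inner_apply, Fin.sum_univ_three]
    ring
  constructor
  · intro h y hy
    rw [← hin, ← range_dcoe] at hy
    obtain ⟨v, rfl⟩ := hy
    rw [← hd v]
    exact congrArg (fun L : EuclideanSpace ℝ (Fin 2) →L[ℝ] ℝ => L v) h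
  · intro h
    refine ContinuousLinearMap.ext fun v => (hd v).trans (h _ ?_)
    rw [← hin, inner_dcoe]

/-- An eigenvalue of the Hessian at a critical point of the equator with critical value zero. -/
theorem eigenvalue_of_isCritical {P : EuclideanSpace ℝ (Fin 2) → S2}
    (hP : ContMDiff (𝓡 2) (𝓡 2) ∞ P) {z : EuclideanSpace ℝ (Fin 2)}
    (hb : Function.Bijective (mfderiv (𝓡 2) (𝓡 2) P z)) (hx : (goryachev b c).IsCritical (P z))
    (hV : (goryachev b c).potential (P z) = 0) (h2 : (P z).1 2 = 0) {β : ℝ}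
    (hβ : (goryachev b c).IsHessianEigenvalue P z β) :
    β = -(P z).1 0 ∨ β = -6 * (P z).1 0 := by
  have hs := coord_sq (P z)
  rw [isCritical_goryachev_iff] at hx
  have hT := hx !₂[-(P z).1 1, (P z).1 0, 0] (by simp; ring)
  simp only [Matrix.cons_val_zero, Matrix.cons_val_one] at hT
  have hV' : -2 * b * (P z).1 0 * (P z).1 1 - c * ((P z).1 0 ^ 2 - (P z).1 1 ^ 2) - (P z).1 0 = 0 :=
    hV
  obtain ⟨v, hv, hβ⟩ := hβ
  have hι : ContDiff ℝ ∞ fun z => (P z).1 := (contMDiff_coe.comp hP).contDiff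
  have hDι : ∀ v : EuclideanSpace ℝ (Fin 2),
      dcoe (P z) (mfderiv (𝓡 2) (𝓡 2) P z v) = fderiv ℝ (fun z => (P z).1) z v := fun v =>
    dcoe_mfderiv ((hP z).mdifferentiableAt (by simp)) v
  have hx0 : (P z).1 0 ^ 2 + (P z).1 1 ^ 2 = 1 := by rw [h2] at hs; linarith
  -- The Lagrange multiplier is `μ = x₀`. Indeed the potential is `Q - x₀` with `Q` quadratic, its
  -- radial derivative is `2Q - x₀`, and the critical value zero means `Q = x₀`. With this `μ` the
  -- full gradient of `goryachevAmbient` vanishes, so its ambient Hessian restricts to the one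
  -- sought.
  have g0 : -2 * b * (P z).1 1 - 2 * c * (P z).1 0 - 1 - (P z).1 0 * (P z).1 0 = 0 := by
    linear_combination (-2 * b * (P z).1 1 - 2 * c * (P z).1 0 - 1) * (-hx0) -
      (P z).1 1 * hT + 2 * (P z).1 0 * hV'
  have g1 : -2 * b * (P z).1 0 + 2 * c * (P z).1 1 - (P z).1 0 * (P z).1 1 = 0 := by
    linear_combination (-2 * b * (P z).1 0 + 2 * c * (P z).1 1) * (-hx0) +
      (P z).1 0 * hT + 2 * (P z).1 1 * hV'
  have hgrad : fderiv ℝ (goryachevAmbient b c ((P z).1 0)) (P z).1 = 0 := by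
    rw [fderiv_goryachevAmbient, g0, g1, h2]
    simp
  have key : ∀ w : EuclideanSpace ℝ (Fin 2), fderiv ℝ (fderiv ℝ (goryachevAmbient b c ((P z).1 0)))
      (P z).1 (dcoe (P z) (mfderiv (𝓡 2) (𝓡 2) P z v)) (dcoe (P z) (mfderiv (𝓡 2) (𝓡 2) P z w)) =
      β * kovalevskayaForm (P z) (mfderiv (𝓡 2) (𝓡 2) P z v) (mfderiv (𝓡 2) (𝓡 2) P z w) := by
    intro w
    rw [hDι, hDι, ← fderiv_fderiv_comp_of_fderiv_eq_zero (contDiff_goryachevAmbient _ _ _)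
      hι.contDiffAt hgrad]
    refine Eq.trans ?_ (hβ w)
    rw [funext fun z' => goryachev_potential b c ((P z).1 0) (P z')]
  have hα : 2 * (P z).1 0 ^ 2 + 2 * (P z).1 1 ^ 2 + (P z).1 2 ^ 2 = 2 := by
    rw [h2]
    linarith
  have hy : ∀ y : EuclideanSpace ℝ (Fin 3), (P z).1 0 * y 0 + (P z).1 1 * y 1 = 0 →
      ∃ w : EuclideanSpace ℝ (Fin 2), dcoe (P z) (mfderiv (𝓡 2) (𝓡 2) P z w) = y := by
    intro y hy
    obtain ⟨v', hv'⟩ := (range_dcoe (P z) y).2 (by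
      simp [PiLp.inner_apply, Fin.sum_univ_three, h2]
      linarith)
    obtain ⟨w, hw⟩ : ∃ w : EuclideanSpace ℝ (Fin 2), mfderiv (𝓡 2) (𝓡 2) P z w = v' := hb.2 v'
    exact ⟨w, by rw [hw, hv']⟩
  have key' : ∀ y : EuclideanSpace ℝ (Fin 3), (P z).1 0 * y 0 + (P z).1 1 * y 1 = 0 →
      fderiv ℝ (fderiv ℝ (goryachevAmbient b c ((P z).1 0)))
        (P z).1 (dcoe (P z) (mfderiv (𝓡 2) (𝓡 2) P z v)) y =
      β * (2⁻¹ * (dcoe (P z) (mfderiv (𝓡 2) (𝓡 2) P z v) 0 * y 0 +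
        dcoe (P z) (mfderiv (𝓡 2) (𝓡 2) P z v) 1 * y 1 +
          2 * (dcoe (P z) (mfderiv (𝓡 2) (𝓡 2) P z v) 2 * y 2))) := by
    intro y hyx
    obtain ⟨w, rfl⟩ := hy y hyx
    refine (key w).trans ?_
    rw [kovalevskayaForm_apply, hα]
    rfl
  have hv0 : dcoe (P z) (mfderiv (𝓡 2) (𝓡 2) P z v) ≠ 0 := fun h =>
    hv (hb.1 (dcoe_injective _ (h.trans (map_zero _).symm) |>.trans (map_zero _).symm))
  have hort := inner_dcoe (P z) (mfderiv (𝓡 2) (𝓡 2) P z v)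
  generalize dcoe (P z) (mfderiv (𝓡 2) (𝓡 2) P z v) = y at key' hv0 hort
  have hort' : (P z).1 0 * y 0 + (P z).1 1 * y 1 = 0 := by
    simp [PiLp.inner_apply, Fin.sum_univ_three, h2] at hort
    linarith
  have k2 := key' (EuclideanSpace.single 2 1) (by simp)
  have kT := key' !₂[-(P z).1 1, (P z).1 0, 0] (by simp; ring)
  rw [fderiv_fderiv_goryachevAmbient] at k2 kT
  simp at k2 kT
  by_cases hy2 : y 2 = 0
  · right
    have ht : -(P z).1 1 * y 0 + (P z).1 0 * y 1 ≠ 0 := by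
      intro ht
      apply hv0
      ext i
      fin_cases i
      · change y 0 = 0
        linear_combination (P z).1 0 * hort' - (P z).1 1 * ht - y 0 * hx0
      · change y 1 = 0
        linear_combination (P z).1 1 * hort' + (P z).1 0 * ht - y 1 * hx0
      · exact hy2
    apply mul_right_cancel₀ ht
    have q0 : y 0 = -(P z).1 1 * (-(P z).1 1 * y 0 + (P z).1 0 * y 1) := by
      linear_combination (P z).1 0 * hort' - y 0 * hx0
    have q1 : y 1 = (P z).1 0 * (-(P z).1 1 * y 0 + (P z).1 0 * y 1) := by
      linear_combination (P z).1 1 * hort' - y 1 * hx0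
    -- Along the equator: `Q` is harmonic in the plane, so its value on the unit tangent is `-Q =
    -- -x₀`. The second derivative is `-2x₀ - μ = -3x₀`, and the metric coefficient `1/2` gives
    -- `-6x₀`.
    linear_combination (-2) * kT +
      2 * (-2 * b * (P z).1 0 + 2 * c * (P z).1 1 + (P z).1 0 * (P z).1 1) * q0 +
      2 * (2 * b * (P z).1 1 + 2 * c * (P z).1 0 - (P z).1 0 ^ 2) * q1 -
      4 * (-(P z).1 1 * y 0 + (P z).1 0 * y 1) * hV' -
      2 * (-(P z).1 1 * y 0 + (P z).1 0 * y 1) * (P z).1 0 * hx0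
  · left
    apply mul_right_cancel₀ hy2
    linear_combination -k2

/-- A critical point with critical value zero at which the Hessian has opposite eigenvalues. -/
theorem parameters_of_saddle {P : EuclideanSpace ℝ (Fin 2) → S2}
    (hP : ContMDiff (𝓡 2) (𝓡 2) ∞ P) {z : EuclideanSpace ℝ (Fin 2)}
    (hb : Function.Bijective (mfderiv (𝓡 2) (𝓡 2) P z)) (hx : (goryachev b c).IsCritical (P z))
    (hV : (goryachev b c).potential (P z) = 0) {β : ℝ} (hβ0 : β ≠ 0)
    (hβ : (goryachev b c).IsHessianEigenvalue P z β)
    (hβ' : (goryachev b c).IsHessianEigenvalue P z (-β)) : c = 0 ∧ 1 < 4 * b ^ 2 := by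
  by_cases h2 : (P z).1 2 = 0
  · exfalso
    have h1 := eigenvalue_of_isCritical hP hb hx hV h2 hβ
    have h1' := eigenvalue_of_isCritical hP hb hx hV h2 hβ'
    -- Eigenvalues among `-x₀` and `-6x₀` cannot be opposite unless they vanish.
    rcases h1 with h | h <;> rcases h1' with h' | h' <;> exact hβ0 (by linarith)
  · rw [isCritical_goryachev_iff] at hx
    have hV' : -2 * b * (P z).1 0 * (P z).1 1 - c * ((P z).1 0 ^ 2 - (P z).1 1 ^ 2) -
      (P z).1 0 = 0 := hV
    have hs := coord_sq (P z)
    have e0 := hx !₂[(P z).1 2, 0, -(P z).1 0] (by simp; ring)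
    have e1 := hx !₂[0, (P z).1 2, -(P z).1 1] (by simp; ring)
    simp only [Matrix.cons_val_zero, Matrix.cons_val_one, mul_zero, add_zero, zero_add] at e0 e1
    have g0 := (mul_eq_zero.1 e0).resolve_right h2
    have g1 := (mul_eq_zero.1 e1).resolve_right h2
    generalize (P z).1 0 = x at *
    generalize (P z).1 1 = y at *
    -- Off the equator both horizontal derivatives vanish, so Euler's relation gives `2Q = x`, while
    -- the zero value gives `Q = x`.
    have hx0 : x = 0 := by linear_combination x * g0 + y * g1 - 2 * hV'
    subst hx0
    have hby : 2 * b * y = -1 := by linear_combination -g0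
    have hy : y ≠ 0 := by
      rintro rfl
      norm_num at hby
    have hc : c * y = 0 := by linear_combination g1 / 2
    refine ⟨(mul_eq_zero.1 hc).resolve_right hy, ?_⟩
    have h3 : 0 < (P z).1 2 ^ 2 := by positivity
    have h4 : 4 * b ^ 2 * y ^ 2 = 1 := by linear_combination (2 * b * y - 1) * hby
    have hb2 : 0 < b ^ 2 := by
      have : b ≠ 0 := by
        rintro rfl
        norm_num at hby
      positivity
    nlinarith

/-- The point of the equator with second coordinate `s` and positive first coordinate. -/
def equatorPoint (s : ℝ) (hs : s ∈ Set.Ioo (-1 : ℝ) 1) : S2 :=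
  ⟨!₂[√(1 - s ^ 2), s, 0], by
    have h : 0 ≤ 1 - s ^ 2 := by nlinarith [hs.1, hs.2]
    rw [mem_sphere_zero_iff_norm, EuclideanSpace.norm_eq, Real.sqrt_eq_one, Fin.sum_univ_three]
    simp [Real.sq_sqrt h]⟩

/-- The polynomial is the derivative of the potential along the unit tangent of the equator; the
vertical derivative vanishes by the symmetry `u₃ ↦ -u₃`. -/
theorem isCritical_equatorPoint {s : ℝ} (hs : s ∈ Set.Ioo (-1 : ℝ) 1)
    (h : 4 * b * s ^ 2 + s - 2 * b = 0) : (goryachev b 0).IsCritical (equatorPoint s hs) := by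
  have h' : 0 ≤ 1 - s ^ 2 := by nlinarith [hs.1, hs.2]
  have hc := Real.sq_sqrt h'
  rw [isCritical_goryachev_iff]
  intro y hy
  simp [equatorPoint] at hy ⊢
  generalize √(1 - s ^ 2) = r at *
  have e0 : y 0 = -s * (r * y 1 - s * y 0) := by linear_combination -y 0 * hc + r * hy
  have e1 : y 1 = r * (r * y 1 - s * y 0) := by linear_combination -y 1 * hc + s * hy
  linear_combination (-(2 * b * s) - 1) * e0 - 2 * b * r * e1 + (r * y 1 - s * y 0) * h -
    2 * b * (r * y 1 - s * y 0) * hc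

/-- The squared value is `(1 - s²)(1 + 2bs)²`. After multiplication by `4b` it reduces, modulo the
quadratic equation for `s`, to an affine function with slope `8b² + 1/4 ≠ 0`, so different roots
give different squares. -/
theorem potential_equatorPoint_sq {s : ℝ} (hs : s ∈ Set.Ioo (-1 : ℝ) 1)
    (h : 4 * b * s ^ 2 + s - 2 * b = 0) :
    4 * b * (goryachev b 0).potential (equatorPoint s hs) ^ 2 =
      2 * b + 4 * b ^ 3 + 3 / 2 * b + (8 * b ^ 2 + 1 / 4) * s := by
  have h' : 0 ≤ 1 - s ^ 2 := by nlinarith [hs.1, hs.2]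
  have hc := Real.sq_sqrt h'
  simp [goryachev, equatorPoint]
  generalize √(1 - s ^ 2) = r at *
  linear_combination 4 * b * (1 + 2 * b * s) ^ 2 * hc +
    (-4 * b ^ 2 * s ^ 2 - 3 * b * s + 2 * b ^ 2 - 1 / 4) * h

theorem potential_equatorPoint_ne_zero (hb : 1 < 4 * b ^ 2) {s : ℝ} (hs : s ∈ Set.Ioo (-1 : ℝ) 1)
    (h : 4 * b * s ^ 2 + s - 2 * b = 0) :
    (goryachev b 0).potential (equatorPoint s hs) ≠ 0 := by
  have h' : 0 < 1 - s ^ 2 := by nlinarith [hs.1, hs.2]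
  have hr := Real.sqrt_pos.2 h'
  simp [goryachev, equatorPoint]
  generalize √(1 - s ^ 2) = r at *
  intro h0
  have h1 : 2 * b * s = -1 := by
    apply mul_right_cancel₀ hr.ne'
    linear_combination -h0
  have h2 : s = -2 * b := by linear_combination -h + 2 * s * h1
  rw [h2] at h1
  linarith

theorem exists_two_roots (hb : 1 < 4 * b ^ 2) : ∃ s ∈ Set.Ioo (-1 : ℝ) 1, ∃ t ∈ Set.Ioo (-1 : ℝ) 1,
    s ≠ t ∧ 4 * b * s ^ 2 + s - 2 * b = 0 ∧ 4 * b * t ^ 2 + t - 2 * b = 0 := by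
  have hb0 : b ≠ 0 := by
    rintro rfl
    norm_num at hb
  have habs : 1 < 2 * |b| := by
    by_contra hcon
    nlinarith [abs_nonneg b, sq_abs b]
  have hbb : |b| * |b| = b * b := abs_mul_abs_self b
  have h1 : 0 < 2 * (b * b) + b := by nlinarith [neg_abs_le b, abs_nonneg b]
  have h2 : 0 < 2 * (b * b) - b := by nlinarith [le_abs_self b, abs_nonneg b]
  have h0 : 0 < b * b := mul_self_pos.2 hb0
  -- The extra factor `b` makes the signs independent of that of `b`: the value is `-2b² < 0` at `0`
  -- and `2b² ± b > 0` at `±1`.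
  have hcont : Continuous fun s : ℝ => b * (4 * b * s ^ 2 + s - 2 * b) := by fun_prop
  obtain ⟨s, hs, hs0⟩ := intermediate_value_Ioo (show (0 : ℝ) ≤ 1 by norm_num) hcont.continuousOn
    (show (0 : ℝ) ∈ _ by constructor <;> norm_num <;> linarith)
  obtain ⟨t, ht, ht0⟩ := intermediate_value_Ioo' (show (-1 : ℝ) ≤ 0 by norm_num)
    hcont.continuousOn (show (0 : ℝ) ∈ _ by constructor <;> norm_num <;> linarith)
  refine ⟨s, ⟨by linarith [hs.1], hs.2⟩, t, ⟨ht.1, by linarith [ht.2]⟩, ?_,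
    (mul_eq_zero.1 hs0).resolve_left hb0, (mul_eq_zero.1 ht0).resolve_left hb0⟩
  have := hs.1
  have := ht.2
  intro h
  linarith

theorem kovalevskaya_eq : kovalevskaya = goryachev 0 0 := by
  simp [kovalevskaya, goryachev]

end S2

/-- For `a ≠ 2`, the saddle of value zero restricts the Goryachev parameters by
`parameters_of_saddle`. For these parameters the two equatorial critical points contradict
`potential_sq_eq`. -/
theorem ExtendsH1.not_equivalent_goryachev {a : ℝ} (ha : -2 < a) {S : ConservativeSystem 2 S2}
    (h : ExtendsH1 a S) (b c : ℝ) : ¬ S.Equivalent (S2.goryachev b c) := by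
  intro hE
  obtain ⟨φ, κ, κ', hκ, hκ', hg, hU⟩ := hE.exists_isometry
  by_cases ha2 : a = 2
  · subst ha2
    have h0 : ∀ x : S2, (S2.goryachev b c).potential x = 0 := fun x =>
      (mul_eq_zero.1 ((hU x).symm.trans (h.potential_eq_zero _))).resolve_left hκ'
    -- At `(±1, 0, 0)` the Goryachev potential is `-c ∓ 1`, so it cannot vanish identically.
    have h1 := h0 ⟨!₂[1, 0, 0], by simp [EuclideanSpace.norm_eq, Fin.sum_univ_three]⟩
    have h2 := h0 ⟨!₂[-1, 0, 0], by simp [EuclideanSpace.norm_eq, Fin.sum_univ_three]⟩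
    simp [S2.goryachev] at h1 h2
    linarith
  have hQ : ContMDiff (𝓡 2) (𝓡 2) ∞ (φ.symm ∘ polarMap a) :=
    φ.symm.contMDiff.comp (contMDiff_polarMap ha)
  have hφQ : φ ∘ φ.symm ∘ polarMap a = polarMap a := funext fun z => φ.apply_symm_apply _
  have hb := ConservativeSystem.bijective_mfderiv_diffeomorph_comp φ.symm (contMDiff_polarMap ha)
    (bijective_mfderiv_polarMap ha !₂[Real.pi / 2, 0])
  have hcr : (S2.goryachev b c).IsCritical ((φ.symm ∘ polarMap a) !₂[Real.pi / 2, 0]) := by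
    rw [← ConservativeSystem.isCritical_diffeomorph φ hκ' hU]
    simpa using h.isCritical_saddle ha
  have hV : (S2.goryachev b c).potential ((φ.symm ∘ polarMap a) !₂[Real.pi / 2, 0]) = 0 := by
    have h1 := hU ((φ.symm ∘ polarMap a) !₂[Real.pi / 2, 0])
    rw [Function.comp_apply, φ.apply_symm_apply, h.potential_saddle] at h1
    exact (mul_eq_zero.1 h1.symm).resolve_left hκ'
  have heig : ∀ ε : ℝ, ε ^ 2 = 1 → (S2.goryachev b c).IsHessianEigenvalue (φ.symm ∘ polarMap a)
      !₂[Real.pi / 2, 0] (ε * ((1 - a / 2) / (κ * κ'))) := by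
    intro ε hε
    rw [← ConservativeSystem.isHessianEigenvalue_diffeomorph φ hg hκ' hU hQ, hφQ]
    convert! h.isHessianEigenvalue_saddle ha hε using 1
    have := hκ.ne'
    field_simp
  have hβ : (1 - a / 2) / (κ * κ') ≠ 0 := by
    refine div_ne_zero (fun h0 => ha2 (by linarith)) (mul_ne_zero hκ.ne' hκ')
  obtain ⟨rfl, hb1⟩ := S2.parameters_of_saddle hQ hb hcr hV hβ
    (by simpa using heig 1 (by norm_num)) (by simpa using heig (-1) (by norm_num))
  obtain ⟨s, hs, t, ht, hne, es, et⟩ := S2.exists_two_roots hb1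
  have key : ∀ x : S2, (S2.goryachev b 0).IsCritical x → (S2.goryachev b 0).potential x ≠ 0 →
      S.IsCritical (φ x) ∧ S.potential (φ x) ≠ 0 := fun x hx hx0 =>
    ⟨(ConservativeSystem.isCritical_diffeomorph φ hκ' hU x).2 hx,
      hU x ▸ mul_ne_zero hκ' hx0⟩
  obtain ⟨c1, v1⟩ := key _ (S2.isCritical_equatorPoint hs es)
    (S2.potential_equatorPoint_ne_zero hb1 hs es)
  obtain ⟨c2, v2⟩ := key _ (S2.isCritical_equatorPoint ht et)
    (S2.potential_equatorPoint_ne_zero hb1 ht et)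
  have hsq := h.potential_sq_eq ha c1 v1 c2 v2
  rw [hU, hU, mul_pow, mul_pow] at hsq
  have hsq' := mul_left_cancel₀ (pow_ne_zero 2 hκ') hsq
  have e1 := S2.potential_equatorPoint_sq hs es
  have e2 := S2.potential_equatorPoint_sq ht et
  rw [hsq'] at e1
  apply hne
  have h8 : 8 * b ^ 2 + 1 / 4 ≠ 0 := by positivity
  apply mul_left_cancel₀ h8
  linear_combination e2 - e1

end

/-! ### Assembly of the theorem. -/

theorem mainTheorem1 :
    (∀ a : ℝ, -2 < a →
      -- `(φ, u)` with `φ ∈ [0, 2π)`, `u ∈ ℝ` are coordinates on the sphere without the poles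
      Set.BijOn (polarParam a) (Set.Ico 0 (2 * Real.pi) ×ˢ Set.univ)
        {x : S2 | x.1 2 ≠ 1 ∧ x.1 2 ≠ -1} ∧
      -- the Hamiltonian extends to the whole sphere
      (∃! S : ConservativeSystem 2 S2, ExtendsH1 a S) ∧
      ∀ S : ConservativeSystem 2 S2, ExtendsH1 a S →
        S.HasIntegralOfDegree 4 ∧
        (a ≠ 2 → ∀ F : PhaseFunction 2 S2, S.IsFirstIntegral F → F.PolynomialInMomenta 2 →
          F.EverywhereDependent S.hamiltonian) ∧
        (a = 2 → (∃ c : ℝ, 0 < c ∧ S.metric.HasConstantCurvature c) ∧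
          ∀ x : S2, S.potential x = 0) ∧
        ¬ S.Equivalent S2.kovalevskaya ∧
        ∀ B₁ B₂ : ℝ, ¬ S.Equivalent (S2.goryachev B₁ B₂)) ∧
    ∀ a₁ a₂ : ℝ, -2 < a₁ → -2 < a₂ → a₁ ≠ a₂ →
      ∀ S₁ S₂ : ConservativeSystem 2 S2, ExtendsH1 a₁ S₁ → ExtendsH1 a₂ S₂ →
        ¬ S₁.Equivalent S₂ := by
  refine ⟨fun a ha => ⟨bijOn_polarParam ha, existsUnique_extendsH1 ha, fun S h =>
    ⟨h.hasIntegralOfDegree_four ha, fun ha2 F hF hF2 => h.everywhereDependent ha ha2 hF hF2, ?_,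
      ?_, h.not_equivalent_goryachev ha⟩⟩, fun a₁ a₂ ha₁ ha₂ hne S₁ S₂ h₁ h₂ =>
        ExtendsH1.not_equivalent_of_ne ha₁ ha₂ hne h₁ h₂⟩
  · rintro rfl
    exact ⟨⟨1, one_pos, h.hasConstantCurvature⟩, h.potential_eq_zero⟩
  · rw [S2.kovalevskaya_eq]
    exact h.not_equivalent_goryachev ha 0 0
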